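/- **Setting.** Let $M,Q\in\mathbb R$ with $|Q|<\frac{\sqrt{15}}{4}M$. Put $r_\pm=M\pm\sqrt{M^2-Q^2}$ and let $r=r(u,v)>r_+$ be defined by $r_\star(r)=v-u$, where $\frac{dr_\star}{dr}=(1-\frac{2M}{r}+\frac{Q^2}{r^2})^{-1}$. Let $\Omega^2=1-\frac{2M}{r}+\frac{Q^2}{r^2}$, so that $-4\Omega^2\,du\,dv+r^2\gamma_{S^2}$ is the exterior Reissner--Nordström metric. Background values: $\mathrm{tr}\chi=\frac{2\Omega}{r}=-\mathrm{tr}\underline\chi$, $\omega=\frac{M}{r^2}-\frac{Q^2}{r^3}=-\underline\omega$, $\hat\omega=\Omega^{-1}\omega=-\hat{\underline\omega}$, $\rho=-\frac{2M}{r^3}+\frac{2Q^2}{r^4}$, $\rho_F=\frac{Q}{r^2}$. The operators $\nabla$ (covariant derivative), $\mathrm{div}$, $\mathrm{curl}$, $\Delta$, norms $|\cdot|$ and $\varepsilon_{AB}$ are those of the sphere $S^2_{u,v}$ with metric $r^2\gamma_{S^2}$; $\nabla_3,\nabla_4$ are the projections to $S^2_{u,v}$ of the covariant derivatives along $\Omega^{-1}\partial_u,\Omega^{-1}\partial_v$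 (so $\Omega^{-1}\partial_u,\Omega^{-1}\partial_v$ on orthonormal components); $\nabla_T=\frac{\Omega}{2}(\nabla_3+\nabla_4)$; $D_1^*(f_1,f_2)_A=-\nabla_Af_1+\varepsilon_{AB}\nabla^Bf_2$; $D_2^*\xi_{AB}=-\frac12(\nabla_A\xi_B+\nabla_B\xi_A-\mathrm{div}\,\xi\, g_{AB})$, $g=r^2\gamma_{S^2}$. All integrals over $S^2$ use the area form $\varepsilon_{S^2}$ of the unit sphere, and $\|\Theta\|_{u,v}^2=\int_{S^2}|\Theta|^2(u,v,\cdot)\,\varepsilon_{S^2}$. **Solutions.** Fix $u_0,v_0$. A solution $\mathcal S$ consists of smooth $S^2_{u,v}$-tensor fields on $\{u\ge u_0,\ v\ge v_0\}\times S^2$ (dots denote linearised quantities): scalars $\dot s$ (for $\sqrt g^{(1)}/\sqrt g$), $\dot w$ (for $\Omega^{-1}\Omega^{(1)}$), $\dot\tau$ and $\dot{\underline\tau}$ (for the linearised $\Omega\mathrm{tr}\chi$ and $\Omega\mathrm{tr}\underline\chi$), $\dot\omega,\dot{\underline\omega},\dot\rho,\dot\sigma,\dot K,\dot\rho_F,\dot\sigma_F$;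 one-forms $\dot b,\dot\eta,\dot{\underline\eta},\dot\beta,\dot{\underline\beta},\dot\beta_F,\dot{\underline\beta}_F$; symmetric traceless 2-tensors $\dot{\hat g},\dot{\hat\chi},\dot{\underline{\hat\chi}},\dot\alpha,\dot{\underline\alpha}$; satisfying the linearised Einstein--Maxwell equations: *Null structure:* $\partial_u\dot s=\dot{\underline\tau}$, $\partial_v\dot s=\dot\tau-\mathrm{div}\,\dot b$; $r^2\partial_u(r^{-2}\dot{\hat g}_{AB})=2\Omega\dot{\underline{\hat\chi}}_{AB}$, $r^2\partial_v(r^{-2}\dot{\hat g}_{AB})=2\Omega\dot{\hat\chi}_{AB}+2(D_2^*\dot b)_{AB}$; $\partial_u\dot b^A=2\Omega^2(\dot\eta-\dot{\underline\eta})^A$ (coordinate components on the sphere); $\partial_v\dot w=\dot\omega$, $\partial_u\dot w=\dot{\underline\omega}$, $2\nabla\dot w=\dot\eta+\dot{\underline\eta}$; $$\partial_v\dot{\underline\tau}=\Omega^2(2\mathrm{div}\dot{\underline\eta}+2\dot\rho+4\rho\dot w)-\tfrac12\Omega\mathrm{tr}\chi(\dot{\underline\tau}-\dot\tau),\qquad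 \partial_u\dot\tau=\Omega^2(2\mathrm{div}\dot\eta+2\dot\rho+4\rho\dot w)-\tfrac12\Omega\mathrm{tr}\chi(\dot{\underline\tau}-\dot\tau),$$ $$\partial_v\dot\tau=-\Omega\mathrm{tr}\chi\,\dot\tau+2\omega\dot\tau+2\Omega\mathrm{tr}\chi\,\dot\omega,\qquad \partial_u\dot{\underline\tau}=-\Omega\mathrm{tr}\underline\chi\,\dot{\underline\tau}+2\underline\omega\dot{\underline\tau}+2\Omega\mathrm{tr}\underline\chi\,\dot{\underline\omega},$$ $$\nabla_3(\Omega^{-1}\dot{\underline{\hat\chi}})+\Omega^{-1}\mathrm{tr}\underline\chi\dot{\underline{\hat\chi}}=-\Omega^{-1}\dot{\underline\alpha},\qquad \nabla_4(\Omega^{-1}\dot{\hat\chi})+\Omega^{-1}\mathrm{tr}\chi\dot{\hat\chi}=-\Omega^{-1}\dot\alpha,$$ $$\nabla_3(\Omega\dot{\hat\chi})+\tfrac12\Omega\mathrm{tr}\underline\chi\dot{\hat\chi}+\tfrac12\Omega\mathrm{tr}\chi\dot{\underline{\hat\chi}}=-2\Omega D_2^*\dot\eta,\qquad \nabla_4(\Omega\dot{\underline{\hat\chi}})+\tfrac12\Omega\mathrm{tr}\chi\dot{\underline{\hat\chi}}+\tfrac12\Omega\mathrm{tr}\underline\chi\dot{\hat\chi}=-2\Omega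 D_2^*\dot{\underline\eta},$$ $$\nabla_3\dot{\underline\eta}=\tfrac12\mathrm{tr}\underline\chi(\dot\eta-\dot{\underline\eta})+\dot{\underline\beta}+\rho_F\dot{\underline\beta}_F,\qquad \nabla_4\dot\eta=-\tfrac12\mathrm{tr}\chi(\dot\eta-\dot{\underline\eta})-\dot\beta-\rho_F\dot\beta_F,$$ $$\nabla_4\dot{\underline\eta}=\tfrac2\Omega\nabla\dot\omega-\mathrm{tr}\chi\dot{\underline\eta}+\dot\beta+\rho_F\dot\beta_F,\qquad \nabla_3\dot\eta=\tfrac2\Omega\nabla\dot{\underline\omega}-\mathrm{tr}\underline\chi\dot\eta-\dot{\underline\beta}-\rho_F\dot{\underline\beta}_F,$$ $$\mathrm{curl}\,\dot\eta=\dot\sigma=-\mathrm{curl}\,\dot{\underline\eta},\qquad \partial_v\dot{\underline\omega}=\partial_u\dot\omega=-\Omega^2\big(\dot\rho+2\rho_F\dot\rho_F+2(\rho+\rho_F^2)\dot w\big),$$ $$\mathrm{div}\dot{\underline{\hat\chi}}=-\tfrac12\mathrm{tr}\underline\chi\dot\eta+\dot{\underline\beta}-\rho_F\dot{\underline\beta}_F+\tfrac1{2\Omega}\nabla\dot{\underline\tau},\qquad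 \mathrm{div}\dot{\hat\chi}=-\tfrac12\mathrm{tr}\chi\dot{\underline\eta}-\dot\beta+\rho_F\dot\beta_F+\tfrac1{2\Omega}\nabla\dot\tau,$$ $$\dot K=-\dot\rho+2\rho_F\dot\rho_F-\tfrac14\tfrac{\mathrm{tr}\chi}{\Omega}(\dot{\underline\tau}-\dot\tau)+\tfrac12\dot w\,\mathrm{tr}\chi\,\mathrm{tr}\underline\chi .$$ *Maxwell:* $$\nabla_3\dot\beta_F+(\tfrac12\mathrm{tr}\underline\chi+\hat{\underline\omega})\dot\beta_F=-D_1^*(\dot\rho_F,\dot\sigma_F)+2\rho_F\dot\eta,\qquad \nabla_4\dot{\underline\beta}_F+(\tfrac12\mathrm{tr}\chi+\hat\omega)\dot{\underline\beta}_F=D_1^*(\dot\rho_F,-\dot\sigma_F)-2\rho_F\dot{\underline\eta},$$ $$\nabla_3\dot\rho_F+\mathrm{tr}\underline\chi\dot\rho_F=-\mathrm{div}\dot{\underline\beta}_F-\tfrac{\rho_F}\Omega\dot{\underline\tau},\qquad \nabla_4\dot\rho_F+\mathrm{tr}\chi\dot\rho_F=\mathrm{div}\dot\beta_F-\tfrac{\rho_F}\Omega\dot\tau,$$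 $$\nabla_3\dot\sigma_F+\mathrm{tr}\underline\chi\dot\sigma_F=\mathrm{curl}\dot{\underline\beta}_F,\qquad \nabla_4\dot\sigma_F+\mathrm{tr}\chi\dot\sigma_F=\mathrm{curl}\dot\beta_F .$$ *Bianchi:* $$\nabla_3\dot\alpha+(\tfrac12\mathrm{tr}\underline\chi+2\hat{\underline\omega})\dot\alpha=-2D_2^*\dot\beta-3\rho\dot{\hat\chi}-2\rho_F(D_2^*\dot\beta_F+\rho_F\dot{\hat\chi}),$$ $$\nabla_4\dot{\underline\alpha}+(\tfrac12\mathrm{tr}\chi+2\hat\omega)\dot{\underline\alpha}=2D_2^*\dot{\underline\beta}-3\rho\dot{\underline{\hat\chi}}+2\rho_F(D_2^*\dot{\underline\beta}_F-\rho_F\dot{\underline{\hat\chi}}),$$ $$\nabla_3\dot\beta+(\mathrm{tr}\underline\chi+\hat{\underline\omega})\dot\beta=D_1^*(-\dot\rho,\dot\sigma)+3\rho\dot\eta+\rho_F\big(-D_1^*(\dot\rho_F,\dot\sigma_F)-\mathrm{tr}\chi\dot{\underline\beta}_F-\tfrac12\mathrm{tr}\underline\chi\dot\beta_F\big),$$ $$\nabla_4\dot{\underline\beta}+(\mathrm{tr}\chi+\hat\omega)\dot{\underline\beta}=D_1^*(\dot\rho,\dot\sigma)-3\rho\dot{\underline\eta}+\rho_F\big(D_1^*(\dot\rho_F,-\dot\sigma_F)-\mathrm{tr}\underline\chi\dot\beta_F-\tfrac12\mathrm{tr}\chi\dot{\underline\beta}_F\big),$$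 $$\nabla_3\dot{\underline\beta}+(2\mathrm{tr}\underline\chi-\hat{\underline\omega})\dot{\underline\beta}=-\mathrm{div}\dot{\underline\alpha}+\rho_F(\nabla_3\dot{\underline\beta}_F-\hat{\underline\omega}\dot{\underline\beta}_F),\qquad \nabla_4\dot\beta+(2\mathrm{tr}\chi-\hat\omega)\dot\beta=\mathrm{div}\dot\alpha+\rho_F(\nabla_4\dot\beta_F-\hat\omega\dot\beta_F),$$ $$\nabla_3\dot\rho+\tfrac32\mathrm{tr}\underline\chi\dot\rho=-\mathrm{div}\dot{\underline\beta}-\rho_F\mathrm{div}\dot{\underline\beta}_F-(\tfrac32\rho+\rho_F^2)\tfrac1\Omega\dot{\underline\tau}-2\mathrm{tr}\underline\chi\rho_F\dot\rho_F,$$ $$\nabla_4\dot\rho+\tfrac32\mathrm{tr}\chi\dot\rho=\mathrm{div}\dot\beta+\rho_F\mathrm{div}\dot\beta_F-(\tfrac32\rho+\rho_F^2)\tfrac1\Omega\dot\tau-2\mathrm{tr}\chi\rho_F\dot\rho_F,$$ $$\nabla_3\dot\sigma+\tfrac32\mathrm{tr}\underline\chi\dot\sigma=-\mathrm{curl}\dot{\underline\beta}-\rho_F\mathrm{curl}\dot{\underline\beta}_F,\qquad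 \nabla_4\dot\sigma+\tfrac32\mathrm{tr}\chi\dot\sigma=-\mathrm{curl}\dot\beta-\rho_F\mathrm{curl}\dot\beta_F .$$ $\mathcal S$ is *partially initial-data-normalised and supported on $\ell\ge1$* if every scalar of $\mathcal S$ has zero mean on every sphere and, pointwise on $S^2$, $\dot\tau\to0$ and $\mathrm{div}\,\dot\eta+\dot\rho\to0$ as $u\to\infty$ along $v=v_0$, and $r^2\dot K\to0$ as $v\to\infty$ along $u=u_0$. $\mathcal S$ satisfies the *decay assumptions* if for some $s\in(0,1)$, for each $\mathcal Q$ in the list $r^{3+s}\dot\alpha$, $r^{3+s}\dot\beta$, $r^3\dot\rho$, $r^3\dot\sigma$, $r^2\dot{\underline\beta}$, $r\dot{\underline\alpha}$, $r^{2+s}\dot\beta_F$, $r^2\dot\rho_F$, $r^2\dot\sigma_F$, $r\dot{\underline\beta}_F$, $r^2\dot{\hat\chi}$, $r\dot{\underline{\hat\chi}}$, $r\dot\eta$, $r^2\dot{\underline\eta}$, $r^2\mathrm{div}\dot\eta$, $r^3\mathrm{div}\dot{\underline\eta}$, $r^{2+s}\dot\omega$, $\dot{\underline\omega}$, $r^2\dot\tau$,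 $r\dot{\underline\tau}$, $\dot w$, $r^3\dot K$, and for all $i+j\le2$: the (orthonormal components of the) derivatives $[r\nabla]^i[\nabla_T]^j\mathcal Q$ have limits as $v\to\infty$ for every $u\ge u_0$ and every point of $S^2$, and are bounded on $[u_0,u_1]\times\{v\ge v_0\}\times S^2$ for every $u_1>u_0$. The initial data are *regular* if along $v=v_0$ the quantities $\dot w$, $\dot\tau$, $\Omega^{-2}\dot{\underline\tau}$, $\dot\omega$, $\Omega^{-2}\dot{\underline\omega}$, $\dot\eta$, $\dot{\underline\eta}$, $\Omega\dot{\hat\chi}$, $\Omega^{-1}\dot{\underline{\hat\chi}}$, $\dot K$, $\Omega\dot\beta$, $\Omega^{-1}\dot{\underline\beta}$, $\Omega^2\dot\alpha$, $\Omega^{-2}\dot{\underline\alpha}$, $\dot\rho$, $\dot\sigma$, $\Omega\dot\beta_F$, $\Omega^{-1}\dot{\underline\beta}_F$, $\dot\rho_F$, $\dot\sigma_F$ extend smoothly to the event horizon $u=\infty$, i.e. are smooth functions on $S^2$ and of $U=e^{-2\kappa u}$ up to $U=0$, $\kappa=\frac{r_+-r_-}{2r_+^2}$. **Energies.** Let $\lambda=\frac{r}{\Omega^2}\dot\tau-4\dot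 w$ and $X=2r^3(\dot\rho-\mathrm{div}\dot{\underline\eta})+\frac{r^2}{\Omega^2}r^2\Delta\dot\tau$. Let $$E_{u_0}(v_0,\infty)=\int_{v_0}^\infty\!\!\int_{S^2}\!\Big[|\Omega\dot{\hat\chi}|^2+2|\Omega\dot{\underline\eta}|^2+2|\Omega\dot\beta_F|^2+2|\Omega\dot\sigma_F|^2+2|\Omega\dot\rho_F|^2+r\dot\tau(\dot\rho+\mathrm{div}\dot{\underline\eta})\Big]r^2\,\varepsilon_{S^2}dv\Big|_{u=u_0},$$ $$E_{v_0}(u_0,u_1)=\int_{u_0}^{u_1}\!\!\int_{S^2}\!\Big[|\Omega\dot{\underline{\hat\chi}}|^2+2|\Omega\dot\eta|^2+2|\Omega\dot{\underline\beta}_F|^2+2|\Omega\dot\sigma_F|^2+2|\Omega\dot\rho_F|^2-r\dot{\underline\tau}(\dot\rho+\mathrm{div}\dot\eta)\Big]r^2\,\varepsilon_{S^2}du\Big|_{v=v_0},$$ $$\mathbb E^{0,0}(u_1)=\int_{v_0}^\infty\!\!\int_{S^2}\!\Big[|\dot{\hat\chi}|^2+\Big|\dot{\underline\eta}-\tfrac12[r\nabla]\tfrac{\dot\tau}{\Omega^2}\Big|^2+|\dot\beta_F|^2+|\dot\sigma_F|^2+\Big|\dot\rho_F-\tfrac{Q\lambda}{r^2}\Big|^2\Big]\Omega^2r^2\,\varepsilon_{S^2}dv\Big|_{u=u_1}+\|X\|^2_{u_1,\infty},$$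 where $\|X\|^2_{u_1,\infty}=\int_{S^2}|\lim_{v\to\infty}X(u_1,v,\cdot)|^2\varepsilon_{S^2}$, and for $\Lambda\ge1$ $$\mathbb E^{\Lambda}_{data}(u_1)=E_{u_0}(v_0,\infty)+E_{v_0}(u_0,u_1)+\Lambda\Big(\|\Omega^{-1}\lambda\|^2_{u_1,v_0}+\|\Omega^{-1}X\|^2_{u_1,v_0}\Big).$$ **Theorem.** There are constants $C>0$ and $\Lambda\ge1$ depending only on $M$ and $Q$ such that for all $u_0,v_0$ and every partially initial-data-normalised solution $\mathcal S$ supported on $\ell\ge1$ that satisfies the decay assumptions: the integrals over $v\in(v_0,\infty)$ above (of the respective sphere integrals) converge absolutely; for every $u_1\ge u_0$ the limits $\lim_{v\to\infty}X(u_1,v,\cdot)$ (pointwise) and that in the following inequality exist, and $$\mathbb E^{0,0}(u_1)+\lim_{v\to\infty}\int_{u_0}^{u_1}\!\!\int_{S^2}\Big[|r\Omega\dot{\underline{\hat\chi}}|^2+|r\Omega\dot{\underline\beta}_F|^2\Big]\varepsilon_{S^2}\,du\ \le\ C\,\mathbb E^{\Lambda}_{data}(u_1);$$ moreover, if the initial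 data are regular, then $\sup_{u\in[u_0,\infty)}\mathbb E^{\Lambda}_{data}(u)<\infty$. -/

import Mathlib

open Set Filter Topology MeasureTheory
open scoped ContDiff

noncomputable section

namespace RN

/-! ## Tensor fields on the round sphere

The unit sphere `S²` is realised inside `ℝ³`.  A covariant tensor of rank `n` at a point `x` of `S²`
is given by its Cartesian components; it is tangential when every contraction with `x` vanishes.
Only the values of a field at unit vectors play a role. -/

/-- The ambient Euclidean space of the unit sphere. -/
abbrev E3 := EuclideanSpace ℝ (Fin 3)

/-- Cartesian components of a covariant `n`-tensor (rank `0`: scalars). -/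
abbrev Tensor (n : ℕ) := (Fin n → Fin 3) → ℝ

/-- Pointwise inner product of tensors. -/
def tinner {n : ℕ} (A B : Tensor n) : ℝ := ∑ I, A I * B I

/-- Pointwise squared norm of a tensor. -/
def tsq {n : ℕ} (A : Tensor n) : ℝ := tinner A A

/-- The `0`-homogeneous extension of a field from the unit sphere to `ℝ³ \ {0}`. -/
def ext {V : Type*} (T : E3 → V) : E3 → V := fun x => T (‖x‖⁻¹ • x)

/-- The orthogonal projection to the tangent plane at a unit vector `x`, which is also the round
metric of the unit sphere at `x`. -/
def proj (x : E3) (i j : Fin 3) : ℝ := (if i = j then 1 else 0) - x i * x j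

/-- The volume form `ε_{AB}` of the unit sphere at `x` (outward normal orientation):
`ε(a, b) = det (x, a, b)`. -/
def eps (x : E3) : Matrix (Fin 3) (Fin 3) ℝ :=
  !![0, x 2, -(x 1); -(x 2), 0, x 0; x 1, -(x 0), 0]

/-- The Levi-Civita covariant derivative of the round unit sphere, the derivative index being the
first one: differentiate the Cartesian components tangentially and project every slot. -/
def nabla {n : ℕ} (T : E3 → Tensor n) : E3 → Tensor (n + 1) := fun x I =>
  ∑ J : Fin (n + 1) → Fin 3, (∏ k, proj x (I k) (J k)) *
    fderiv ℝ (ext T) x (EuclideanSpace.single (J 0) 1) (Fin.tail J)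

/-- Divergence on the unit sphere, `∇^B T_{B...}`. -/
def sdiv {n : ℕ} (T : E3 → Tensor (n + 1)) : E3 → Tensor n := fun x I =>
  ∑ a : Fin 3, nabla T x (Fin.cons a (Fin.cons a I))

/-- Curl on the unit sphere, `ε^{BC} ∇_B T_{C...}`. -/
def scurl {n : ℕ} (T : E3 → Tensor (n + 1)) : E3 → Tensor n := fun x I =>
  ∑ a : Fin 3, ∑ b : Fin 3, eps x a b * nabla T x (Fin.cons a (Fin.cons b I))

/-- `D₁^*(f₁, f₂)_A = -∇_A f₁ + ε_{AB} ∇^B f₂` on the unit sphere. -/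
def sD1 (f₁ f₂ : E3 → Tensor 0) : E3 → Tensor 1 := fun x I =>
  -nabla f₁ x I + ∑ b : Fin 3, eps x (I 0) b * nabla f₂ x ![b]

/-- `D₂^* ξ = -½ (∇_A ξ_B + ∇_B ξ_A - (div ξ) g_{AB})` on the unit sphere. -/
def sD2 (ξ : E3 → Tensor 1) : E3 → Tensor 2 := fun x I =>
  -(1 / 2) * (nabla ξ x ![I 0, I 1] + nabla ξ x ![I 1, I 0] - sdiv ξ x ![] * proj x (I 0) (I 1))

/-- Integration over the unit sphere with respect to its area measure. -/
def sphInt (f : E3 → ℝ) : ℝ :=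
  ∫ x : Metric.sphere (0 : E3) 1, f x ∂((volume : Measure E3).toSphere)

/-! ## Fields on the exterior region

An `S²_{u,v}`-tensor `Θ` of rank `n` is represented by its components in orthonormal frames of
`S²_{u,v}`: the sphere `S²_{u,v}` is the unit sphere scaled by `r(u,v)`, and `Θ` is represented by
the tensor `r⁻ⁿ Θ` on the unit sphere.  Pointwise norms of `Θ` are then Euclidean norms of the
representatives, the angular derivative is `r⁻¹` times the one of the unit sphere, and the projected
derivatives `∇₃`, `∇₄` act on representatives as `Ω⁻¹ ∂_u`, `Ω⁻¹ ∂_v`. -/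

/-- A family of sphere tensors of rank `n` depending on `(u, v)`. -/
abbrev SField (n : ℕ) := ℝ → ℝ → E3 → Tensor n

/-- Multiplication of a field by a function of `(u, v)`. -/
def mulF {n : ℕ} (c : ℝ → ℝ → ℝ) (T : SField n) : SField n := fun u v x => c u v • T u v x

infixr:73 " ⊙ " => RN.mulF

/-- The parameters: mass and charge of the black hole, and the corner `(u₀, v₀)` of the region
`{u ≥ u₀, v ≥ v₀}` bounded by the two initial null cones. -/
structure Geom where
  M : ℝ
  Q : ℝ
  u₀ : ℝ
  v₀ : ℝ

/-- Outer horizon radius `r₊`. -/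
def rPlus (M Q : ℝ) : ℝ := M + √(M ^ 2 - Q ^ 2)

/-- Inner horizon radius `r₋`. -/
def rMinus (M Q : ℝ) : ℝ := M - √(M ^ 2 - Q ^ 2)

/-- The tortoise coordinate `r_*` on `r > r₊`, an antiderivative of `(1 - 2M/r + Q²/r²)⁻¹`. -/
def tortoise (M Q r : ℝ) : ℝ :=
  r + rPlus M Q ^ 2 / (rPlus M Q - rMinus M Q) * Real.log (r - rPlus M Q)
    - rMinus M Q ^ 2 / (rPlus M Q - rMinus M Q) * Real.log (r - rMinus M Q)

/-- Elementary relations between the horizon radii. -/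
theorem horizon_facts {M Q : ℝ} (h : |Q| < M) : 0 ≤ rMinus M Q ∧ rMinus M Q < rPlus M Q ∧
    rPlus M Q + rMinus M Q = 2 * M ∧ rPlus M Q * rMinus M Q = Q ^ 2 := by
  have hM : 0 < M := (abs_nonneg Q).trans_lt h
  have hd : 0 < M ^ 2 - Q ^ 2 := by
    have := sq_lt_sq' (by linarith [abs_nonneg Q]) h
    rw [sq_abs] at this; linarith
  have hs := Real.sq_sqrt hd.le
  have hp := Real.sqrt_pos.2 hd
  have hle : √(M ^ 2 - Q ^ 2) ≤ M := Real.sqrt_le_iff.2 ⟨hM.le, by nlinarith [sq_nonneg Q]⟩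
  refine ⟨by unfold rMinus; linarith, by unfold rMinus rPlus; linarith,
    by unfold rMinus rPlus; ring, by unfold rMinus rPlus; nlinarith⟩

/-- The tortoise coordinate satisfies `dr_*/dr = (1 - 2M/r + Q²/r²)⁻¹`. -/
theorem hasDerivAt_tortoise {M Q r : ℝ} (h : |Q| < M) (hr : rPlus M Q < r) :
    HasDerivAt (tortoise M Q) (1 - 2 * M / r + Q ^ 2 / r ^ 2)⁻¹ r := by
  obtain ⟨h0, h1, h2, h3⟩ := horizon_facts h
  have ha : r - rPlus M Q ≠ 0 := by linarith [hr] |> fun (h : 0 < r - rPlus M Q) => h.ne'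
  have hb : r - rMinus M Q ≠ 0 := (show 0 < r - rMinus M Q by linarith).ne'
  have hc : rPlus M Q - rMinus M Q ≠ 0 := (show 0 < rPlus M Q - rMinus M Q by linarith).ne'
  have hr0 : r ≠ 0 := (show 0 < r by linarith).ne'
  have e : (1 - 2 * M / r + Q ^ 2 / r ^ 2) = (r - rPlus M Q) * (r - rMinus M Q) / r ^ 2 := by
    rw [← h2, ← h3]; field_simp; ring
  have d := ((hasDerivAt_id r).add ((((hasDerivAt_id r).sub_const (rPlus M Q)).log ha).const_mul
    (rPlus M Q ^ 2 / (rPlus M Q - rMinus M Q)))).sub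
    ((((hasDerivAt_id r).sub_const (rMinus M Q)).log hb).const_mul
    (rMinus M Q ^ 2 / (rPlus M Q - rMinus M Q)))
  rw [e]
  refine HasDerivAt.congr_deriv (f' := _) d ?_
  simp only [id_eq]
  field_simp
  ring

/-- The tortoise coordinate maps `(r₊, ∞)` bijectively onto `ℝ`. -/
theorem bijOn_tortoise {M Q : ℝ} (h : |Q| < M) :
    BijOn (tortoise M Q) (Ioi (rPlus M Q)) univ := by
  obtain ⟨h0, h1, h2, h3⟩ := horizon_facts h
  set p := rPlus M Q with hp
  set m := rMinus M Q with hm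
  have hcont : ContinuousOn (tortoise M Q) (Ioi p) := fun r hr =>
    (hasDerivAt_tortoise h hr).continuousAt.continuousWithinAt
  have hpos : ∀ r, p < r → 0 < 1 - 2 * M / r + Q ^ 2 / r ^ 2 := fun r hr => by
    have hr0 : 0 < r := by linarith
    have e : (1 - 2 * M / r + Q ^ 2 / r ^ 2) = (r - p) * (r - m) / r ^ 2 := by
      rw [← h2, ← h3]; field_simp; ring
    rw [e]; have : 0 < r - p := by linarith
    have : 0 < r - m := by linarith
    positivity
  have hmono : StrictMonoOn (tortoise M Q) (Ioi p) := by
    refine strictMonoOn_of_deriv_pos (convex_Ioi p) hcont fun r hr => ?_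
    rw [interior_Ioi] at hr
    rw [(hasDerivAt_tortoise h hr).deriv]
    exact inv_pos.2 (hpos r hr)
  have hA : 0 < p ^ 2 / (p - m) := by
    have : 0 < p := by linarith
    have : 0 < p - m := by linarith
    positivity
  have hmain : ∀ r, p < r → tortoise M Q r = r + (p + m) * Real.log (r - p)
      + m ^ 2 / (p - m) * (Real.log (r - p) - Real.log (r - m)) := fun r hr => by
    have hc : p - m ≠ 0 := (show 0 < p - m by linarith).ne'
    simp only [tortoise, ← hp, ← hm]
    field_simp
    ring
  refine ⟨fun _ _ => mem_univ _, hmono.injOn, fun y _ => ?_⟩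
  have hB : 0 ≤ m ^ 2 / (p - m) := div_nonneg (sq_nonneg _) (by linarith)
  have hM : 0 < p + m := by linarith
  have lo : ∃ a, p < a ∧ tortoise M Q a ≤ y := by
    have t1 : Tendsto (fun r => (p + 1) + (p + m) * Real.log (r - p)) (𝓝[>] p) atBot := by
      refine tendsto_atBot_add_const_left _ _ (Tendsto.const_mul_atBot hM ?_)
      refine Real.tendsto_log_nhdsGT_zero.comp ?_
      refine tendsto_nhdsWithin_iff.2 ⟨?_, ?_⟩
      · have : Tendsto (fun r : ℝ => r - p) (𝓝 p) (𝓝 (p - p)) := tendsto_id.sub_const p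
        rw [sub_self] at this
        exact this.mono_left nhdsWithin_le_nhds
      · filter_upwards [self_mem_nhdsWithin] with r hr
        exact sub_pos.2 (mem_Ioi.1 hr)
    have t2 := t1.eventually (eventually_le_atBot y)
    have t3 : ∀ᶠ r in 𝓝[>] p, r ∈ Ioo p (p + 1) := Ioo_mem_nhdsGT (by linarith)
    obtain ⟨a, ha, ha'⟩ := (t2.and t3).exists
    refine ⟨a, ha'.1, ?_⟩
    rw [hmain a ha'.1]
    have hl : Real.log (a - p) ≤ Real.log (a - m) :=
      Real.log_le_log (by linarith [ha'.1]) (by linarith)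
    nlinarith [ha'.2, mul_nonneg hB (sub_nonneg.2 hl)]
  have hi : ∃ b, p < b ∧ y ≤ tortoise M Q b := by
    refine ⟨max (p + 1) (y + m ^ 2 / (p - m) * (p - m)), by
      linarith [le_max_left (p + 1) (y + m ^ 2 / (p - m) * (p - m))], ?_⟩
    set b := max (p + 1) (y + m ^ 2 / (p - m) * (p - m))
    have b1 : p + 1 ≤ b := le_max_left _ _
    have b2 : y + m ^ 2 / (p - m) * (p - m) ≤ b := le_max_right _ _
    rw [hmain b (by linarith)]
    have l0 : 0 ≤ Real.log (b - p) := Real.log_nonneg (by linarith)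
    have l1 : Real.log (b - m) - Real.log (b - p) ≤ p - m := by
      rw [← Real.log_div (by linarith) (by linarith)]
      refine (Real.log_le_sub_one_of_pos (div_pos (by linarith) (by linarith))).trans ?_
      rw [div_sub_one (by linarith), div_le_iff₀ (by linarith)]
      nlinarith
    nlinarith [mul_nonneg hM.le l0, mul_le_mul_of_nonneg_left l1 hB]
  obtain ⟨a, ha, hay⟩ := lo
  obtain ⟨b, hb, hyb⟩ := hi
  exact (isPreconnected_Ioi.intermediate_value ha hb hcont) ⟨hay, hyb⟩

namespace Geom

variable (G : Geom)

/-- The area radius `r(u,v) > r₊`, determined by `r_*(r) = v - u` (see `r_spec`). -/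
def r : ℝ → ℝ → ℝ := fun u v =>
  Function.invFunOn (tortoise G.M G.Q) (Ioi (rPlus G.M G.Q)) (v - u)

theorem r_spec (h : |G.Q| < G.M) (u v : ℝ) :
    rPlus G.M G.Q < G.r u v ∧ tortoise G.M G.Q (G.r u v) = v - u := by
  have hs : v - u ∈ tortoise G.M G.Q '' Ioi (rPlus G.M G.Q) :=
    (bijOn_tortoise h).surjOn (mem_univ _)
  exact ⟨Function.invFunOn_mem hs, Function.invFunOn_eq hs⟩

/-- The lapse `Ω`, with `Ω² = 1 - 2M/r + Q²/r²`. -/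
def Om : ℝ → ℝ → ℝ := fun u v => √(1 - 2 * G.M / G.r u v + G.Q ^ 2 / G.r u v ^ 2)

/-- Background `tr χ`. -/
def trchi : ℝ → ℝ → ℝ := 2 * G.Om / G.r

/-- Background `tr χ̲`. -/
def trchib : ℝ → ℝ → ℝ := -(2 * G.Om / G.r)

/-- Background `ω`. -/
def om : ℝ → ℝ → ℝ := fun u v => G.M / G.r u v ^ 2 - G.Q ^ 2 / G.r u v ^ 3

/-- Background `ω̲`. -/
def omb : ℝ → ℝ → ℝ := -G.om

/-- Background `ω̂ = Ω⁻¹ ω`. -/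
def omh : ℝ → ℝ → ℝ := G.om / G.Om

/-- Background `ω̲̂ = Ω⁻¹ ω̲`. -/
def ombh : ℝ → ℝ → ℝ := G.omb / G.Om

/-- Background Weyl curvature component `ρ`. -/
def rho : ℝ → ℝ → ℝ := fun u v => -(2 * G.M / G.r u v ^ 3) + 2 * G.Q ^ 2 / G.r u v ^ 4

/-- Background electromagnetic component `ρ^F`. -/
def rhoF : ℝ → ℝ → ℝ := fun u v => G.Q / G.r u v ^ 2

/-- `∂_u` on the region `u ≥ u₀` (one-sided at `u = u₀`), on orthonormal components. -/
def dU {n : ℕ} (T : SField n) : SField n := fun u v x =>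
  derivWithin (fun s => T s v x) (Ici G.u₀) u

/-- `∂_v` on the region `v ≥ v₀` (one-sided at `v = v₀`), on orthonormal components. -/
def dV {n : ℕ} (T : SField n) : SField n := fun u v x =>
  derivWithin (fun s => T u s x) (Ici G.v₀) v

/-- The projected derivative `∇₃`. -/
def nab3 {n : ℕ} (T : SField n) : SField n := G.Om⁻¹ ⊙ G.dU T

/-- The projected derivative `∇₄`. -/
def nab4 {n : ℕ} (T : SField n) : SField n := G.Om⁻¹ ⊙ G.dV T

/-- The projected derivative `∇_T = (Ω/2)(∇₃ + ∇₄)`. -/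
def nabT {n : ℕ} (T : SField n) : SField n := (G.Om / 2) ⊙ (G.nab3 T + G.nab4 T)

/-- The angular covariant derivative `∇` of `S²_{u,v}`. -/
def grad {n : ℕ} (T : SField n) : SField (n + 1) := G.r⁻¹ ⊙ fun u v => nabla (T u v)

/-- The divergence on `S²_{u,v}`. -/
def div {n : ℕ} (T : SField (n + 1)) : SField n := G.r⁻¹ ⊙ fun u v => sdiv (T u v)

/-- The curl on `S²_{u,v}`. -/
def curl {n : ℕ} (T : SField (n + 1)) : SField n := G.r⁻¹ ⊙ fun u v => scurl (T u v)

/-- The operator `D₁^*` on `S²_{u,v}`. -/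
def D1 (f₁ f₂ : SField 0) : SField 1 := G.r⁻¹ ⊙ fun u v => sD1 (f₁ u v) (f₂ u v)

/-- The operator `D₂^*` on `S²_{u,v}`. -/
def D2 (ξ : SField 1) : SField 2 := G.r⁻¹ ⊙ fun u v => sD2 (ξ u v)

/-- The weighted angular derivative `r∇`. -/
def rnab {n : ℕ} (T : SField n) : SField (n + 1) := G.r ⊙ G.grad T

/-- The iterated weighted angular derivative `[r∇]ⁱ`. -/
def rnabPow {n : ℕ} (T : SField n) : (i : ℕ) → SField (n + i)
  | 0 => T
  | i + 1 => G.rnab (rnabPow T i)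

/-- The Laplacian of `S²_{u,v}`, `Δ Θ = div (∇ Θ)`. -/
def lap {n : ℕ} (T : SField n) : SField n := G.div (G.grad T)

/-- Equality of two fields on the region `u ≥ u₀`, `v ≥ v₀`. -/
def EqOn {n : ℕ} (A B : SField n) : Prop :=
  ∀ u v x, G.u₀ ≤ u → G.v₀ ≤ v → ‖x‖ = 1 → A u v x = B u v x

/-- Smoothness on the region, up to and including the initial cones. -/
def Smooth {n : ℕ} (T : SField n) : Prop :=
  ContDiffOn ℝ ∞ (fun p : ℝ × ℝ × E3 => ext (T p.1 p.2.1) p.2.2)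
    (Ici G.u₀ ×ˢ Ici G.v₀ ×ˢ {0}ᶜ)

/-- A smooth scalar. -/
def IsScalar (f : SField 0) : Prop := G.Smooth f

/-- A smooth `S²_{u,v}` one-form. -/
def IsOneForm (ξ : SField 1) : Prop :=
  G.Smooth ξ ∧ ∀ u v x, G.u₀ ≤ u → G.v₀ ≤ v → ‖x‖ = 1 → ∑ a, x a * ξ u v x ![a] = 0

/-- A smooth symmetric traceless `S²_{u,v}` two-tensor. -/
def IsSymTraceless (θ : SField 2) : Prop :=
  G.Smooth θ ∧ ∀ u v x, G.u₀ ≤ u → G.v₀ ≤ v → ‖x‖ = 1 →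
    (∀ b, ∑ a, x a * θ u v x ![a, b] = 0) ∧ (∀ a b, θ u v x ![a, b] = θ u v x ![b, a]) ∧
      ∑ a, θ u v x ![a, a] = 0

end Geom

/-! ## The linearised Einstein-Maxwell system -/

/-- The linearised quantities.  `sg` is `√g⁽¹⁾ / √g`, `lO` is `Ω⁻¹ Ω⁽¹⁾`, `gh` the traceless metric
perturbation, `b` the shift, `otx`, `otxb` the perturbations of `Ω tr χ`, `Ω tr χ̲`; a final `b`
in a name stands for an underlined quantity, `F` for an electromagnetic one. -/
structure Pert where
  sg : SField 0
  gh : SField 2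
  lO : SField 0
  b : SField 1
  otx : SField 0
  otxb : SField 0
  chi : SField 2
  chib : SField 2
  eta : SField 1
  etab : SField 1
  om : SField 0
  omb : SField 0
  alpha : SField 2
  beta : SField 1
  rho : SField 0
  sigma : SField 0
  betab : SField 1
  alphab : SField 2
  K : SField 0
  betaF : SField 1
  rhoF : SField 0
  sigmaF : SField 0
  betabF : SField 1

namespace Geom

variable (G : Geom)

/-- All linearised quantities are smooth tensors of their type. -/
structure IsSmoothPert (S : Pert) : Prop where
  sg : G.IsScalar S.sg
  gh : G.IsSymTraceless S.gh
  lO : G.IsScalar S.lO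
  b : G.IsOneForm S.b
  otx : G.IsScalar S.otx
  otxb : G.IsScalar S.otxb
  chi : G.IsSymTraceless S.chi
  chib : G.IsSymTraceless S.chib
  eta : G.IsOneForm S.eta
  etab : G.IsOneForm S.etab
  om : G.IsScalar S.om
  omb : G.IsScalar S.omb
  alpha : G.IsSymTraceless S.alpha
  beta : G.IsOneForm S.beta
  rho : G.IsScalar S.rho
  sigma : G.IsScalar S.sigma
  betab : G.IsOneForm S.betab
  alphab : G.IsSymTraceless S.alphab
  K : G.IsScalar S.K
  betaF : G.IsOneForm S.betaF
  rhoF : G.IsScalar S.rhoF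
  sigmaF : G.IsScalar S.sigmaF
  betabF : G.IsOneForm S.betabF

/-- The linearised null structure equations.  In the equations for the metric perturbation:
`√g ∂_u (ĝ_{AB} / √g)` is `∂_u` of the orthonormal components of `ĝ`, because `√g` is `r²` times the
area element of the unit sphere; and `∂_u b` is the derivative of the components `b^A` of the shift
vector field, that is `r ∂_u (r⁻¹ b)` in orthonormal components. -/
structure NullStructure (S : Pert) : Prop where
  sg_u : G.EqOn (G.dU S.sg) S.otxb
  sg_v : G.EqOn (G.dV S.sg) (S.otx - G.div S.b)
  gh_u : G.EqOn (G.dU S.gh) ((2 * G.Om) ⊙ S.chib)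
  gh_v : G.EqOn (G.dV S.gh) ((2 * G.Om) ⊙ S.chi + 2 ⊙ G.D2 S.b)
  b_u : G.EqOn (G.r ⊙ G.dU (G.r⁻¹ ⊙ S.b)) ((2 * G.Om ^ 2) ⊙ (S.eta - S.etab))
  lO_v : G.EqOn (G.dV S.lO) S.om
  lO_u : G.EqOn (G.dU S.lO) S.omb
  lO_grad : G.EqOn (2 ⊙ G.grad S.lO) (S.eta + S.etab)
  otxb_v : G.EqOn (G.dV S.otxb)
    (G.Om ^ 2 ⊙ (2 ⊙ G.div S.etab + 2 ⊙ S.rho + (4 * G.rho) ⊙ S.lO)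
      - (1 / 2 * (G.Om * G.trchi)) ⊙ (S.otxb - S.otx))
  otx_u : G.EqOn (G.dU S.otx)
    (G.Om ^ 2 ⊙ (2 ⊙ G.div S.eta + 2 ⊙ S.rho + (4 * G.rho) ⊙ S.lO)
      - (1 / 2 * (G.Om * G.trchi)) ⊙ (S.otxb - S.otx))
  otx_v : G.EqOn (G.dV S.otx)
    (-((G.Om * G.trchi) ⊙ S.otx) + (2 * G.om) ⊙ S.otx + (2 * (G.Om * G.trchi)) ⊙ S.om)
  otxb_u : G.EqOn (G.dU S.otxb)
    (-((G.Om * G.trchib) ⊙ S.otxb) + (2 * G.omb) ⊙ S.otxb + (2 * (G.Om * G.trchib)) ⊙ S.omb)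
  chib_3 : G.EqOn (G.nab3 (G.Om⁻¹ ⊙ S.chib) + (G.Om⁻¹ * G.trchib) ⊙ S.chib)
    (-(G.Om⁻¹ ⊙ S.alphab))
  chi_4 : G.EqOn (G.nab4 (G.Om⁻¹ ⊙ S.chi) + (G.Om⁻¹ * G.trchi) ⊙ S.chi)
    (-(G.Om⁻¹ ⊙ S.alpha))
  chi_3 : G.EqOn (G.nab3 (G.Om ⊙ S.chi) + (1 / 2 * (G.Om * G.trchib)) ⊙ S.chi
      + (1 / 2 * (G.Om * G.trchi)) ⊙ S.chib)
    (-((2 * G.Om) ⊙ G.D2 S.eta))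
  chib_4 : G.EqOn (G.nab4 (G.Om ⊙ S.chib) + (1 / 2 * (G.Om * G.trchi)) ⊙ S.chib
      + (1 / 2 * (G.Om * G.trchib)) ⊙ S.chi)
    (-((2 * G.Om) ⊙ G.D2 S.etab))
  etab_3 : G.EqOn (G.nab3 S.etab)
    ((1 / 2 * G.trchib) ⊙ (S.eta - S.etab) + S.betab + G.rhoF ⊙ S.betabF)
  eta_4 : G.EqOn (G.nab4 S.eta)
    (-((1 / 2 * G.trchi) ⊙ (S.eta - S.etab)) - S.beta - G.rhoF ⊙ S.betaF)
  etab_4 : G.EqOn (G.nab4 S.etab)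
    ((2 / G.Om) ⊙ G.grad S.om - G.trchi ⊙ S.etab + S.beta + G.rhoF ⊙ S.betaF)
  eta_3 : G.EqOn (G.nab3 S.eta)
    ((2 / G.Om) ⊙ G.grad S.omb - G.trchib ⊙ S.eta - S.betab - G.rhoF ⊙ S.betabF)
  curl_eta : G.EqOn (G.curl S.eta) S.sigma
  curl_etab : G.EqOn (G.curl S.etab) (-S.sigma)
  omb_v : G.EqOn (G.dV S.omb)
    (-(G.Om ^ 2 ⊙ (S.rho + (2 * G.rhoF) ⊙ S.rhoF + (2 * (G.rho + G.rhoF ^ 2)) ⊙ S.lO)))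
  om_u : G.EqOn (G.dU S.om)
    (-(G.Om ^ 2 ⊙ (S.rho + (2 * G.rhoF) ⊙ S.rhoF + (2 * (G.rho + G.rhoF ^ 2)) ⊙ S.lO)))
  codazzi_b : G.EqOn (G.div S.chib)
    (-((1 / 2 * G.trchib) ⊙ S.eta) + S.betab - G.rhoF ⊙ S.betabF
      + (1 / (2 * G.Om)) ⊙ G.grad S.otxb)
  codazzi : G.EqOn (G.div S.chi)
    (-((1 / 2 * G.trchi) ⊙ S.etab) - S.beta + G.rhoF ⊙ S.betaF
      + (1 / (2 * G.Om)) ⊙ G.grad S.otx)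
  gauss : G.EqOn S.K
    (-S.rho + (2 * G.rhoF) ⊙ S.rhoF - (1 / 4 * (G.trchi / G.Om)) ⊙ (S.otxb - S.otx)
      + (1 / 2 * (G.trchi * G.trchib)) ⊙ S.lO)

/-- The linearised Maxwell equations. -/
structure Maxwell (S : Pert) : Prop where
  betaF_3 : G.EqOn (G.nab3 S.betaF + (1 / 2 * G.trchib + G.ombh) ⊙ S.betaF)
    (-G.D1 S.rhoF S.sigmaF + (2 * G.rhoF) ⊙ S.eta)
  betabF_4 : G.EqOn (G.nab4 S.betabF + (1 / 2 * G.trchi + G.omh) ⊙ S.betabF)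
    (G.D1 S.rhoF (-S.sigmaF) - (2 * G.rhoF) ⊙ S.etab)
  rhoF_3 : G.EqOn (G.nab3 S.rhoF + G.trchib ⊙ S.rhoF)
    (-G.div S.betabF - (G.rhoF / G.Om) ⊙ S.otxb)
  rhoF_4 : G.EqOn (G.nab4 S.rhoF + G.trchi ⊙ S.rhoF)
    (G.div S.betaF - (G.rhoF / G.Om) ⊙ S.otx)
  sigmaF_3 : G.EqOn (G.nab3 S.sigmaF + G.trchib ⊙ S.sigmaF) (G.curl S.betabF)
  sigmaF_4 : G.EqOn (G.nab4 S.sigmaF + G.trchi ⊙ S.sigmaF) (G.curl S.betaF)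

/-- The linearised Bianchi identities. -/
structure Bianchi (S : Pert) : Prop where
  alpha_3 : G.EqOn (G.nab3 S.alpha + (1 / 2 * G.trchib + 2 * G.ombh) ⊙ S.alpha)
    (-(2 ⊙ G.D2 S.beta) - (3 * G.rho) ⊙ S.chi
      - (2 * G.rhoF) ⊙ (G.D2 S.betaF + G.rhoF ⊙ S.chi))
  alphab_4 : G.EqOn (G.nab4 S.alphab + (1 / 2 * G.trchi + 2 * G.omh) ⊙ S.alphab)
    (2 ⊙ G.D2 S.betab - (3 * G.rho) ⊙ S.chib
      + (2 * G.rhoF) ⊙ (G.D2 S.betabF - G.rhoF ⊙ S.chib))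
  beta_3 : G.EqOn (G.nab3 S.beta + (G.trchib + G.ombh) ⊙ S.beta)
    (G.D1 (-S.rho) S.sigma + (3 * G.rho) ⊙ S.eta
      + G.rhoF ⊙ (-G.D1 S.rhoF S.sigmaF - G.trchi ⊙ S.betabF - (1 / 2 * G.trchib) ⊙ S.betaF))
  betab_4 : G.EqOn (G.nab4 S.betab + (G.trchi + G.omh) ⊙ S.betab)
    (G.D1 S.rho S.sigma - (3 * G.rho) ⊙ S.etab
      + G.rhoF ⊙ (G.D1 S.rhoF (-S.sigmaF) - G.trchib ⊙ S.betaF - (1 / 2 * G.trchi) ⊙ S.betabF))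
  betab_3 : G.EqOn (G.nab3 S.betab + (2 * G.trchib - G.ombh) ⊙ S.betab)
    (-G.div S.alphab + G.rhoF ⊙ (G.nab3 S.betabF - G.ombh ⊙ S.betabF))
  beta_4 : G.EqOn (G.nab4 S.beta + (2 * G.trchi - G.omh) ⊙ S.beta)
    (G.div S.alpha + G.rhoF ⊙ (G.nab4 S.betaF - G.omh ⊙ S.betaF))
  rho_3 : G.EqOn (G.nab3 S.rho + (3 / 2 * G.trchib) ⊙ S.rho)
    (-G.div S.betab - G.rhoF ⊙ G.div S.betabF
      - ((3 / 2 * G.rho + G.rhoF ^ 2) / G.Om) ⊙ S.otxb - (2 * G.trchib * G.rhoF) ⊙ S.rhoF)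
  rho_4 : G.EqOn (G.nab4 S.rho + (3 / 2 * G.trchi) ⊙ S.rho)
    (G.div S.beta + G.rhoF ⊙ G.div S.betaF
      - ((3 / 2 * G.rho + G.rhoF ^ 2) / G.Om) ⊙ S.otx - (2 * G.trchi * G.rhoF) ⊙ S.rhoF)
  sigma_3 : G.EqOn (G.nab3 S.sigma + (3 / 2 * G.trchib) ⊙ S.sigma)
    (-G.curl S.betab - G.rhoF ⊙ G.curl S.betabF)
  sigma_4 : G.EqOn (G.nab4 S.sigma + (3 / 2 * G.trchi) ⊙ S.sigma)
    (-G.curl S.beta - G.rhoF ⊙ G.curl S.betaF)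

/-- A smooth solution of the linearised Einstein-Maxwell equations on `{u ≥ u₀, v ≥ v₀}`. -/
structure IsSolution (S : Pert) : Prop where
  smooth : G.IsSmoothPert S
  nullStructure : G.NullStructure S
  maxwell : G.Maxwell S
  bianchi : G.Bianchi S

/-! ## The class of solutions -/

/-- A scalar field has vanishing projection to the spherical harmonic `ℓ = 0`. -/
def NoMean (f : SField 0) : Prop :=
  ∀ u v, G.u₀ ≤ u → G.v₀ ≤ v → sphInt (fun x => f u v x ![]) = 0

/-- Support on the angular modes `ℓ ≥ 1` (automatic for one-forms and for symmetric traceless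
two-tensors). -/
structure SupportedOnGeOne (S : Pert) : Prop where
  sg : G.NoMean S.sg
  lO : G.NoMean S.lO
  otx : G.NoMean S.otx
  otxb : G.NoMean S.otxb
  om : G.NoMean S.om
  omb : G.NoMean S.omb
  rho : G.NoMean S.rho
  sigma : G.NoMean S.sigma
  K : G.NoMean S.K
  rhoF : G.NoMean S.rhoF
  sigmaF : G.NoMean S.sigmaF

/-- Partially initial data normalised solutions supported on `ℓ ≥ 1`. -/
structure PartiallyNormalised (S : Pert) : Prop where
  support : G.SupportedOnGeOne S
  otx_horizon : ∀ x, ‖x‖ = 1 → Tendsto (fun u => S.otx u G.v₀ x) atTop (𝓝 0)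
  mu_horizon : ∀ x, ‖x‖ = 1 →
    Tendsto (fun u => (G.div S.eta + S.rho) u G.v₀ x) atTop (𝓝 0)
  K_infinity : ∀ x, ‖x‖ = 1 → Tendsto (fun v => (G.r ^ 2 ⊙ S.K) G.u₀ v x) atTop (𝓝 0)

/-- All derivatives `[r∇]ⁱ [∇_T]ʲ 𝒬`, `i + j ≤ 2`, of a quantity `𝒬` have limits at null infinity
and are bounded on `[u₀, u₁] × {v ≥ v₀} × S²` for every `u₁ > u₀`. -/
def Decays {n : ℕ} (T : SField n) : Prop :=
  ∀ i j : ℕ, i + j ≤ 2 →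
    (∀ u x, G.u₀ ≤ u → ‖x‖ = 1 →
      ∃ L, Tendsto (fun v => G.rnabPow (G.nabT^[j] T) i u v x) atTop (𝓝 L)) ∧
    (∀ u₁, G.u₀ < u₁ → ∃ C : ℝ, ∀ u v x, u ∈ Icc G.u₀ u₁ → G.v₀ ≤ v → ‖x‖ = 1 →
      √(tsq (G.rnabPow (G.nabT^[j] T) i u v x)) ≤ C)

/-- The weight `r^p`. -/
def rpw (p : ℝ) : ℝ → ℝ → ℝ := fun u v => G.r u v ^ p

/-- The decay assumptions towards null infinity, with exponent `s`. -/
structure DecayWith (s : ℝ) (S : Pert) : Prop where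
  alpha : G.Decays (G.rpw (3 + s) ⊙ S.alpha)
  beta : G.Decays (G.rpw (3 + s) ⊙ S.beta)
  rho : G.Decays (G.r ^ 3 ⊙ S.rho)
  sigma : G.Decays (G.r ^ 3 ⊙ S.sigma)
  betab : G.Decays (G.r ^ 2 ⊙ S.betab)
  alphab : G.Decays (G.r ⊙ S.alphab)
  betaF : G.Decays (G.rpw (2 + s) ⊙ S.betaF)
  rhoF : G.Decays (G.r ^ 2 ⊙ S.rhoF)
  sigmaF : G.Decays (G.r ^ 2 ⊙ S.sigmaF)
  betabF : G.Decays (G.r ⊙ S.betabF)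
  chi : G.Decays (G.r ^ 2 ⊙ S.chi)
  chib : G.Decays (G.r ⊙ S.chib)
  eta : G.Decays (G.r ⊙ S.eta)
  etab : G.Decays (G.r ^ 2 ⊙ S.etab)
  div_eta : G.Decays (G.r ^ 2 ⊙ G.div S.eta)
  div_etab : G.Decays (G.r ^ 3 ⊙ G.div S.etab)
  om : G.Decays (G.rpw (2 + s) ⊙ S.om)
  omb : G.Decays S.omb
  otx : G.Decays (G.r ^ 2 ⊙ S.otx)
  otxb : G.Decays (G.r ⊙ S.otxb)
  lO : G.Decays S.lO
  K : G.Decays (G.r ^ 3 ⊙ S.K)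

/-- The decay assumptions towards null infinity, for some `s ∈ (0, 1)`. -/
def DecayAssumptions (S : Pert) : Prop := ∃ s ∈ Ioo (0 : ℝ) 1, G.DecayWith s S

/-- The surface gravity `κ = (r₊ - r₋) / (2 r₊²)` of the event horizon. -/
def kappa : ℝ := (rPlus G.M G.Q - rMinus G.M G.Q) / (2 * rPlus G.M G.Q ^ 2)

/-- Along the initial ingoing cone `v = v₀` the field extends smoothly to the event horizon
`u = ∞`, that is, to `U = 0` in terms of the regular (Kruskal) coordinate `U = e^{-2κu}`. -/
def ExtendsToHorizon {n : ℕ} (T : SField n) : Prop :=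
  ∃ g : ℝ × E3 → Tensor n,
    ContDiffOn ℝ ∞ g (Icc 0 (Real.exp (-(2 * G.kappa * G.u₀))) ×ˢ {0}ᶜ) ∧
    ∀ u x, G.u₀ ≤ u → ‖x‖ = 1 → T u G.v₀ x = g (Real.exp (-(2 * G.kappa * u)), x)

/-- Regularity of the initial data at the event horizon: the renormalised quantities extend
smoothly along the initial ingoing cone. -/
structure RegularData (S : Pert) : Prop where
  lO : G.ExtendsToHorizon S.lO
  otx : G.ExtendsToHorizon S.otx
  otxb : G.ExtendsToHorizon ((G.Om ^ 2)⁻¹ ⊙ S.otxb)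
  om : G.ExtendsToHorizon S.om
  omb : G.ExtendsToHorizon ((G.Om ^ 2)⁻¹ ⊙ S.omb)
  eta : G.ExtendsToHorizon S.eta
  etab : G.ExtendsToHorizon S.etab
  chi : G.ExtendsToHorizon (G.Om ⊙ S.chi)
  chib : G.ExtendsToHorizon (G.Om⁻¹ ⊙ S.chib)
  K : G.ExtendsToHorizon S.K
  beta : G.ExtendsToHorizon (G.Om ⊙ S.beta)
  betab : G.ExtendsToHorizon (G.Om⁻¹ ⊙ S.betab)
  alpha : G.ExtendsToHorizon (G.Om ^ 2 ⊙ S.alpha)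
  alphab : G.ExtendsToHorizon ((G.Om ^ 2)⁻¹ ⊙ S.alphab)
  rho : G.ExtendsToHorizon S.rho
  sigma : G.ExtendsToHorizon S.sigma
  betaF : G.ExtendsToHorizon (G.Om ⊙ S.betaF)
  betabF : G.ExtendsToHorizon (G.Om⁻¹ ⊙ S.betabF)
  rhoF : G.ExtendsToHorizon S.rhoF
  sigmaF : G.ExtendsToHorizon S.sigmaF

/-! ## Energies -/

/-- `λ = (r/Ω²) (Ω tr χ)⁽¹⁾ - 4 Ω⁻¹Ω⁽¹⁾`. -/
def lam (S : Pert) : SField 0 := (G.r / G.Om ^ 2) ⊙ S.otx - 4 ⊙ S.lO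

/-- `X = 2r³ (ρ⁽¹⁾ - div η̲⁽¹⁾) + (r²/Ω²) [r²Δ] (Ω tr χ)⁽¹⁾`. -/
def X (S : Pert) : SField 0 :=
  (2 * G.r ^ 3) ⊙ (S.rho - G.div S.etab)
    + (G.r ^ 2 / G.Om ^ 2) ⊙ (G.r ^ 2 ⊙ G.lap S.otx)

/-- The sphere norm `‖Θ‖²_{u,v}`. -/
def normSq {n : ℕ} (T : SField n) (u v : ℝ) : ℝ := sphInt (fun x => tsq (T u v x))

/-- The sphere integral of the density of the flux `E_u` through outgoing cones. -/
def outDensity (S : Pert) (u v : ℝ) : ℝ := sphInt fun x =>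
  (tsq ((G.Om ⊙ S.chi) u v x) + 2 * tsq ((G.Om ⊙ S.etab) u v x)
    + 2 * tsq ((G.Om ⊙ S.betaF) u v x) + 2 * tsq ((G.Om ⊙ S.sigmaF) u v x)
    + 2 * tsq ((G.Om ⊙ S.rhoF) u v x)
    + G.r u v * tinner (S.otx u v x) ((S.rho + G.div S.etab) u v x)) * G.r u v ^ 2

/-- The sphere integral of the density of the flux `E_v` through ingoing cones. -/
def inDensity (S : Pert) (u v : ℝ) : ℝ := sphInt fun x =>
  (tsq ((G.Om ⊙ S.chib) u v x) + 2 * tsq ((G.Om ⊙ S.eta) u v x)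
    + 2 * tsq ((G.Om ⊙ S.betabF) u v x) + 2 * tsq ((G.Om ⊙ S.sigmaF) u v x)
    + 2 * tsq ((G.Om ⊙ S.rhoF) u v x)
    - G.r u v * tinner (S.otxb u v x) ((S.rho + G.div S.eta) u v x)) * G.r u v ^ 2

/-- The initial outgoing flux `E_{u₀}[S](v₀, ∞)`. -/
def outFlux (S : Pert) : ℝ := ∫ v in Ioi G.v₀, G.outDensity S G.u₀ v

/-- The initial ingoing flux `E_{v₀}[S](u₀, u₁)`. -/
def inFlux (S : Pert) (u₁ : ℝ) : ℝ := ∫ u in G.u₀..u₁, G.inDensity S u G.v₀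

/-- The data quantity
`E_{u₀}(v₀,∞) + E_{v₀}(u₀,u₁) + Λ (‖Ω⁻¹λ‖²_{u₁,v₀} + ‖Ω⁻¹X‖²_{u₁,v₀})`. -/
def dataEnergy (Λ : ℝ) (S : Pert) (u₁ : ℝ) : ℝ :=
  G.outFlux S + G.inFlux S u₁ +
    Λ * (normSq (G.Om⁻¹ ⊙ G.lam S) u₁ G.v₀ + normSq (G.Om⁻¹ ⊙ G.X S) u₁ G.v₀)

/-- The sphere integral of the density of the coercive master energy on outgoing cones. -/
def masterDensity (S : Pert) (u v : ℝ) : ℝ := sphInt fun x =>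
  (tsq (S.chi u v x)
    + tsq ((S.etab - (1 / 2) ⊙ G.rnab ((G.Om ^ 2)⁻¹ ⊙ S.otx)) u v x)
    + tsq (S.betaF u v x) + tsq (S.sigmaF u v x)
    + tsq ((S.rhoF - (fun u v => G.Q / G.r u v ^ 2) ⊙ G.lam S) u v x))
      * (G.Om u v ^ 2 * G.r u v ^ 2)

/-- The master energy along the cone `u = u₁`, given the limit `Xinf` of `X(u₁, v, ·)` as
`v → ∞`. -/
def masterEnergy (S : Pert) (u₁ : ℝ) (Xinf : E3 → Tensor 0) : ℝ :=
  (∫ v in Ioi G.v₀, G.masterDensity S u₁ v) + sphInt (fun x => tsq (Xinf x))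

/-- The flux of `rΩχ̲̂` and `rΩβ̲^F` through `{u₀ ≤ u ≤ u₁}` on the ingoing cone of `v`. -/
def radFlux (S : Pert) (u₁ v : ℝ) : ℝ := ∫ u in G.u₀..u₁, sphInt fun x =>
  tsq (((G.r * G.Om) ⊙ S.chib) u v x) + tsq (((G.r * G.Om) ⊙ S.betabF) u v x)

end Geom

end RN

end

/-! The system carries a conserved current. The u-derivative of the density of `outDensity` plus the
v-derivative of that of `inDensity` has zero mean on each sphere (`outField_inField_deriv`,
`sphNull_deriv`), since the angular operators occur in adjoint pairs: D₂^* with div, D₁^* with (div,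
curl), ∇ with -div. So the fluxes through the sides of a characteristic rectangle balance
(`energy_conservation`). Neither density has a sign; the work is to make both fluxes coercive up to
boundary terms.

Outgoing cones. Put m = 6M - 8Q²/r and τ = `otx`. Then ∂_v λ = -τ and ∂_v X = mτ - 8Ω²Q·`S.rhoF`.
Writing `S.rho` through X and integrating by parts on spheres, the density becomes r²|Ωχ̂|² +
2Ω²r²(|η̲ - ½r∇(τ/Ω²)|² + |β_F|² + |σ_F|² + g²) - ½∂_v(λX + ½mλ²), where g = `S.rhoF` - Qλ/r². The
boundary term is X²/(4m) - Y²/(4m) with Y = X + mλ, so its second half has the wrong sign. However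
∂_v Y = -8Ω²Qg, so adding Y²/(4m_δ), m_δ = 6M - 8Q²/((1-δ)r), costs only part of the g² term
(`outField_ge`), and the resulting potential `psi` dominates X²/(24M) (`psi_ge`). This needs m_δ > 0
down to r₊; for small δ that is 4Q² < 3M r₊, which is exactly |Q| < (√15/4)M (`exists_coercivity`).

Ingoing cones. As v → ∞ the Gauss equation gives `otxb` = -4Ω²`lO`/r to leading order, and η is
2∇`lO` to leading order. The terms of the flux without a sign then combine to 8Ω²(wΔw + |∇w|²), w =
`lO`, on the unit sphere, which integrates to zero; what remains is at least the radiation flux, up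
to O(1/r) (`exists_inDensity_ge`). Letting v → ∞ in the balance law yields `energy_estimate`, with
`psi` at (u₁, v₀) controlled by λ and X there.

Event horizon. With U = e^{-2κu} one has Ω² ~ U on v = v₀. The normalisation makes Ω²λ and its
Laplacian O(U), and their u-derivatives O(U²), hence both are O(U²) after integration from the
horizon (`lapOrd_lapseLam`); the same follows for Ω²X. The ingoing density is O(U), which is
integrable in u. Together these bound the data energy (`bddAbove_dataEnergy`). -/

noncomputable section

namespace RN

/-! ## Calculus on the unit sphere -/

section Sphere

variable {V W : Type*} [NormedAddCommGroup V] [NormedSpace ℝ V]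
  [NormedAddCommGroup W] [NormedSpace ℝ W]

/-- Smoothness of a field on the unit sphere. -/
def SphSmooth (T : E3 → V) : Prop := ContDiffOn ℝ ∞ (ext T) {0}ᶜ

/-- The `a`-th Cartesian derivative of the homogeneous extension. -/
def dd (a : Fin 3) (T : E3 → V) (x : E3) : V :=
  fderiv ℝ (ext T) x (EuclideanSpace.single a 1)

theorem ext_smul {V : Type*} (T : E3 → V) {t : ℝ} (ht : 0 < t) (x : E3) :
    ext T (t • x) = ext T x := by
  simp only [ext, norm_smul, Real.norm_eq_abs, abs_of_pos ht, smul_smul, mul_inv]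
  congr 2
  field_simp

theorem ext_of_norm_one {V : Type*} (T : E3 → V) {x : E3} (hx : ‖x‖ = 1) : ext T x = T x := by
  simp [ext, hx]

theorem ext_congr {V : Type*} {T T' : E3 → V} (h : ∀ x, ‖x‖ = 1 → T x = T' x) {x : E3}
    (hx : x ≠ 0) : ext T x = ext T' x :=
  h _ (by simp [norm_smul, norm_ne_zero_iff.2 hx])

theorem ne_zero_of_norm_one {x : E3} (hx : ‖x‖ = 1) : x ≠ 0 := by
  rintro rfl; simp at hx

theorem ext_eventuallyEq {V : Type*} {T T' : E3 → V} (h : ∀ x, ‖x‖ = 1 → T x = T' x) {x : E3}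
    (hx : x ≠ 0) : ext T =ᶠ[𝓝 x] ext T' := by
  filter_upwards [isOpen_compl_singleton.mem_nhds hx] with y hy using ext_congr h hy

theorem dd_congr {T T' : E3 → V} (h : ∀ x, ‖x‖ = 1 → T x = T' x) {x : E3} (hx : x ≠ 0)
    (a : Fin 3) : dd a T x = dd a T' x := by
  rw [dd, dd, (ext_eventuallyEq h hx).fderiv_eq]

theorem SphSmooth.congr {T T' : E3 → V} (hT : SphSmooth T) (h : ∀ x, ‖x‖ = 1 → T' x = T x) :
    SphSmooth T' :=
  ContDiffOn.congr hT fun _ hx => ext_congr h hx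

theorem SphSmooth.contDiffAt {T : E3 → V} (hT : SphSmooth T) {x : E3} (hx : x ≠ 0) :
    ContDiffAt ℝ ∞ (ext T) x :=
  ContDiffOn.contDiffAt hT (isOpen_compl_singleton.mem_nhds hx)

theorem SphSmooth.differentiableAt {T : E3 → V} (hT : SphSmooth T) {x : E3} (hx : x ≠ 0) :
    DifferentiableAt ℝ (ext T) x :=
  (hT.contDiffAt hx).differentiableAt (by simp)

theorem dd_smul_point (a : Fin 3) (T : E3 → V) {t : ℝ} (ht : 0 < t) (x : E3) :
    dd a T (t • x) = t⁻¹ • dd a T x := by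
  have h : (fun y => ext T (t • y)) = ext T := funext fun y => ext_smul T ht y
  have h2 := fderiv_comp_smul (𝕜 := ℝ) (f := ext T) (x := x) t
  rw [h] at h2
  rw [dd, dd, h2]
  simp [smul_smul, ht.ne']

theorem sum_single (x : E3) : ∑ a, x a • (EuclideanSpace.single a (1 : ℝ) : E3) = x := by
  ext i
  fin_cases i <;> simp [Fin.sum_univ_three]

/-- Euler's identity in degree zero: the extension is constant on rays, so its radial derivative
vanishes. -/
theorem sum_smul_dd {T : E3 → V} (hT : SphSmooth T) {x : E3} (hx : x ≠ 0) :
    ∑ a, x a • dd a T x = 0 := by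
  have h1 : ∑ a, x a • dd a T x = fderiv ℝ (ext T) x x := by
    have h := congrArg (fderiv ℝ (ext T) x) (sum_single x)
    rw [map_sum] at h
    rw [← h]
    exact Finset.sum_congr rfl fun a _ => ((fderiv ℝ (ext T) x).map_smul _ _).symm
  rw [h1]
  have hd := (hT.differentiableAt hx).hasFDerivAt
  have hl : HasDerivAt (fun t : ℝ => t • x) x 1 := by
    simpa using (hasDerivAt_id (1 : ℝ)).smul_const x
  have h2 : HasDerivAt (fun t : ℝ => ext T (t • x)) (fderiv ℝ (ext T) x x) 1 :=
    HasFDerivAt.comp_hasDerivAt (1 : ℝ) (l := ext T) (f := fun t : ℝ => t • x)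
      (by simpa using hd) hl
  have h3 : HasDerivAt (fun t : ℝ => ext T (t • x)) 0 1 := by
    refine (hasDerivAt_const (1 : ℝ) (ext T x)).congr_of_eventuallyEq ?_
    filter_upwards [lt_mem_nhds (zero_lt_one (α := ℝ))] with t ht using ext_smul T ht x
  exact h2.unique h3

theorem sum_sq_of_norm_one {x : E3} (hx : ‖x‖ = 1) : x 0 ^ 2 + x 1 ^ 2 + x 2 ^ 2 = 1 := by
  have := EuclideanSpace.real_norm_sq_eq x
  rw [hx, Fin.sum_univ_three] at this
  linarith

theorem sum_proj_smul_dd {T : E3 → V} (hT : SphSmooth T) {x : E3} (hx : x ≠ 0) (a : Fin 3) :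
    ∑ b, proj x a b • dd b T x = dd a T x := by
  simp only [proj, sub_smul, Finset.sum_sub_distrib]
  have : ∑ b, (x a * x b) • dd b T x = 0 := by
    simp only [mul_smul, ← Finset.smul_sum, sum_smul_dd hT hx, smul_zero]
  rw [this]
  simp

theorem sum_tensor_succ {n : ℕ} {M : Type*} [AddCommMonoid M] (F : (Fin (n + 1) → Fin 3) → M) :
    ∑ J, F J = ∑ a, ∑ J : Fin n → Fin 3, F (Fin.cons a J) := by
  rw [← Fintype.sum_prod_type']
  exact (Fintype.sum_equiv (Fin.consEquiv fun _ => Fin 3) _ _ fun _ => rfl).symm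

theorem sum_tensor_zero {M : Type*} [AddCommMonoid M] (F : (Fin 0 → Fin 3) → M) :
    ∑ J, F J = F ![] := by
  rw [Fintype.sum_unique]
  congr 1

theorem sum_tensor_one {M : Type*} [AddCommMonoid M] (F : (Fin 1 → Fin 3) → M) :
    ∑ J, F J = ∑ a, F ![a] := by
  rw [sum_tensor_succ]
  exact Finset.sum_congr rfl fun a _ => sum_tensor_zero _

theorem sum_tensor_two {M : Type*} [AddCommMonoid M] (F : (Fin 2 → Fin 3) → M) :
    ∑ J, F J = ∑ a, ∑ b, F ![a, b] := by
  rw [sum_tensor_succ]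
  exact Finset.sum_congr rfl fun a _ => sum_tensor_one _

/-- The extension has no radial derivative, so the projection of the derivative index in `nabla`
acts trivially and only the tensor slots keep theirs. -/
theorem nabla_cons {n : ℕ} {T : E3 → Tensor n} (hT : SphSmooth T) {x : E3} (hx : x ≠ 0)
    (a : Fin 3) (I : Fin n → Fin 3) :
    nabla T x (Fin.cons a I) = ∑ J : Fin n → Fin 3, (∏ k, proj x (I k) (J k)) * dd a T x J := by
  have h := sum_proj_smul_dd hT hx a
  rw [nabla, sum_tensor_succ, Finset.sum_comm]
  refine Finset.sum_congr rfl fun J _ => ?_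
  rw [← h]
  simp only [Fin.prod_univ_succ, Fin.cons_zero, Fin.cons_succ, Fin.tail_cons, Finset.sum_apply,
    Pi.smul_apply, smul_eq_mul, Finset.mul_sum]
  exact Finset.sum_congr rfl fun b _ => by rw [dd]; ring

theorem nabla_zero_apply {f : E3 → Tensor 0} (hf : SphSmooth f) {x : E3} (hx : x ≠ 0)
    (a : Fin 3) : nabla f x ![a] = dd a f x ![] := by
  have := nabla_cons hf hx a ![]
  rw [sum_tensor_zero] at this
  simpa using this

theorem nabla_one_apply {ξ : E3 → Tensor 1} (hf : SphSmooth ξ) {x : E3} (hx : x ≠ 0)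
    (a b : Fin 3) : nabla ξ x ![a, b] = ∑ d, proj x b d * dd a ξ x ![d] := by
  have := nabla_cons hf hx a ![b]
  rw [sum_tensor_one] at this
  simpa using this

theorem nabla_two_apply {θ : E3 → Tensor 2} (hf : SphSmooth θ) {x : E3} (hx : x ≠ 0)
    (a b c : Fin 3) :
    nabla θ x ![a, b, c] = ∑ d, ∑ e, proj x b d * proj x c e * dd a θ x ![d, e] := by
  have := nabla_cons hf hx a ![b, c]
  rw [sum_tensor_two] at this
  simpa using this

theorem sum_proj_mul_dd {n : ℕ} {T : E3 → Tensor n} (hT : SphSmooth T) {x : E3} (hx : x ≠ 0)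
    (a : Fin 3) (I : Fin n → Fin 3) : ∑ b, proj x a b * dd b T x I = dd a T x I := by
  have := congrFun (sum_proj_smul_dd hT hx a) I
  simpa using this

theorem proj_symm (x : E3) (a b : Fin 3) : proj x a b = proj x b a := by
  simp [proj, eq_comm, mul_comm]

/-- In the trace, the projection of the slot can be moved onto the derivative index, where it is
trivial. What is left is the Cartesian divergence of the extension. -/
theorem sdiv_one_apply {ξ : E3 → Tensor 1} (hf : SphSmooth ξ) {x : E3} (hx : x ≠ 0) :
    sdiv ξ x ![] = ∑ a, dd a ξ x ![a] := by
  have : sdiv ξ x ![] = ∑ a, nabla ξ x ![a, a] := rfl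
  simp only [this, nabla_one_apply hf hx]
  rw [Finset.sum_comm]
  refine Finset.sum_congr rfl fun d _ => ?_
  rw [← sum_proj_mul_dd hf hx d]
  exact Finset.sum_congr rfl fun b _ => by rw [proj_symm]

theorem sdiv_two_apply {θ : E3 → Tensor 2} (hf : SphSmooth θ) {x : E3} (hx : x ≠ 0)
    (c : Fin 3) : sdiv θ x ![c] = ∑ a, ∑ e, proj x c e * dd a θ x ![a, e] := by
  have : sdiv θ x ![c] = ∑ a, nabla θ x ![a, a, c] := rfl
  simp only [this, nabla_two_apply hf hx]
  rw [Finset.sum_comm]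
  refine Finset.sum_congr rfl fun d _ => ?_
  rw [Finset.sum_comm]
  refine Finset.sum_congr rfl fun e _ => ?_
  rw [← sum_proj_mul_dd hf hx d, Finset.mul_sum]
  exact Finset.sum_congr rfl fun b _ => by rw [proj_symm x b d]; ring

theorem sum_eps_proj {x : E3} (hx : ‖x‖ = 1) (a d : Fin 3) :
    ∑ b, eps x a b * proj x b d = eps x a d := by
  have := sum_sq_of_norm_one hx
  fin_cases a <;> fin_cases d <;> simp [Fin.sum_univ_three, eps, proj] <;> ring

/-- The form ε annihilates the normal, so it absorbs the projection of the slot. -/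
theorem scurl_one_apply {ξ : E3 → Tensor 1} (hf : SphSmooth ξ) {x : E3} (hx : ‖x‖ = 1) :
    scurl ξ x ![] = ∑ a, ∑ b, eps x a b * dd a ξ x ![b] := by
  have : scurl ξ x ![] = ∑ a, ∑ b, eps x a b * nabla ξ x ![a, b] := rfl
  simp only [this, nabla_one_apply hf (ne_zero_of_norm_one hx), Finset.mul_sum]
  refine Finset.sum_congr rfl fun a _ => ?_
  rw [Finset.sum_comm]
  refine Finset.sum_congr rfl fun d _ => ?_
  rw [← sum_eps_proj hx a d, Finset.sum_mul]
  exact Finset.sum_congr rfl fun b _ => by ring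

end Sphere

/-! ### Polar coordinates and the divergence theorem on the sphere. -/

theorem integral_polar (F : E3 → ℝ) :
    ∫ x, F x = ∫ p : Metric.sphere (0 : E3) 1 × Ioi (0 : ℝ), F (p.2.1 • p.1.1)
      ∂((volume : Measure E3).toSphere.prod (Measure.volumeIoiPow 2)) := by
  have hd : Module.finrank ℝ E3 - 1 = 2 := by simp
  have h := (volume : Measure E3).measurePreserving_homeomorphUnitSphereProd.integral_comp
    (Homeomorph.measurableEmbedding _)
    (fun p : Metric.sphere (0 : E3) 1 × Ioi (0 : ℝ) => F (p.2.1 • p.1.1))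
  rw [hd] at h
  calc ∫ x, F x = ∫ x : ({(0 : E3)}ᶜ : Set E3), F x ∂((volume : Measure E3).comap (↑)) := by
        rw [integral_subtype_comap (measurableSet_singleton (0 : E3)).compl F,
          restrict_compl_singleton]
    _ = _ := by
        rw [← h]
        refine integral_congr_ae (Eventually.of_forall fun x => ?_)
        have hx : ‖(x : E3)‖ ≠ 0 := norm_ne_zero_iff.2 x.2
        simp [smul_smul, hx]

/-- Evaluated at ‖x‖², such a cutoff lives in the shell 1 ≤ ‖x‖ ≤ 2, away from the singularity of
homogeneous extensions at the origin. Positivity at 2 keeps the radial integral from vanishing. -/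
theorem exists_cutoff : ∃ φ : ℝ → ℝ, ContDiff ℝ ∞ φ ∧ (∀ t, 0 ≤ φ t) ∧ (∀ t, t ≤ 1 → φ t = 0) ∧
    (∀ t, 4 ≤ t → φ t = 0) ∧ 0 < φ 2 := by
  let b : ContDiffBump (2 : ℝ) := ⟨1 / 2, 1, by norm_num, by norm_num⟩
  refine ⟨b, b.contDiff, fun t => b.nonneg, fun t ht => ?_, fun t ht => ?_, ?_⟩
  · exact b.zero_of_le_dist (by rw [Real.dist_eq, abs_sub_comm]; exact le_abs.2 (Or.inl (by linarith)))
  · exact b.zero_of_le_dist (by rw [Real.dist_eq]; exact le_abs.2 (Or.inl (by linarith)))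
  · exact b.pos_of_mem_ball (by simp [b])

theorem sum_mul_of_tangential {ξ : E3 → Tensor 1} (ht : ∀ x, ‖x‖ = 1 → ∑ a, x a * ξ x ![a] = 0)
    {x : E3} (hx : x ≠ 0) : ∑ a, x a * ext ξ x ![a] = 0 := by
  have h := ht (‖x‖⁻¹ • x) (by simp [norm_smul, norm_ne_zero_iff.2 hx])
  simp only [PiLp.smul_apply, smul_eq_mul, mul_assoc, ← Finset.mul_sum] at h
  exact (mul_eq_zero.1 h).resolve_left (inv_ne_zero (norm_ne_zero_iff.2 hx))

/-- The divergence theorem on the unit sphere. -/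
theorem sphInt_sdiv {ξ : E3 → Tensor 1} (hξ : SphSmooth ξ)
    (ht : ∀ x, ‖x‖ = 1 → ∑ a, x a * ξ x ![a] = 0) : sphInt (fun x => sdiv ξ x ![]) = 0 := by
  obtain ⟨φ, hφ, hφ0, hφ1, hφ4, hφ2⟩ := exists_cutoff
  -- A smooth compactly supported vector field on ℝ³: its Euclidean divergence integrates to zero,
  -- and tangency of ξ removes the derivative of the cutoff from that divergence.
  set V : Fin 3 → E3 → ℝ := fun a x => φ (‖x‖ ^ 2) * ext ξ x ![a] with hV
  have hVs : ∀ a, ContDiff ℝ ∞ (V a) := fun a => by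
    rw [contDiff_iff_contDiffAt]
    intro x
    by_cases hx : x = 0
    · have : V a =ᶠ[𝓝 x] fun _ => 0 := by
        rw [hx]
        filter_upwards [Metric.ball_mem_nhds (0 : E3) one_pos] with y hy
        have : ‖y‖ < 1 := by simpa using hy
        simp only [hV]
        rw [hφ1 _ (by nlinarith [norm_nonneg y]), zero_mul]
      exact contDiffAt_const.congr_of_eventuallyEq this
    · exact ((hφ.comp (contDiff_norm_sq ℝ)).contDiffAt).mul
        (contDiffAt_pi.1 (hξ.contDiffAt hx) ![a])
  have hVc : ∀ a, HasCompactSupport (V a) := fun a => by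
    refine HasCompactSupport.intro (isCompact_closedBall (0 : E3) 2) fun x hx => ?_
    have : 2 < ‖x‖ := by simpa using hx
    simp only [hV]
    rw [hφ4 _ (by nlinarith), zero_mul]
  have hi : ∀ a, Integrable fun x => fderiv ℝ (V a) x (EuclideanSpace.single a 1) := fun a =>
    (((hVs a).continuous_fderiv (by simp)).clm_apply
      continuous_const).integrable_of_hasCompactSupport ((hVc a).fderiv_apply ℝ _)
  have hint : ∀ a, ∫ x, fderiv ℝ (V a) x (EuclideanSpace.single a 1) = 0 := fun a => by
    have h := integral_mul_fderiv_eq_neg_fderiv_mul_of_integrable (𝕜 := ℝ)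
      (μ := (volume : Measure E3)) (f := fun _ => 1) (g := V a) (v := EuclideanSpace.single a 1)
      (by simp) (by simpa using hi a)
      (by simpa using (hVs a).continuous.integrable_of_hasCompactSupport (hVc a))
      (fun x _ => differentiableAt_const _)
      (fun x _ => (hVs a).differentiable (by simp) x)
    simpa using h
  have hdiv : ∀ x : E3, x ≠ 0 → ∑ a, fderiv ℝ (V a) x (EuclideanSpace.single a 1) =
      φ (‖x‖ ^ 2) * ∑ a, dd a ξ x ![a] := fun x hx => by
    have h1 : ∀ a, fderiv ℝ (V a) x (EuclideanSpace.single a 1) =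
        φ (‖x‖ ^ 2) * dd a ξ x ![a] + (deriv φ (‖x‖ ^ 2) * 2) * (x a * ext ξ x ![a]) := fun a => by
      have d1 : HasFDerivAt (fun y : E3 => ‖y‖ ^ 2) (2 • (innerSL ℝ x)) x :=
        (hasStrictFDerivAt_norm_sq x).hasFDerivAt
      have d2 := (hφ.differentiable (by simp) (‖x‖ ^ 2)).hasDerivAt.comp_hasFDerivAt x d1
      have d3 : HasFDerivAt (fun y => ext ξ y ![a])
          ((ContinuousLinearMap.proj (R := ℝ) (φ := fun _ : Fin 1 → Fin 3 => ℝ) ![a]).comp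
            (fderiv ℝ (ext ξ) x)) x :=
        (ContinuousLinearMap.proj (R := ℝ) (φ := fun _ : Fin 1 → Fin 3 => ℝ)
          ![a]).hasFDerivAt.comp x (hξ.differentiableAt hx).hasFDerivAt
      have d4 := d2.mul d3
      have d5 : fderiv ℝ (V a) x = _ := d4.fderiv
      rw [d5]
      simp [dd, EuclideanSpace.inner_single_right]
      ring
    simp only [h1, Finset.sum_add_distrib, ← Finset.mul_sum, sum_mul_of_tangential ht hx]
    ring
  have h0 : ∫ x, ∑ a, fderiv ℝ (V a) x (EuclideanSpace.single a 1) = 0 := by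
    rw [integral_finsetSum]
    · simp [hint]
    · exact fun a _ => hi a
  rw [integral_polar] at h0
  -- Derivatives of the extension are homogeneous of degree -1, so the integrand splits into a
  -- spherical and a radial factor.
  have h1 : ∀ p : Metric.sphere (0 : E3) 1 × Ioi (0 : ℝ),
      ∑ a, fderiv ℝ (V a) (p.2.1 • p.1.1) (EuclideanSpace.single a 1) =
      sdiv ξ p.1 ![] * (φ (p.2.1 ^ 2) * p.2.1⁻¹) := fun p => by
    have hp : ‖(p.1 : E3)‖ = 1 := by simp
    have hr : 0 < p.2.1 := p.2.2
    have hp0 := ne_zero_of_norm_one hp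
    rw [hdiv _ (smul_ne_zero hr.ne' hp0), sdiv_one_apply hξ hp0]
    simp only [dd_smul_point _ _ hr, norm_smul, hp, mul_one, Real.norm_eq_abs, sq_abs,
      Pi.smul_apply, smul_eq_mul, ← Finset.mul_sum]
    ring
  simp only [h1] at h0
  rw [integral_prod_mul (fun y : Metric.sphere (0 : E3) 1 => sdiv ξ y ![])
    (fun y : Ioi (0 : ℝ) => φ (y.1 ^ 2) * y.1⁻¹)] at h0
  -- A vanishing radial factor would force the integral of φ(‖x‖²)/‖x‖ over ℝ³ to vanish, although
  -- this function is continuous, nonnegative, and positive where ‖x‖² = 2.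
  refine (mul_eq_zero.1 h0).resolve_right fun h2 => ?_
  have hF := integral_polar fun x => φ (‖x‖ ^ 2) * ‖x‖⁻¹
  have h3 : ∀ p : Metric.sphere (0 : E3) 1 × Ioi (0 : ℝ),
      φ (‖p.2.1 • (p.1.1 : E3)‖ ^ 2) * ‖p.2.1 • (p.1.1 : E3)‖⁻¹ =
      1 * (φ (p.2.1 ^ 2) * p.2.1⁻¹) := fun p => by
    have hp : ‖(p.1 : E3)‖ = 1 := by simp
    have hr : 0 < p.2.1 := p.2.2
    simp only [norm_smul, hp, mul_one, Real.norm_eq_abs, abs_of_pos hr, one_mul]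
  simp only [h3] at hF
  rw [integral_prod_mul (fun y : Metric.sphere (0 : E3) 1 => (1 : ℝ))
    (fun y : Ioi (0 : ℝ) => φ (y.1 ^ 2) * y.1⁻¹), h2, mul_zero] at hF
  have hcont : Continuous fun x : E3 => φ (‖x‖ ^ 2) * ‖x‖⁻¹ := by
    rw [continuous_iff_continuousAt]
    intro x
    by_cases hx : x = 0
    · have : (fun x : E3 => φ (‖x‖ ^ 2) * ‖x‖⁻¹) =ᶠ[𝓝 x] fun _ => 0 := by
        rw [hx]
        filter_upwards [Metric.ball_mem_nhds (0 : E3) one_pos] with y hy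
        have : ‖y‖ < 1 := by simpa using hy
        rw [hφ1 _ (by nlinarith [norm_nonneg y]), zero_mul]
      exact continuousAt_const.congr this.symm
    · have := hφ.continuous
      exact ContinuousAt.mul (by fun_prop)
        (ContinuousAt.inv₀ (by fun_prop) (norm_ne_zero_iff.2 hx))
  have hsupp : HasCompactSupport fun x : E3 => φ (‖x‖ ^ 2) * ‖x‖⁻¹ := by
    refine HasCompactSupport.intro (isCompact_closedBall (0 : E3) 2) fun x hx => ?_
    have : 2 < ‖x‖ := by simpa using hx
    rw [hφ4 _ (by nlinarith), zero_mul]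
  refine (hcont.integral_pos_of_hasCompactSupport_nonneg_nonzero (μ := (volume : Measure E3)) hsupp
    (fun x => mul_nonneg (hφ0 _) (by positivity)) (x := √2 • EuclideanSpace.single 0 1) ?_).ne' hF
  simp only [norm_smul, PiLp.norm_single, norm_one, mul_one, Real.norm_eq_abs, sq_abs,
    Real.sq_sqrt zero_le_two]
  exact mul_ne_zero hφ2.ne' (by positivity)

/-! ### Contractions and Leibniz rules for the Cartesian derivatives. -/

theorem tinner_zero (A B : Tensor 0) : tinner A B = A ![] * B ![] := by
  rw [tinner, sum_tensor_zero]

theorem tinner_one (A B : Tensor 1) : tinner A B = ∑ a, A ![a] * B ![a] := by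
  rw [tinner, sum_tensor_one]

theorem tinner_two (A B : Tensor 2) : tinner A B = ∑ a, ∑ b, A ![a, b] * B ![a, b] := by
  rw [tinner, sum_tensor_two]

theorem SphSmooth.apply {n : ℕ} {T : E3 → Tensor n} (hT : SphSmooth T) (I : Fin n → Fin 3) :
    SphSmooth fun x => T x I := contDiffOn_pi.1 hT I

theorem SphSmooth.pi {n : ℕ} {T : E3 → Tensor n} (hT : ∀ I, SphSmooth fun x => T x I) :
    SphSmooth T := contDiffOn_pi.2 hT

theorem SphSmooth.mul {f g : E3 → ℝ} (hf : SphSmooth f) (hg : SphSmooth g) :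
    SphSmooth fun x => f x * g x := ContDiffOn.mul hf hg

theorem SphSmooth.sum {ι : Type*} {s : Finset ι} {f : ι → E3 → ℝ} (hf : ∀ i ∈ s, SphSmooth (f i)) :
    SphSmooth fun x => ∑ i ∈ s, f i x := ContDiffOn.sum hf

theorem dd_apply {n : ℕ} {T : E3 → Tensor n} (hT : SphSmooth T) {x : E3} (hx : x ≠ 0) (a : Fin 3)
    (I : Fin n → Fin 3) : dd a T x I = dd a (fun y => T y I) x := by
  have h := ((ContinuousLinearMap.proj (R := ℝ) (φ := fun _ : Fin n → Fin 3 => ℝ)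
    I).hasFDerivAt.comp x (hT.differentiableAt hx).hasFDerivAt).fderiv
  rw [dd, dd]
  exact (congrArg (fun L => L (EuclideanSpace.single a 1)) h).symm

theorem dd_mul {f g : E3 → ℝ} (hf : SphSmooth f) (hg : SphSmooth g) {x : E3} (hx : ‖x‖ = 1)
    (a : Fin 3) : dd a (fun y => f y * g y) x = f x * dd a g x + g x * dd a f x := by
  have h0 := ne_zero_of_norm_one hx
  have h : fderiv ℝ (ext fun y => f y * g y) x = _ :=
    ((hf.differentiableAt h0).hasFDerivAt.mul (hg.differentiableAt h0).hasFDerivAt).fderiv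
  rw [dd, h]
  simp [dd, ext_of_norm_one _ hx]

theorem dd_sum {ι : Type*} {s : Finset ι} {f : ι → E3 → ℝ} (hf : ∀ i ∈ s, SphSmooth (f i))
    {x : E3} (hx : x ≠ 0) (a : Fin 3) :
    dd a (fun y => ∑ i ∈ s, f i y) x = ∑ i ∈ s, dd a (f i) x := by
  have h : fderiv ℝ (ext fun y => ∑ i ∈ s, f i y) x = _ :=
    (HasFDerivAt.fun_sum fun i hi => ((hf i hi).differentiableAt hx).hasFDerivAt).fderiv
  rw [dd, h]
  simp [dd]

theorem sphSmooth_coord (i : Fin 3) : SphSmooth fun x : E3 => x i := by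
  intro x hx
  have hx : x ≠ 0 := hx
  have h1 : ContDiffAt ℝ ∞ (fun y : E3 => ‖y‖⁻¹ * y i) x :=
    ((contDiffAt_norm ℝ hx).inv (norm_ne_zero_iff.2 hx)).mul (by fun_prop)
  have e : (ext fun y : E3 => y i) = fun y => ‖y‖⁻¹ * y i := by funext y; simp [ext]
  exact ContDiffAt.contDiffWithinAt (by rw [e]; exact h1)

theorem dd_coord (i a : Fin 3) {x : E3} (hx : ‖x‖ = 1) :
    dd a (fun x : E3 => x i) x = proj x a i := by
  have h0 := ne_zero_of_norm_one hx
  have e : (ext fun y : E3 => y i) = fun y => ‖y‖⁻¹ * y i := by funext y; simp [ext]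
  have d1 : HasFDerivAt (fun y : E3 => ‖y‖) (‖x‖⁻¹ • innerSL ℝ x) x := by
    have := (hasStrictFDerivAt_norm_sq x).hasFDerivAt.sqrt (by simp [hx])
    simp only [Real.sqrt_sq (norm_nonneg _)] at this
    refine this.congr_fderiv ?_
    ext v; simp [hx]
  have d2 := (hasDerivAt_inv (norm_ne_zero_iff.2 h0)).comp_hasFDerivAt x d1
  have d3 : HasFDerivAt (fun y : E3 => y i) (EuclideanSpace.proj (𝕜 := ℝ) i) x :=
    (EuclideanSpace.proj (𝕜 := ℝ) i : E3 →L[ℝ] ℝ).hasFDerivAt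
  have h : fderiv ℝ (fun y : E3 => ‖y‖⁻¹ * y i) x = _ := (d2.mul d3).fderiv
  rw [dd, e, h]
  simp [hx, proj, EuclideanSpace.inner_single_right, eq_comm]
  ring

/-! ### Integration by parts on the sphere. -/

/-- Integrable scalar functions of vanishing mean on the unit sphere. -/
def SphNull (Z : E3 → ℝ) : Prop :=
  Integrable (fun x : Metric.sphere (0 : E3) 1 => Z x) (volume : Measure E3).toSphere ∧
    sphInt Z = 0

theorem sphInt_congr {f g : E3 → ℝ} (h : ∀ x, ‖x‖ = 1 → f x = g x) : sphInt f = sphInt g :=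
  integral_congr_ae (Eventually.of_forall fun x => h x (by simp))

theorem SphNull.congr {Z Z' : E3 → ℝ} (h : SphNull Z) (h' : ∀ x, ‖x‖ = 1 → Z' x = Z x) :
    SphNull Z' :=
  ⟨h.1.congr (Eventually.of_forall fun x => (h' x (by simp)).symm),
    (sphInt_congr h').trans h.2⟩

theorem SphNull.add {Z Z' : E3 → ℝ} (h : SphNull Z) (h' : SphNull Z') :
    SphNull fun x => Z x + Z' x :=
  ⟨h.1.add h'.1, by
    have := integral_add h.1 h'.1
    rw [sphInt, this]
    exact (congrArg₂ (· + ·) h.2 h'.2).trans (add_zero 0)⟩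

theorem SphNull.const_mul {Z : E3 → ℝ} (h : SphNull Z) (c : ℝ) : SphNull fun x => c * Z x :=
  ⟨h.1.const_mul c, by
    rw [sphInt, integral_const_mul]
    exact (congrArg (c * ·) h.2).trans (mul_zero c)⟩

theorem integrable_sphere_of_continuousOn {f : E3 → ℝ}
    (hf : ContinuousOn f (Metric.sphere (0 : E3) 1)) :
    Integrable (fun x : Metric.sphere (0 : E3) 1 => f x) (volume : Measure E3).toSphere :=
  (continuousOn_iff_continuous_domRestrict.1 hf).integrable_of_hasCompactSupport
    (HasCompactSupport.of_compactSpace _)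

theorem SphSmooth.continuousOn {V : Type*} [NormedAddCommGroup V] [NormedSpace ℝ V] {T : E3 → V}
    (hT : SphSmooth T) : ContinuousOn T (Metric.sphere (0 : E3) 1) := by
  refine (ContDiffOn.continuousOn (hT : ContDiffOn ℝ ∞ (ext T) {0}ᶜ)).mono ?_ |>.congr ?_
  · intro x hx; exact ne_zero_of_norm_one (by simpa using hx)
  · intro x hx; exact (ext_of_norm_one T (by simpa using hx)).symm

theorem SphSmooth.continuousOn_dd {V : Type*} [NormedAddCommGroup V] [NormedSpace ℝ V] {T : E3 → V}
    (hT : SphSmooth T) (a : Fin 3) : ContinuousOn (dd a T) (Metric.sphere (0 : E3) 1) := by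
  have h := ContDiffOn.continuousOn_fderiv_of_isOpen (hT : ContDiffOn ℝ ∞ (ext T) {0}ᶜ)
    isOpen_compl_singleton (by simp)
  refine (h.clm_apply continuousOn_const).mono ?_
  intro x hx; exact ne_zero_of_norm_one (by simpa using hx)

theorem sphNull_sdiv {ξ : E3 → Tensor 1} (hξ : SphSmooth ξ)
    (ht : ∀ x, ‖x‖ = 1 → ∑ a, x a * ξ x ![a] = 0) : SphNull fun x => sdiv ξ x ![] := by
  refine ⟨?_, sphInt_sdiv hξ ht⟩
  have : ContinuousOn (fun x => ∑ a, dd a ξ x ![a]) (Metric.sphere (0 : E3) 1) :=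
    continuousOn_finsetSum _ fun a _ => continuousOn_pi.1 (hξ.continuousOn_dd a) _
  refine integrable_sphere_of_continuousOn (f := fun x => sdiv ξ x ![]) (this.congr fun x hx => ?_)
  exact sdiv_one_apply hξ (ne_zero_of_norm_one (by simpa using hx))

/-- Tangential one-forms on the unit sphere. -/
def Tangential (ξ : E3 → Tensor 1) : Prop := ∀ x, ‖x‖ = 1 → ∑ a, x a * ξ x ![a] = 0

/-- Tangential symmetric traceless two-tensors on the unit sphere. -/
def SymTraceless (θ : E3 → Tensor 2) : Prop := ∀ x, ‖x‖ = 1 →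
    (∀ b, ∑ a, x a * θ x ![a, b] = 0) ∧ (∀ a b, θ x ![a, b] = θ x ![b, a]) ∧
      ∑ a, θ x ![a, a] = 0

/-- The function is the divergence of fξ. -/
theorem sphNull_mul_sdiv_add {f : E3 → Tensor 0} {ξ : E3 → Tensor 1} (hf : SphSmooth f)
    (hξ : SphSmooth ξ) (ht : Tangential ξ) :
    SphNull fun x => f x ![] * sdiv ξ x ![] + tinner (ξ x) (nabla f x) := by
  have hs : SphSmooth (fun x (I : Fin 1 → Fin 3) => f x ![] * ξ x I) :=
    SphSmooth.pi fun I => (hf.apply _).mul (hξ.apply _)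
  refine (sphNull_sdiv hs fun x hx => ?_).congr fun x hx => ?_
  · have := ht x hx
    simp only [mul_left_comm, ← Finset.mul_sum, this, mul_zero]
  · have h0 := ne_zero_of_norm_one hx
    rw [sdiv_one_apply hs h0, sdiv_one_apply hξ h0, tinner_one, Finset.mul_sum,
      ← Finset.sum_add_distrib]
    refine Finset.sum_congr rfl fun a _ => ?_
    rw [nabla_zero_apply hf h0, dd_apply hs h0, dd_apply hξ h0, dd_apply hf h0,
      dd_mul (hf.apply _) (hξ.apply _) hx]

theorem sum_eps_mul_coord (x : E3) (b : Fin 3) : ∑ a, x a * eps x a b = 0 := by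
  fin_cases b <;> simp [Fin.sum_univ_three, eps] <;> ring

theorem sphSmooth_eps (a b : Fin 3) : SphSmooth fun x => eps x a b := by
  have h := sphSmooth_coord
  have h0 : SphSmooth fun _ : E3 => (0 : ℝ) := contDiffOn_const
  have hn : ∀ i, SphSmooth fun x : E3 => -(x i) := fun i => ContDiffOn.neg (h i)
  fin_cases a <;> fin_cases b <;> simp [eps, h, h0, hn]

/-- The columns of ε are, up to sign, the infinitesimal rotations, hence divergence free. -/
theorem sum_dd_eps (b : Fin 3) {x : E3} (hx : ‖x‖ = 1) : ∑ a, dd a (fun x => eps x a b) x = 0 := by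
  have h := fun i a => dd_coord i a hx
  have h0 : ∀ a, dd a (fun _ : E3 => (0 : ℝ)) x = 0 := fun a => by
    have : (ext fun _ : E3 => (0 : ℝ)) = fun _ => 0 := rfl
    rw [dd, this]; simp
  have hn : ∀ i a, dd a (fun x : E3 => -(x i)) x = - proj x a i := fun i a => by
    rw [← dd_coord i a hx]
    have : (ext fun x : E3 => -(x i)) = fun x => -(ext (fun x : E3 => x i) x) := rfl
    rw [dd, this, fderiv_fun_neg]; rfl
  fin_cases b <;> simp [Fin.sum_univ_three, eps, h, h0, hn, proj] <;> ring

/-- Rotating ξ by ε gives a tangential form ζ with div ζ = curl ξ, and antisymmetry of ε turns the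
second half of D₁^* into -⟨ζ, ∇f₂⟩. Both halves are then instances of `sphNull_mul_sdiv_add`. -/
theorem sphNull_sD1 {f₁ f₂ : E3 → Tensor 0} {ξ : E3 → Tensor 1} (hf₁ : SphSmooth f₁)
    (hf₂ : SphSmooth f₂) (hξ : SphSmooth ξ) (ht : Tangential ξ) :
    SphNull fun x => tinner (ξ x) (sD1 f₁ f₂ x) - f₁ x ![] * sdiv ξ x ![]
      - f₂ x ![] * scurl ξ x ![] := by
  set ζ : E3 → Tensor 1 := fun x I => ∑ b, eps x (I 0) b * ξ x ![b] with hζ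
  have hs : SphSmooth ζ :=
    SphSmooth.pi fun I => SphSmooth.sum fun b _ => (sphSmooth_eps _ _).mul (hξ.apply _)
  have hζt : Tangential ζ := fun x hx => by
    simp only [hζ, Matrix.cons_val_zero, Finset.mul_sum]
    rw [Finset.sum_comm]
    refine Finset.sum_eq_zero fun b _ => ?_
    simp only [← mul_assoc, ← Finset.sum_mul, sum_eps_mul_coord, zero_mul]
  have hcurl : ∀ x, ‖x‖ = 1 → sdiv ζ x ![] = scurl ξ x ![] := fun x hx => by
    have h0 := ne_zero_of_norm_one hx
    rw [sdiv_one_apply hs h0, scurl_one_apply hξ hx]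
    have h1 : ∀ a, dd a ζ x ![a] = ∑ b, (eps x a b * dd a ξ x ![b]
        + ξ x ![b] * dd a (fun x => eps x a b) x) := fun a => by
      rw [dd_apply hs h0]
      simp only [hζ, Matrix.cons_val_zero]
      rw [dd_sum (fun b _ => (sphSmooth_eps _ _).mul (hξ.apply _)) h0]
      refine Finset.sum_congr rfl fun b _ => ?_
      rw [dd_mul (sphSmooth_eps _ _) (hξ.apply _) hx, dd_apply hξ h0]
    simp only [h1, Finset.sum_add_distrib]
    rw [add_eq_left, Finset.sum_comm]
    refine Finset.sum_eq_zero fun b _ => ?_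
    rw [← Finset.mul_sum, sum_dd_eps b hx, mul_zero]
  refine (((sphNull_mul_sdiv_add hf₁ hξ ht).const_mul (-1)).add
    ((sphNull_mul_sdiv_add hf₂ hs hζt).const_mul (-1))).congr fun x hx => ?_
  rw [hcurl x hx]
  simp only [tinner_one, sD1, hζ, eps, Fin.sum_univ_three, Matrix.cons_val_zero]
  simp
  ring

/-- The divergence of the contraction ζ = θ·η is ⟨div θ, η⟩ + ⟨θ, ∇η⟩, and a symmetric traceless θ
sees only the symmetric traceless part of ∇η, which is -D₂^*η. Tangency of θ and η lets every
projection be dropped. -/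
theorem sphNull_sD2 {θ : E3 → Tensor 2} {η : E3 → Tensor 1} (hθ : SphSmooth θ)
    (htθ : SymTraceless θ) (hη : SphSmooth η) (htη : Tangential η) :
    SphNull fun x => tinner (θ x) (sD2 η x) - tinner (sdiv θ x) (η x) := by
  set ζ : E3 → Tensor 1 := fun x I => ∑ b, θ x ![I 0, b] * η x ![b] with hζ
  have hs : SphSmooth ζ :=
    SphSmooth.pi fun I => SphSmooth.sum fun b _ => (hθ.apply _).mul (hη.apply _)
  have hζt : Tangential ζ := fun x hx => by
    simp only [hζ, Matrix.cons_val_zero, Finset.mul_sum]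
    rw [Finset.sum_comm]
    refine Finset.sum_eq_zero fun b _ => ?_
    simp only [← mul_assoc, ← Finset.sum_mul, (htθ x hx).1, zero_mul]
  refine ((sphNull_sdiv hs hζt).const_mul (-1)).congr fun x hx => ?_
  have h0 := ne_zero_of_norm_one hx
  obtain ⟨t1, t2, t3⟩ := htθ x hx
  have e1 : sdiv ζ x ![] = ∑ a, ∑ b, (θ x ![a, b] * dd a η x ![b]
        + η x ![b] * dd a θ x ![a, b]) := by
    rw [sdiv_one_apply hs h0]
    refine Finset.sum_congr rfl fun a _ => ?_
    rw [dd_apply hs h0]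
    simp only [hζ, Matrix.cons_val_zero]
    rw [dd_sum (fun b _ => (hθ.apply _).mul (hη.apply _)) h0]
    refine Finset.sum_congr rfl fun b _ => ?_
    rw [dd_mul (hθ.apply _) (hη.apply _) hx, dd_apply hη h0, dd_apply hθ h0]
  have e2 : tinner (sdiv θ x) (η x) = ∑ a, ∑ b, η x ![b] * dd a θ x ![a, b] := by
    rw [tinner_one]
    simp only [sdiv_two_apply hθ h0, Finset.sum_mul]
    rw [Finset.sum_comm]
    refine Finset.sum_congr rfl fun a _ => ?_
    rw [Finset.sum_comm]
    refine Finset.sum_congr rfl fun e _ => ?_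
    have : ∑ c, proj x c e * η x ![c] = η x ![e] := by
      have h := htη x hx
      simp only [proj, sub_mul, Finset.sum_sub_distrib, ite_mul, one_mul, zero_mul,
        Finset.sum_ite_eq', Finset.mem_univ, if_true]
      have : ∑ c, x c * x e * η x ![c] = x e * ∑ c, x c * η x ![c] := by
        rw [Finset.mul_sum]; exact Finset.sum_congr rfl fun c _ => by ring
      rw [this, h]; ring
    rw [← this, Finset.sum_mul]
    exact Finset.sum_congr rfl fun c _ => by ring
  have e3 : ∑ a, ∑ b, θ x ![a, b] * nabla η x ![a, b] = ∑ a, ∑ b, θ x ![a, b] * dd a η x ![b] := by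
    refine Finset.sum_congr rfl fun a _ => ?_
    simp only [nabla_one_apply hη h0, Finset.mul_sum]
    rw [Finset.sum_comm]
    refine Finset.sum_congr rfl fun d _ => ?_
    have : ∑ b, θ x ![a, b] * proj x b d = θ x ![a, d] := by
      have h := t1 a
      simp only [proj, mul_sub, Finset.sum_sub_distrib, mul_ite, mul_one, mul_zero,
        Finset.sum_ite_eq', Finset.mem_univ, if_true]
      have : ∑ b, θ x ![a, b] * (x b * x d) = x d * ∑ b, x b * θ x ![b, a] := by
        rw [Finset.mul_sum]; exact Finset.sum_congr rfl fun c _ => by rw [t2 a c]; ring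
      rw [this, h]; ring
    rw [← this, Finset.sum_mul]
    exact Finset.sum_congr rfl fun c _ => by ring
  have e4 : ∑ a, ∑ b, θ x ![a, b] * nabla η x ![b, a] =
      ∑ a, ∑ b, θ x ![a, b] * nabla η x ![a, b] := by
    rw [Finset.sum_comm]
    exact Finset.sum_congr rfl fun a _ => Finset.sum_congr rfl fun b _ => by rw [t2]
  have e5 : ∑ a, ∑ b, θ x ![a, b] * proj x a b = 0 := by
    have h : ∑ a, ∑ b, θ x ![a, b] * proj x a b =
        ∑ a, θ x ![a, a] - ∑ b, x b * ∑ a, x a * θ x ![a, b] := by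
      simp only [proj, Fin.sum_univ_three]; simp; ring
    rw [h, t3]; simp [t1]
  have e6 : tinner (θ x) (sD2 η x) = -(1 / 2) * (∑ a, ∑ b, θ x ![a, b] * nabla η x ![a, b]
      + ∑ a, ∑ b, θ x ![a, b] * nabla η x ![b, a]
      - sdiv η x ![] * ∑ a, ∑ b, θ x ![a, b] * proj x a b) := by
    rw [tinner_two]
    simp only [sD2, Matrix.cons_val_zero, Matrix.cons_val_one, Finset.mul_sum,
      ← Finset.sum_add_distrib, ← Finset.sum_sub_distrib]
    exact Finset.sum_congr rfl fun a _ => Finset.sum_congr rfl fun b _ => by ring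
  rw [e6, e5, e4, e3, e2, e1]
  simp only [Finset.sum_add_distrib]
  ring

/-! ## Smooth families of fields on the unit sphere -/

section Family

variable {E V W : Type*} [NormedAddCommGroup E] [NormedSpace ℝ E] [NormedAddCommGroup V]
  [NormedSpace ℝ V] [NormedAddCommGroup W] [NormedSpace ℝ W] {s : Set E}

/-- Joint smoothness of a family of fields on the unit sphere with parameters in `s`. -/
def FamSmooth (s : Set E) (T : E → E3 → V) : Prop :=
  ContDiffOn ℝ ∞ (fun p : E × E3 => ext (T p.1) p.2) (s ×ˢ {0}ᶜ)

theorem FamSmooth.comp {E' : Type*} [NormedAddCommGroup E'] [NormedSpace ℝ E'] {s' : Set E'}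
    {T : E → E3 → V} (hT : FamSmooth s T) {φ : E' → E} (hφ : ContDiffOn ℝ ∞ φ s')
    (hm : MapsTo φ s' s) : FamSmooth s' fun q => T (φ q) := by
  have h : ContDiffOn ℝ ∞ (fun p : E' × E3 => (φ p.1, p.2)) (s' ×ˢ {0}ᶜ) :=
    (hφ.comp contDiffOn_fst fun p hp => hp.1).prodMk contDiffOn_snd
  exact ContDiffOn.comp (g := fun p : E × E3 => ext (T p.1) p.2) hT h
    fun p hp => ⟨hm hp.1, hp.2⟩

theorem FamSmooth.slice {T : E → E3 → V} (hT : FamSmooth s T) {q : E} (hq : q ∈ s) :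
    SphSmooth (T q) := by
  have h : ContDiffOn ℝ ∞ (fun x : E3 => (q, x)) {0}ᶜ := contDiffOn_const.prodMk contDiffOn_id
  exact ContDiffOn.comp (g := fun p : E × E3 => ext (T p.1) p.2) hT h fun x hx => ⟨hq, hx⟩

theorem FamSmooth.congr {T T' : E → E3 → V} (hT : FamSmooth s T)
    (h : ∀ q ∈ s, ∀ x, ‖x‖ = 1 → T' q x = T q x) : FamSmooth s T' :=
  ContDiffOn.congr hT fun p hp => ext_congr (h p.1 hp.1) hp.2

theorem famSmooth_of_sphSmooth {f : E3 → V} (hf : SphSmooth f) : FamSmooth s fun _ : E => f :=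
  ContDiffOn.comp (g := ext f) hf contDiffOn_snd fun _ hp => hp.2

theorem famSmooth_of_contDiffOn {c : E → V} (hc : ContDiffOn ℝ ∞ c s) :
    FamSmooth s fun q (_ : E3) => c q :=
  hc.comp contDiffOn_fst fun _ hp => hp.1

theorem FamSmooth.apply {n : ℕ} {T : E → E3 → Tensor n} (hT : FamSmooth s T)
    (I : Fin n → Fin 3) : FamSmooth s fun q x => T q x I := contDiffOn_pi.1 hT I

theorem FamSmooth.pi {n : ℕ} {T : E → E3 → Tensor n}
    (hT : ∀ I, FamSmooth s fun q x => T q x I) : FamSmooth s T := contDiffOn_pi.2 hT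

theorem FamSmooth.add {T T' : E → E3 → V} (hT : FamSmooth s T) (hT' : FamSmooth s T') :
    FamSmooth s fun q x => T q x + T' q x := ContDiffOn.add hT hT'

theorem FamSmooth.neg {T : E → E3 → V} (hT : FamSmooth s T) :
    FamSmooth s fun q x => -T q x := ContDiffOn.neg hT

theorem FamSmooth.sub {T T' : E → E3 → V} (hT : FamSmooth s T) (hT' : FamSmooth s T') :
    FamSmooth s fun q x => T q x - T' q x := ContDiffOn.sub hT hT'

theorem FamSmooth.smul {c : E → E3 → ℝ} {T : E → E3 → V} (hc : FamSmooth s c)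
    (hT : FamSmooth s T) : FamSmooth s fun q x => c q x • T q x := ContDiffOn.smul hc hT

theorem FamSmooth.mul {c d : E → E3 → ℝ} (hc : FamSmooth s c) (hd : FamSmooth s d) :
    FamSmooth s fun q x => c q x * d q x := ContDiffOn.mul hc hd

theorem FamSmooth.const_smul {c : E → ℝ} {T : E → E3 → V} (hc : ContDiffOn ℝ ∞ c s)
    (hT : FamSmooth s T) : FamSmooth s fun q x => c q • T q x :=
  FamSmooth.smul (famSmooth_of_contDiffOn hc) hT

theorem FamSmooth.const_mul {c : E → ℝ} {f : E → E3 → ℝ} (hc : ContDiffOn ℝ ∞ c s)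
    (hf : FamSmooth s f) : FamSmooth s fun q x => c q * f q x :=
  FamSmooth.mul (famSmooth_of_contDiffOn hc) hf

theorem FamSmooth.sum {ι : Type*} {t : Finset ι} {f : ι → E → E3 → V}
    (hf : ∀ i ∈ t, FamSmooth s (f i)) : FamSmooth s fun q x => ∑ i ∈ t, f i q x :=
  ContDiffOn.sum hf

theorem FamSmooth.prod {ι : Type*} {t : Finset ι} {f : ι → E → E3 → ℝ}
    (hf : ∀ i ∈ t, FamSmooth s (f i)) : FamSmooth s fun q x => ∏ i ∈ t, f i q x :=
  contDiffOn_prod hf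

theorem FamSmooth.tinner {n : ℕ} {A B : E → E3 → Tensor n} (hA : FamSmooth s A)
    (hB : FamSmooth s B) : FamSmooth s fun q x => tinner (A q x) (B q x) :=
  FamSmooth.sum fun I _ => (hA.apply I).mul (hB.apply I)

theorem FamSmooth.tsq {n : ℕ} {A : E → E3 → Tensor n} (hA : FamSmooth s A) :
    FamSmooth s fun q x => tsq (A q x) := hA.tinner hA

theorem FamSmooth.continuousOn {T : E → E3 → V} (hT : FamSmooth s T) :
    ContinuousOn (fun p : E × E3 => T p.1 p.2) (s ×ˢ Metric.sphere 0 1) := by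
  refine (ContDiffOn.continuousOn
    (f := fun p : E × E3 => ext (T p.1) p.2) (n := ∞) (𝕜 := ℝ) hT).mono ?_ |>.congr ?_
  · exact fun p hp => ⟨hp.1, ne_zero_of_norm_one (by simpa using hp.2)⟩
  · exact fun p hp => (ext_of_norm_one (T p.1) (by simpa using hp.2)).symm

/-- Identifies an angular derivative of one slice with a joint derivative in the direction (0, v),
which is how smooth dependence on parameters passes to angular derivatives. -/
theorem fderiv_slice {H : E × E3 → W} {q : E} (hq : q ∈ s) {x : E3} (hx : x ≠ 0)
    (hH : DifferentiableWithinAt ℝ H (s ×ˢ {0}ᶜ) (q, x)) (v : E3) :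
    fderiv ℝ (fun y => H (q, y)) x v = fderivWithin ℝ H (s ×ˢ {0}ᶜ) (q, x) (0, v) := by
  have h1 : HasFDerivWithinAt (fun y : E3 => (q, y)) (ContinuousLinearMap.inr ℝ E E3) {0}ᶜ x :=
    (hasFDerivAt_prodMk_right q x).hasFDerivWithinAt
  have h2 := hH.hasFDerivWithinAt.comp x h1 fun y hy => ⟨hq, hy⟩
  have h3 := (h2.hasFDerivAt (isOpen_compl_singleton.mem_nhds hx)).fderiv
  have h4 : (fun y => H (q, y)) = H ∘ fun y => (q, y) := rfl
  rw [h4, h3]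
  simp

theorem uniqueDiffOn_fam (hs : UniqueDiffOn ℝ s) : UniqueDiffOn ℝ (s ×ˢ ({0}ᶜ : Set E3)) :=
  hs.prod isOpen_compl_singleton.uniqueDiffOn

theorem FamSmooth.dd {T : E → E3 → V} (hs : UniqueDiffOn ℝ s) (hT : FamSmooth s T) (a : Fin 3) :
    FamSmooth s fun q x => dd a (T q) x := by
  -- The factor ‖x‖ compensates the degree -1 homogeneity of the derivative: `ext` evaluates it at
  -- x/‖x‖, not at x.
  have h1 : ContDiffOn ℝ ∞ (fun p : E × E3 => ‖p.2‖ • fderivWithin ℝ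
      (fun p : E × E3 => ext (T p.1) p.2) (s ×ˢ {0}ᶜ) p (0, EuclideanSpace.single a 1))
      (s ×ˢ {0}ᶜ) := by
    refine ContDiffOn.smul ?_ ?_
    · intro p hp
      exact ((contDiffAt_norm ℝ hp.2).comp p contDiffAt_snd).contDiffWithinAt
    · exact (ContDiffOn.fderivWithin hT (uniqueDiffOn_fam hs) (by simp)).clm_apply contDiffOn_const
  refine ContDiffOn.congr h1 fun p hp => ?_
  have hx : p.2 ≠ 0 := hp.2
  rw [← fderiv_slice hp.1 hp.2 (ContDiffOn.differentiableOn hT (by simp) p hp)]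
  have : ext (fun x => RN.dd a (T p.1) x) p.2 = RN.dd a (T p.1) (‖p.2‖⁻¹ • p.2) := rfl
  rw [this, dd_smul_point _ _ (by positivity), inv_inv]
  rfl

theorem FamSmooth.nabla {n : ℕ} {T : E → E3 → Tensor n} (hs : UniqueDiffOn ℝ s)
    (hT : FamSmooth s T) : FamSmooth s fun q => nabla (T q) := by
  have hc : ∀ i : Fin 3, FamSmooth s fun (_ : E) (x : E3) => x i := fun i =>
    famSmooth_of_sphSmooth (sphSmooth_coord i)
  refine FamSmooth.pi fun I => FamSmooth.sum fun J _ => FamSmooth.mul (FamSmooth.prod fun k _ => ?_)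
    ((hT.dd hs (J 0)).apply _)
  exact (famSmooth_of_contDiffOn contDiffOn_const).sub ((hc _).mul (hc _))

theorem FamSmooth.sdiv {n : ℕ} {T : E → E3 → Tensor (n + 1)} (hs : UniqueDiffOn ℝ s)
    (hT : FamSmooth s T) : FamSmooth s fun q => sdiv (T q) :=
  FamSmooth.pi fun _ => FamSmooth.sum fun _ _ => (hT.nabla hs).apply _

end Family

section Line

variable {V W : Type*} [NormedAddCommGroup V] [NormedSpace ℝ V] [NormedAddCommGroup W]
  [NormedSpace ℝ W] {c : ℝ}

theorem hasDerivWithinAt_slice {H : ℝ × E3 → W} {t : ℝ} {x : E3}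
    (hH : DifferentiableWithinAt ℝ H (Ici c ×ˢ {0}ᶜ) (t, x)) (hx : x ≠ 0) :
    HasDerivWithinAt (fun t => H (t, x)) (fderivWithin ℝ H (Ici c ×ˢ {0}ᶜ) (t, x) (1, 0))
      (Ici c) t := by
  have h1 : HasDerivWithinAt (fun t : ℝ => (t, x)) (1, 0) (Ici c) t :=
    (hasDerivWithinAt_id t _).prodMk (hasDerivWithinAt_const _ _ _)
  have h2 : MapsTo (fun t : ℝ => (t, x)) (Ici c) (Ici c ×ˢ ({0}ᶜ : Set E3)) :=
    fun t ht => ⟨ht, hx⟩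
  exact hH.hasFDerivWithinAt.comp_hasDerivWithinAt t h1 h2

theorem FamSmooth.hasDerivWithinAt {T : ℝ → E3 → V} (hT : FamSmooth (Ici c) T) {t : ℝ}
    (ht : c ≤ t) {x : E3} (hx : ‖x‖ = 1) :
    HasDerivWithinAt (fun s => T s x) (derivWithin (fun s => T s x) (Ici c) t) (Ici c) t := by
  have h0 := ne_zero_of_norm_one hx
  have hd : DifferentiableWithinAt ℝ (fun p : ℝ × E3 => ext (T p.1) p.2) (Ici c ×ˢ {0}ᶜ) (t, x) :=
    ContDiffOn.differentiableOn hT (by simp) (t, x) ⟨ht, h0⟩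
  have h := hasDerivWithinAt_slice hd h0
  have h2 : (fun s => ext (T s) x) = fun s => T s x := funext fun s => ext_of_norm_one _ hx
  simp only [h2] at h
  exact h.differentiableWithinAt.hasDerivWithinAt

/-- At the boundary t = c, symmetry of the second derivative within the set needs the point to be a
limit of interior points. -/
theorem closure_interior_fam : Ici c ×ˢ ({0}ᶜ : Set E3) ⊆
    closure (interior (Ici c ×ˢ ({0}ᶜ : Set E3))) := by
  rw [interior_prod_eq, closure_prod_eq, interior_Ici, closure_Ioi,
    isOpen_compl_singleton.interior_eq]
  exact prod_mono le_rfl subset_closure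

/-- Equality of mixed partial derivatives, valid up to the initial cones because the joint second
derivative is symmetric there too. -/
theorem FamSmooth.hasDerivWithinAt_dd {T : ℝ → E3 → V} (hT : FamSmooth (Ici c) T) {t : ℝ}
    (ht : c ≤ t) {x : E3} (hx : x ≠ 0) (a : Fin 3) :
    HasDerivWithinAt (fun s => RN.dd a (T s) x)
      (RN.dd a (fun y => derivWithin (fun s => T s y) (Ici c) t) x) (Ici c) t := by
  set F : ℝ × E3 → V := fun p => ext (T p.1) p.2 with hF
  set D : Set (ℝ × E3) := Ici c ×ˢ {0}ᶜ
  have hD : UniqueDiffOn ℝ D := uniqueDiffOn_fam (uniqueDiffOn_Ici c)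
  have hd : DifferentiableOn ℝ F D := ContDiffOn.differentiableOn hT (by simp)
  have hG : ContDiffOn ℝ ∞ (fderivWithin ℝ F D) D := ContDiffOn.fderivWithin hT hD (by simp)
  have hGd : DifferentiableOn ℝ (fderivWithin ℝ F D) D := hG.differentiableOn (by simp)
  have htx : (t, x) ∈ D := ⟨ht, hx⟩
  have hsymm : IsSymmSndFDerivWithinAt ℝ F D (t, x) :=
    ContDiffWithinAt.isSymmSndFDerivWithinAt (hT (t, x) htx) (by
      rw [minSmoothness_of_isRCLikeNormedField]; exact WithTop.coe_le_coe.2 (le_top : (2 : ℕ∞) ≤ ⊤)) hD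
      (closure_interior_fam htx) htx
  have e1 : ∀ s ∈ Ici c, RN.dd a (T s) x = fderivWithin ℝ F D (s, x) (0, EuclideanSpace.single a 1) :=
    fun s hs => fderiv_slice hs hx (hd _ ⟨hs, hx⟩) _
  have e2 : ∀ y : E3, y ≠ 0 → ext (fun y => derivWithin (fun s => T s y) (Ici c) t) y =
      fderivWithin ℝ F D (t, y) (1, 0) := fun y hy =>
    (hasDerivWithinAt_slice (hd _ ⟨ht, hy⟩) hy).derivWithin (uniqueDiffOn_Ici c t ht)
  have h1 := (hasDerivWithinAt_slice (hGd _ htx) hx).clm_apply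
    (hasDerivWithinAt_const t (Ici c) ((0 : ℝ), (EuclideanSpace.single a 1 : E3)))
  have e3 : RN.dd a (fun y => derivWithin (fun s => T s y) (Ici c) t) x =
      fderivWithin ℝ (fderivWithin ℝ F D) D (t, x) (0, EuclideanSpace.single a 1) (1, 0) := by
    have : ext (fun y => derivWithin (fun s => T s y) (Ici c) t) =ᶠ[𝓝 x]
        fun y => fderivWithin ℝ F D (t, y) (1, 0) := by
      filter_upwards [isOpen_compl_singleton.mem_nhds hx] with y hy using e2 y hy
    rw [RN.dd, this.fderiv_eq, ← fderiv_slice (s := Ici c) ht hx (hGd _ htx)]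
    have hs : DifferentiableAt ℝ (fun y => fderivWithin ℝ F D (t, y)) x :=
      ((hGd (t, x) htx).comp x ((differentiableAt_const t).prodMk
        differentiableAt_id).differentiableWithinAt (t := D) (s := {0}ᶜ)
        fun y hy => ⟨ht, hy⟩).differentiableAt (isOpen_compl_singleton.mem_nhds hx)
    rw [fderiv_clm_apply hs (differentiableAt_const _)]
    simp
  rw [e3, hsymm.eq]
  refine (h1.congr e1 (e1 t ht)).congr_deriv ?_
  simp [D]

theorem FamSmooth.hasDerivWithinAt_nabla {n : ℕ} {T : ℝ → E3 → Tensor n}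
    (hT : FamSmooth (Ici c) T) {t : ℝ} (ht : c ≤ t) {x : E3} (hx : x ≠ 0) :
    HasDerivWithinAt (fun s => RN.nabla (T s) x)
      (RN.nabla (fun y => derivWithin (fun s => T s y) (Ici c) t) x) (Ici c) t := by
  refine hasDerivWithinAt_pi.2 fun I => HasDerivWithinAt.fun_sum fun J _ => ?_
  exact (hasDerivWithinAt_pi.1 (hT.hasDerivWithinAt_dd ht hx (J 0)) (Fin.tail J)).const_mul _

theorem FamSmooth.hasDerivWithinAt_sdiv {n : ℕ} {T : ℝ → E3 → Tensor (n + 1)}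
    (hT : FamSmooth (Ici c) T) {t : ℝ} (ht : c ≤ t) {x : E3} (hx : x ≠ 0) :
    HasDerivWithinAt (fun s => RN.sdiv (T s) x)
      (RN.sdiv (fun y => derivWithin (fun s => T s y) (Ici c) t) x) (Ici c) t :=
  hasDerivWithinAt_pi.2 fun _ => HasDerivWithinAt.fun_sum fun _ _ =>
    hasDerivWithinAt_pi.1 (hT.hasDerivWithinAt_nabla ht hx) _

end Line

/-! ### Algebra of the angular operators -/

section Algebra

variable {V : Type*} [NormedAddCommGroup V] [NormedSpace ℝ V]

theorem dd_add {S T : E3 → V} (hS : SphSmooth S) (hT : SphSmooth T) {x : E3} (hx : x ≠ 0)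
    (a : Fin 3) : dd a (fun y => S y + T y) x = dd a S x + dd a T x := by
  have h : fderiv ℝ (ext fun y => S y + T y) x = _ :=
    ((hS.differentiableAt hx).hasFDerivAt.add (hT.differentiableAt hx).hasFDerivAt).fderiv
  rw [dd, h]; rfl

theorem dd_const_smul (k : ℝ) (T : E3 → V) (x : E3) (a : Fin 3) :
    dd a (fun y => k • T y) x = k • dd a T x := by
  have h : fderiv ℝ (ext fun y => k • T y) x = k • fderiv ℝ (ext T) x := by
    have : (ext fun y => k • T y) = k • ext T := rfl
    rw [this, fderiv_const_smul_field]
    rfl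
  rw [dd, h]; rfl

theorem nabla_add {n : ℕ} {S T : E3 → Tensor n} (hS : SphSmooth S) (hT : SphSmooth T) {x : E3}
    (hx : x ≠ 0) : nabla (fun y => S y + T y) x = nabla S x + nabla T x := by
  funext I
  simp only [nabla, Pi.add_apply, ← Finset.sum_add_distrib, ← mul_add]
  refine Finset.sum_congr rfl fun J _ => ?_
  congr 1
  exact congrFun (dd_add hS hT hx (J 0)) _

theorem nabla_const_smul {n : ℕ} (k : ℝ) (T : E3 → Tensor n) (x : E3) :
    nabla (fun y => k • T y) x = k • nabla T x := by
  funext I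
  simp only [nabla, Pi.smul_apply, smul_eq_mul, Finset.mul_sum]
  refine Finset.sum_congr rfl fun J _ => ?_
  rw [mul_left_comm]
  congr 1
  exact congrFun (dd_const_smul k T x (J 0)) _

theorem nabla_congr {n : ℕ} {S T : E3 → Tensor n} (h : ∀ x, ‖x‖ = 1 → S x = T x) {x : E3}
    (hx : x ≠ 0) : nabla S x = nabla T x := by
  funext I
  exact Finset.sum_congr rfl fun J _ => congrArg _ (congrFun (dd_congr h hx (J 0)) _)

theorem sdiv_add {n : ℕ} {S T : E3 → Tensor (n + 1)} (hS : SphSmooth S) (hT : SphSmooth T) {x : E3}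
    (hx : x ≠ 0) : sdiv (fun y => S y + T y) x = sdiv S x + sdiv T x := by
  funext I
  simp only [sdiv, nabla_add hS hT hx, Pi.add_apply, Finset.sum_add_distrib]

theorem sdiv_const_smul {n : ℕ} (k : ℝ) (T : E3 → Tensor (n + 1)) (x : E3) :
    sdiv (fun y => k • T y) x = k • sdiv T x := by
  funext I
  simp only [sdiv, nabla_const_smul, Pi.smul_apply, smul_eq_mul, Finset.mul_sum]

theorem sdiv_congr {n : ℕ} {S T : E3 → Tensor (n + 1)} (h : ∀ x, ‖x‖ = 1 → S x = T x) {x : E3}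
    (hx : x ≠ 0) : sdiv S x = sdiv T x := by
  funext I
  simp only [sdiv, nabla_congr h hx]

end Algebra

/-! ## Integrals over the unit sphere -/

/-- The unit sphere as a subset of the ambient space. -/
abbrev S2 : Set E3 := Metric.sphere 0 1

/-- The area of the unit sphere. -/
def sphArea : ℝ := (volume : Measure E3).toSphere.real univ

theorem sphArea_nonneg : 0 ≤ sphArea := measureReal_nonneg

theorem sphInt_add {f g : E3 → ℝ} (hf : ContinuousOn f S2) (hg : ContinuousOn g S2) :
    sphInt (fun x => f x + g x) = sphInt f + sphInt g :=
  integral_add (integrable_sphere_of_continuousOn hf) (integrable_sphere_of_continuousOn hg)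

theorem sphInt_sub {f g : E3 → ℝ} (hf : ContinuousOn f S2) (hg : ContinuousOn g S2) :
    sphInt (fun x => f x - g x) = sphInt f - sphInt g :=
  integral_sub (integrable_sphere_of_continuousOn hf) (integrable_sphere_of_continuousOn hg)

theorem sphInt_const_mul (k : ℝ) (f : E3 → ℝ) : sphInt (fun x => k * f x) = k * sphInt f :=
  integral_const_mul k _

theorem sphInt_mono {f g : E3 → ℝ} (hf : ContinuousOn f S2) (hg : ContinuousOn g S2)
    (h : ∀ x, ‖x‖ = 1 → f x ≤ g x) : sphInt f ≤ sphInt g :=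
  integral_mono (integrable_sphere_of_continuousOn hf) (integrable_sphere_of_continuousOn hg)
    fun x => h x (by simp)

theorem sphInt_nonneg {f : E3 → ℝ} (h : ∀ x, ‖x‖ = 1 → 0 ≤ f x) : 0 ≤ sphInt f :=
  integral_nonneg fun x => h x (by simp)

theorem abs_sphInt_le {f : E3 → ℝ} {C : ℝ} (h : ∀ x, ‖x‖ = 1 → |f x| ≤ C) :
    |sphInt f| ≤ C * sphArea :=
  norm_integral_le_of_norm_le_const (μ := (volume : Measure E3).toSphere)
    (f := fun x : Metric.sphere (0 : E3) 1 => f x) (Eventually.of_forall fun x => h x (by simp))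

theorem continuousOn_sphInt {E : Type*} [TopologicalSpace E] [FirstCountableTopology E]
    [LocallyCompactSpace E] {s : Set E} (hs : IsClosed s) {f : E → E3 → ℝ}
    (hf : ContinuousOn (fun p : E × E3 => f p.1 p.2) (s ×ˢ S2)) :
    ContinuousOn (fun q => sphInt (f q)) s := by
  rw [continuousOn_iff_continuous_domRestrict]
  have := hs.isClosedEmbedding_subtypeVal.locallyCompactSpace
  have h := continuous_parametric_integral_of_continuous (X := s) (Y := Metric.sphere (0 : E3) 1)
    (μ := (volume : Measure E3).toSphere) (f := fun q x => f q x) (s := univ)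
    (hf.comp_continuous (f := fun p : s × Metric.sphere (0 : E3) 1 => ((p.1 : E), (p.2 : E3)))
      (by fun_prop) fun p => ⟨p.1.2, p.2.2⟩) isCompact_univ
  simp only [Measure.restrict_univ] at h
  exact h

theorem sphInt_intervalIntegral {f : ℝ → E3 → ℝ} {a b : ℝ} (hab : a ≤ b)
    (hf : ContinuousOn (fun p : ℝ × E3 => f p.1 p.2) (Icc a b ×ˢ S2)) :
    sphInt (fun x => ∫ t in a..b, f t x) = ∫ t in a..b, sphInt (f t) := by
  refine (intervalIntegral_integral_swap (f := fun t (x : Metric.sphere (0 : E3) 1) => f t x)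
    (μ := (volume : Measure E3).toSphere) ?_).symm
  have h1 : ContinuousOn (fun p : ℝ × Metric.sphere (0 : E3) 1 => f p.1 p.2) (Icc a b ×ˢ univ) :=
    hf.comp (f := fun p : ℝ × Metric.sphere (0 : E3) 1 => (p.1, (p.2 : E3))) (by fun_prop)
      fun p hp => ⟨hp.1, p.2.2⟩
  have h2 := h1.integrableOn_compact (μ := (volume : Measure ℝ).prod
    (volume : Measure E3).toSphere) (isCompact_Icc.prod isCompact_univ)
  have h3 := h2.mono_set (prod_mono (uIoc_of_le hab ▸ Ioc_subset_Icc_self) le_rfl)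
  rwa [IntegrableOn, ← Measure.prod_restrict, Measure.restrict_univ] at h3

theorem sphInt_sub_eq_integral {f f' : ℝ → E3 → ℝ} {a b : ℝ} (hab : a ≤ b)
    (hd : ∀ x, ‖x‖ = 1 → ∀ t ∈ Icc a b, HasDerivWithinAt (fun t => f t x) (f' t x) (Ici a) t)
    (hfa : ContinuousOn (f a) S2) (hfb : ContinuousOn (f b) S2)
    (hf' : ContinuousOn (fun p : ℝ × E3 => f' p.1 p.2) (Icc a b ×ˢ S2)) :
    sphInt (f b) - sphInt (f a) = ∫ t in a..b, sphInt (f' t) := by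
  rw [← sphInt_sub hfb hfa, ← sphInt_intervalIntegral hab hf']
  refine sphInt_congr fun x hx => ?_
  refine (intervalIntegral.integral_eq_sub_of_hasDeriv_right_of_le (f := fun t => f t x)
    (f' := fun t => f' t x) hab ?_ ?_ ?_).symm
  · exact fun t ht => ((hd x hx t ht).continuousWithinAt).mono Icc_subset_Ici_self
  · intro t ht
    exact (hd x hx t (Ioo_subset_Icc_self ht)).mono fun y hy => (ht.1.trans hy).le
  · have h : ContinuousOn (fun t => f' t x) (Icc a b) :=
      hf'.comp (f := fun t : ℝ => (t, x)) (by fun_prop) fun t ht => ⟨ht, by simpa using hx⟩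
    exact (h.mono (uIcc_of_le hab).le).intervalIntegrable

theorem tendsto_sphInt {f : ℝ → E3 → ℝ} {g : E3 → ℝ} {C v₀ : ℝ}
    (hf : ∀ v, v₀ ≤ v → ContinuousOn (f v) S2) (hC : ∀ v, v₀ ≤ v → ∀ x, ‖x‖ = 1 → |f v x| ≤ C)
    (hg : ∀ x, ‖x‖ = 1 → Tendsto (fun v => f v x) atTop (𝓝 (g x))) :
    Tendsto (fun v => sphInt (f v)) atTop (𝓝 (sphInt g)) := by
  refine tendsto_integral_filter_of_dominated_convergence (fun _ => C) ?_ ?_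
    (integrable_const C) (Eventually.of_forall fun x => hg x (by simp))
  · filter_upwards [eventually_ge_atTop v₀] with v hv
    exact (integrable_sphere_of_continuousOn (hf v hv)).aestronglyMeasurable
  · filter_upwards [eventually_ge_atTop v₀] with v hv
    exact Eventually.of_forall fun x => hC v hv x (by simp)

/-! ## The background geometry -/

namespace Geom

variable {G : Geom}

/-- The inverse of the tortoise coordinate. -/
def rad (G : Geom) : ℝ → ℝ := Function.invFunOn (tortoise G.M G.Q) (Ioi (rPlus G.M G.Q))

/-- The squared lapse as a function of the area radius. -/
def lapse (G : Geom) (r : ℝ) : ℝ := 1 - 2 * G.M / r + G.Q ^ 2 / r ^ 2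

theorem rad_gt (h : |G.Q| < G.M) (s : ℝ) : rPlus G.M G.Q < G.rad s := by
  have := (G.r_spec h 0 s).1
  simpa [r, rad] using this

theorem tortoise_rad (h : |G.Q| < G.M) (s : ℝ) : tortoise G.M G.Q (G.rad s) = s := by
  have := (G.r_spec h 0 s).2
  simpa [r, rad] using this

theorem rPlus_pos (h : |G.Q| < G.M) : 0 < rPlus G.M G.Q := by
  obtain ⟨h0, h1, -, -⟩ := horizon_facts h; linarith

theorem lapse_eq (h : |G.Q| < G.M) {r : ℝ} (hr : 0 < r) :
    G.lapse r = (r - rPlus G.M G.Q) * (r - rMinus G.M G.Q) / r ^ 2 := by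
  obtain ⟨h0, h1, h2, h3⟩ := horizon_facts h
  rw [lapse, ← h2, ← h3]; field_simp; ring

theorem lapse_pos (h : |G.Q| < G.M) {r : ℝ} (hr : rPlus G.M G.Q < r) : 0 < G.lapse r := by
  obtain ⟨h0, h1, h2, h3⟩ := horizon_facts h
  have hr0 : 0 < r := by linarith
  rw [lapse_eq h hr0]
  have : 0 < r - rPlus G.M G.Q := by linarith
  have : 0 < r - rMinus G.M G.Q := by linarith
  positivity

theorem lapse_le_one (h : |G.Q| < G.M) {r : ℝ} (hr : rPlus G.M G.Q < r) : G.lapse r ≤ 1 := by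
  obtain ⟨h0, h1, h2, h3⟩ := horizon_facts h
  have hr0 : 0 < r := by linarith
  rw [lapse_eq h hr0, div_le_one (by positivity)]
  nlinarith

theorem lapse_mono (h : |G.Q| < G.M) {r r' : ℝ} (hr : rPlus G.M G.Q < r) (hrr : r ≤ r') :
    G.lapse r ≤ G.lapse r' := by
  obtain ⟨h0, h1, h2, h3⟩ := horizon_facts h
  have hr0 : 0 < r := by linarith
  have hr0' : 0 < r' := by linarith
  -- Both factors 1 - r₊/s and 1 - r₋/s are nonnegative and nondecreasing for s > r₊.
  have e : ∀ s, 0 < s → G.lapse s = (1 - rPlus G.M G.Q / s) * (1 - rMinus G.M G.Q / s) :=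
    fun s hs => by rw [lapse_eq h hs]; field_simp
  rw [e r hr0, e r' hr0']
  have a1 : rPlus G.M G.Q / r' ≤ rPlus G.M G.Q / r :=
    div_le_div_of_nonneg_left (by linarith) hr0 hrr
  have a2 : rMinus G.M G.Q / r' ≤ rMinus G.M G.Q / r := div_le_div_of_nonneg_left h0 hr0 hrr
  have a3 : rPlus G.M G.Q / r ≤ 1 := by rw [div_le_one hr0]; linarith
  have a4 : rMinus G.M G.Q / r ≤ 1 := by rw [div_le_one hr0]; linarith
  apply mul_le_mul <;> linarith

theorem strictMonoOn_tortoise (h : |G.Q| < G.M) :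
    StrictMonoOn (tortoise G.M G.Q) (Ioi (rPlus G.M G.Q)) := by
  refine strictMonoOn_of_deriv_pos (convex_Ioi _)
    (fun r hr => (hasDerivAt_tortoise h hr).continuousAt.continuousWithinAt) fun r hr => ?_
  rw [interior_Ioi] at hr
  rw [(hasDerivAt_tortoise h hr).deriv]
  exact inv_pos.2 (lapse_pos h hr)

theorem strictMono_rad (h : |G.Q| < G.M) : StrictMono G.rad := fun s t hst => by
  by_contra hle
  have := (strictMonoOn_tortoise h).monotoneOn (rad_gt h t) (rad_gt h s) (not_lt.1 hle)
  rw [tortoise_rad h, tortoise_rad h] at this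
  linarith

theorem rad_tortoise (h : |G.Q| < G.M) {r : ℝ} (hr : rPlus G.M G.Q < r) :
    G.rad (tortoise G.M G.Q r) = r :=
  (strictMonoOn_tortoise h).injOn (rad_gt h _) hr (tortoise_rad h _)

/-- A strictly increasing surjection onto an interval is an order isomorphism, hence a
homeomorphism. -/
theorem continuous_rad (h : |G.Q| < G.M) : Continuous G.rad := by
  let φ : ℝ → Ioi (rPlus G.M G.Q) := fun s => ⟨G.rad s, rad_gt h s⟩
  have hm : StrictMono φ := fun s t hst => strictMono_rad h hst
  have hs : Function.Surjective φ := fun r => ⟨tortoise G.M G.Q r, Subtype.ext (rad_tortoise h r.2)⟩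
  exact continuous_subtype_val.comp (hm.orderIsoOfSurjective φ hs).continuous

theorem hasDerivAt_rad (h : |G.Q| < G.M) (s : ℝ) : HasDerivAt G.rad (G.lapse (G.rad s)) s := by
  have h1 := hasDerivAt_tortoise h (rad_gt h s)
  have h2 := h1.of_local_left_inverse (continuous_rad h).continuousAt
    (inv_ne_zero (lapse_pos h (rad_gt h s)).ne') (Eventually.of_forall fun t => tortoise_rad h t)
  simpa [lapse] using h2

theorem contDiffAt_lapse {r : ℝ} (hr : r ≠ 0) {n : WithTop ℕ∞} : ContDiffAt ℝ n G.lapse r := by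
  unfold lapse
  exact (contDiffAt_const.sub (contDiffAt_const.div contDiffAt_id hr)).add
    (contDiffAt_const.div (contDiffAt_id.pow 2) (pow_ne_zero 2 hr))

theorem rad_pos (h : |G.Q| < G.M) (s : ℝ) : 0 < G.rad s := (rPlus_pos h).trans (rad_gt h s)

/-- Bootstrap through the equation rad' = lapse(rad): each order of regularity yields the next. -/
theorem contDiff_rad (h : |G.Q| < G.M) : ContDiff ℝ ∞ G.rad := by
  rw [contDiff_infty]
  intro n
  induction n with
  | zero => exact contDiff_zero.2 (continuous_rad h)
  | succ n ih =>
    rw [Nat.cast_succ]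
    refine contDiff_succ_iff_deriv.2 ⟨fun s => (hasDerivAt_rad h s).differentiableAt,
      fun hn => absurd hn (by simp), ?_⟩
    have : deriv G.rad = fun s => G.lapse (G.rad s) := funext fun s => (hasDerivAt_rad h s).deriv
    rw [this, contDiff_iff_contDiffAt]
    intro s
    exact (contDiffAt_lapse (rad_pos h s).ne').comp s ih.contDiffAt

theorem tendsto_rad (h : |G.Q| < G.M) : Tendsto G.rad atTop atTop := by
  refine (strictMono_rad h).monotone.tendsto_atTop_atTop fun b => ?_
  refine ⟨tortoise G.M G.Q (max b (rPlus G.M G.Q + 1)), ?_⟩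
  rw [rad_tortoise h (lt_max_of_lt_right (by linarith))]
  exact le_max_left _ _

theorem r_gt (h : |G.Q| < G.M) (u v : ℝ) : rPlus G.M G.Q < G.r u v := rad_gt h _

theorem r_pos (h : |G.Q| < G.M) (u v : ℝ) : 0 < G.r u v := rad_pos h _

theorem Om_sq (h : |G.Q| < G.M) (u v : ℝ) :
    G.Om u v ^ 2 = 1 - 2 * G.M / G.r u v + G.Q ^ 2 / G.r u v ^ 2 :=
  Real.sq_sqrt (lapse_pos h (r_gt h u v)).le

theorem Om_sq' (h : |G.Q| < G.M) (u v : ℝ) : G.Om u v ^ 2 = G.lapse (G.r u v) := Om_sq h u v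

theorem Om_pos (h : |G.Q| < G.M) (u v : ℝ) : 0 < G.Om u v :=
  Real.sqrt_pos.2 (lapse_pos h (r_gt h u v))

theorem Om_le_one (h : |G.Q| < G.M) (u v : ℝ) : G.Om u v ≤ 1 :=
  Real.sqrt_le_one.2 (lapse_le_one h (r_gt h u v))

theorem r_mono (h : |G.Q| < G.M) {u u' v v' : ℝ} (hu : u' ≤ u) (hv : v ≤ v') :
    G.r u v ≤ G.r u' v' := (strictMono_rad h).monotone (by linarith)

theorem tendsto_r (h : |G.Q| < G.M) (u : ℝ) : Tendsto (fun v => G.r u v) atTop atTop :=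
  (tendsto_rad h).comp (tendsto_atTop_add_const_right _ (-u) tendsto_id)

theorem hasDerivAt_r_v (h : |G.Q| < G.M) (u v : ℝ) :
    HasDerivAt (fun v => G.r u v) (G.Om u v ^ 2) v := by
  have := (hasDerivAt_rad h (v - u)).comp v ((hasDerivAt_id v).sub_const u)
  rw [Om_sq' h]
  exact this.congr_deriv (mul_one _)

theorem hasDerivAt_r_u (h : |G.Q| < G.M) (u v : ℝ) :
    HasDerivAt (fun u => G.r u v) (-(G.Om u v ^ 2)) u := by
  have := (hasDerivAt_rad h (v - u)).comp u ((hasDerivAt_id u).const_sub v)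
  rw [Om_sq' h]
  exact this.congr_deriv (mul_neg_one _)

theorem hasDerivAt_lapse (h : |G.Q| < G.M) (u v : ℝ) :
    HasDerivAt G.lapse (2 * G.om u v) (G.r u v) := by
  have hr := (r_pos h u v).ne'
  have h1 := ((hasDerivAt_const (G.r u v) (1 : ℝ)).sub ((hasDerivAt_const (G.r u v)
    (2 * G.M)).div (hasDerivAt_id _) hr)).add ((hasDerivAt_const (G.r u v)
    (G.Q ^ 2)).div ((hasDerivAt_id (G.r u v)).pow 2) (pow_ne_zero 2 hr))
  refine h1.congr_deriv ?_
  simp only [om, id, Pi.pow_apply]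
  field_simp
  ring

theorem hasDerivAt_Om_v (h : |G.Q| < G.M) (u v : ℝ) :
    HasDerivAt (fun v => G.Om u v) (G.om u v * G.Om u v) v := by
  have h0 : HasDerivAt (fun v => G.lapse (G.r u v)) _ v :=
    HasDerivAt.comp (h₂ := G.lapse) v (hasDerivAt_lapse h u v) (hasDerivAt_r_v h u v)
  have h1 := h0.sqrt (lapse_pos h (r_gt h u v)).ne'
  have h2 := (Om_pos h u v).ne'
  refine h1.congr_deriv ?_
  change 2 * G.om u v * G.Om u v ^ 2 / (2 * G.Om u v) = _
  field_simp

theorem hasDerivAt_Om_u (h : |G.Q| < G.M) (u v : ℝ) :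
    HasDerivAt (fun u => G.Om u v) (-(G.om u v * G.Om u v)) u := by
  have h0 : HasDerivAt (fun u => G.lapse (G.r u v)) _ u :=
    HasDerivAt.comp (h₂ := G.lapse) u (hasDerivAt_lapse h u v) (hasDerivAt_r_u h u v)
  have h1 := h0.sqrt (lapse_pos h (r_gt h u v)).ne'
  have h2 := (Om_pos h u v).ne'
  refine h1.congr_deriv ?_
  change 2 * G.om u v * -(G.Om u v ^ 2) / (2 * G.Om u v) = _
  field_simp

theorem contDiff_r (h : |G.Q| < G.M) : ContDiff ℝ ∞ fun q : ℝ × ℝ => G.r q.1 q.2 :=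
  (contDiff_rad h).comp (contDiff_snd.sub contDiff_fst)

theorem contDiff_Om (h : |G.Q| < G.M) : ContDiff ℝ ∞ fun q : ℝ × ℝ => G.Om q.1 q.2 := by
  rw [contDiff_iff_contDiffAt]
  intro q
  have h0 : ContDiffAt ℝ ∞ (fun q : ℝ × ℝ => G.lapse (G.r q.1 q.2)) q :=
    ContDiffAt.comp (g := G.lapse) q (contDiffAt_lapse (r_pos h q.1 q.2).ne') (contDiff_r h).contDiffAt
  exact h0.sqrt (lapse_pos h (r_gt h q.1 q.2)).ne'

theorem Om_mono (h : |G.Q| < G.M) {u u' v v' : ℝ} (hu : u' ≤ u) (hv : v ≤ v') :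
    G.Om u v ≤ G.Om u' v' :=
  Real.sqrt_le_sqrt (lapse_mono h (r_gt h u v) (r_mono h hu hv))

end Geom

namespace Geom

variable {G : Geom} {S : Pert}

/-! ## Smooth fields on the exterior region -/

/-- The region `{u ≥ u₀, v ≥ v₀}`. -/
def Reg (G : Geom) : Set (ℝ × ℝ) := Ici G.u₀ ×ˢ Ici G.v₀

theorem uniqueDiffOn_Reg : UniqueDiffOn ℝ G.Reg := (uniqueDiffOn_Ici _).prod (uniqueDiffOn_Ici _)

theorem smooth_iff {n : ℕ} {T : SField n} : G.Smooth T ↔ FamSmooth G.Reg fun q => T q.1 q.2 := by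
  let e : ((ℝ × ℝ) × E3) ≃L[ℝ] ℝ × ℝ × E3 := ContinuousLinearEquiv.prodAssoc ℝ ℝ ℝ E3
  constructor
  · intro h
    have := ContDiffOn.comp h (e.contDiff.contDiffOn (s := G.Reg ×ˢ {0}ᶜ))
      fun p hp => ⟨hp.1.1, hp.1.2, hp.2⟩
    exact this
  · intro h
    have := ContDiffOn.comp (g := fun p : (ℝ × ℝ) × E3 => ext (T p.1.1 p.1.2) p.2) h
      (e.symm.contDiff.contDiffOn (s := Ici G.u₀ ×ˢ Ici G.v₀ ×ˢ {0}ᶜ))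
      fun p hp => ⟨⟨hp.1, hp.2.1⟩, hp.2.2⟩
    exact this

theorem famSmooth_u {V : Type*} [NormedAddCommGroup V] [NormedSpace ℝ V] {T : ℝ → ℝ → E3 → V}
    (hT : FamSmooth G.Reg fun q => T q.1 q.2) {v : ℝ} (hv : G.v₀ ≤ v) :
    FamSmooth (Ici G.u₀) fun u => T u v :=
  hT.comp (φ := fun u : ℝ => (u, v)) (contDiffOn_id.prodMk contDiffOn_const) fun _ hu => ⟨hu, hv⟩

theorem famSmooth_v {V : Type*} [NormedAddCommGroup V] [NormedSpace ℝ V] {T : ℝ → ℝ → E3 → V}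
    (hT : FamSmooth G.Reg fun q => T q.1 q.2) {u : ℝ} (hu : G.u₀ ≤ u) :
    FamSmooth (Ici G.v₀) fun v => T u v :=
  hT.comp (φ := fun v : ℝ => (u, v)) (contDiffOn_const.prodMk contDiffOn_id) fun _ hv => ⟨hu, hv⟩

namespace Smooth

variable {n : ℕ} {T T' : SField n}

theorem slice (hT : G.Smooth T) {u v : ℝ} (hu : G.u₀ ≤ u) (hv : G.v₀ ≤ v) : SphSmooth (T u v) :=
  FamSmooth.slice (T := fun q : ℝ × ℝ => T q.1 q.2) (smooth_iff.1 hT) (q := (u, v)) ⟨hu, hv⟩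

theorem add (hT : G.Smooth T) (hT' : G.Smooth T') : G.Smooth (T + T') :=
  smooth_iff.2 (FamSmooth.add (smooth_iff.1 hT) (smooth_iff.1 hT'))

theorem sub (hT : G.Smooth T) (hT' : G.Smooth T') : G.Smooth (T - T') :=
  smooth_iff.2 (FamSmooth.sub (smooth_iff.1 hT) (smooth_iff.1 hT'))

theorem neg (hT : G.Smooth T) : G.Smooth (-T) :=
  smooth_iff.2 (FamSmooth.neg (smooth_iff.1 hT))

theorem mulF {c : ℝ → ℝ → ℝ} (hc : ContDiffOn ℝ ∞ (fun q : ℝ × ℝ => c q.1 q.2) G.Reg)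
    (hT : G.Smooth T) : G.Smooth (c ⊙ T) :=
  smooth_iff.2 (FamSmooth.const_smul hc (smooth_iff.1 hT))

theorem nabla (hT : G.Smooth T) : G.Smooth fun u v => nabla (T u v) :=
  smooth_iff.2 (FamSmooth.nabla uniqueDiffOn_Reg (smooth_iff.1 hT))

theorem sdiv {T : SField (n + 1)} (hT : G.Smooth T) : G.Smooth fun u v => sdiv (T u v) :=
  smooth_iff.2 (FamSmooth.sdiv uniqueDiffOn_Reg (smooth_iff.1 hT))

theorem hasDerivWithinAt_dU (hT : G.Smooth T) {u v : ℝ} {x : E3} (hu : G.u₀ ≤ u) (hv : G.v₀ ≤ v)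
    (hx : ‖x‖ = 1) : HasDerivWithinAt (fun s => T s v x) (G.dU T u v x) (Ici G.u₀) u :=
  (famSmooth_u (smooth_iff.1 hT) hv).hasDerivWithinAt hu hx

theorem hasDerivWithinAt_dV (hT : G.Smooth T) {u v : ℝ} {x : E3} (hu : G.u₀ ≤ u) (hv : G.v₀ ≤ v)
    (hx : ‖x‖ = 1) : HasDerivWithinAt (fun s => T u s x) (G.dV T u v x) (Ici G.v₀) v :=
  (famSmooth_v (smooth_iff.1 hT) hu).hasDerivWithinAt hv hx

theorem dU_nabla (hT : G.Smooth T) {u v : ℝ} {x : E3} (hu : G.u₀ ≤ u) (hv : G.v₀ ≤ v)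
    (hx : ‖x‖ = 1) :
    G.dU (fun u v => RN.nabla (T u v)) u v x = RN.nabla (G.dU T u v) x :=
  ((famSmooth_u (smooth_iff.1 hT) hv).hasDerivWithinAt_nabla hu
    (ne_zero_of_norm_one hx)).derivWithin (uniqueDiffOn_Ici _ _ hu)

theorem dV_nabla (hT : G.Smooth T) {u v : ℝ} {x : E3} (hu : G.u₀ ≤ u) (hv : G.v₀ ≤ v)
    (hx : ‖x‖ = 1) :
    G.dV (fun u v => RN.nabla (T u v)) u v x = RN.nabla (G.dV T u v) x :=
  ((famSmooth_v (smooth_iff.1 hT) hu).hasDerivWithinAt_nabla hv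
    (ne_zero_of_norm_one hx)).derivWithin (uniqueDiffOn_Ici _ _ hv)

theorem dU_sdiv {T : SField (n + 1)} (hT : G.Smooth T) {u v : ℝ} {x : E3} (hu : G.u₀ ≤ u)
    (hv : G.v₀ ≤ v) (hx : ‖x‖ = 1) :
    G.dU (fun u v => RN.sdiv (T u v)) u v x = RN.sdiv (G.dU T u v) x :=
  ((famSmooth_u (smooth_iff.1 hT) hv).hasDerivWithinAt_sdiv hu
    (ne_zero_of_norm_one hx)).derivWithin (uniqueDiffOn_Ici _ _ hu)

theorem dV_sdiv {T : SField (n + 1)} (hT : G.Smooth T) {u v : ℝ} {x : E3} (hu : G.u₀ ≤ u)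
    (hv : G.v₀ ≤ v) (hx : ‖x‖ = 1) :
    G.dV (fun u v => RN.sdiv (T u v)) u v x = RN.sdiv (G.dV T u v) x :=
  ((famSmooth_v (smooth_iff.1 hT) hu).hasDerivWithinAt_sdiv hv
    (ne_zero_of_norm_one hx)).derivWithin (uniqueDiffOn_Ici _ _ hv)

end Smooth

theorem contDiffOn_r (hM : |G.Q| < G.M) : ContDiffOn ℝ ∞ (fun q : ℝ × ℝ => G.r q.1 q.2) G.Reg :=
  (contDiff_r hM).contDiffOn

theorem contDiffOn_Om (hM : |G.Q| < G.M) : ContDiffOn ℝ ∞ (fun q : ℝ × ℝ => G.Om q.1 q.2) G.Reg :=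
  (contDiff_Om hM).contDiffOn

/-- A point of the exterior region over a subextremal black hole. -/
structure Pt (G : Geom) (u v : ℝ) (x : E3) : Prop where
  sub : |G.Q| < G.M
  u : G.u₀ ≤ u
  v : G.v₀ ≤ v
  x : ‖x‖ = 1

theorem Pt.r_ne {u v : ℝ} {x : E3} (p : G.Pt u v x) : G.r u v ≠ 0 := (r_pos p.sub u v).ne'

theorem Pt.Om_ne {u v : ℝ} {x : E3} (p : G.Pt u v x) : G.Om u v ≠ 0 := (Om_pos p.sub u v).ne'

theorem Pt.ne {u v : ℝ} {x : E3} (p : G.Pt u v x) : x ≠ 0 := ne_zero_of_norm_one p.x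

end Geom

namespace Geom

variable {G : Geom} {S : Pert} {u v : ℝ} {x : E3}

/-! ## Transport equations -/

/-- This and the following statements solve the field equations for their u- or v-derivative, with
all angular operators taken on the unit sphere. Later identities then become rational identities in
r, Ω and the values at one point. -/
theorem dU_Om_chi (hS : G.IsSolution S) (p : G.Pt u v x) : G.dU (G.Om ⊙ S.chi) u v x =
    (G.Om u v ^ 2 / G.r u v) • (G.Om u v • S.chi u v x - G.Om u v • S.chib u v x
      - (2 : ℝ) • sD2 (S.eta u v) x) := by
  have e := hS.nullStructure.chi_3 u v x p.u p.v p.x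
  have hr := p.r_ne
  have hO := p.Om_ne
  funext I
  have e := congrFun e I
  simp [nab3, mulF, trchi, trchib, D2] at e ⊢
  field_simp at e ⊢
  linear_combination e

theorem dV_Om_chib (hS : G.IsSolution S) (p : G.Pt u v x) : G.dV (G.Om ⊙ S.chib) u v x =
    (G.Om u v ^ 2 / G.r u v) • (G.Om u v • S.chi u v x - G.Om u v • S.chib u v x
      - (2 : ℝ) • sD2 (S.etab u v) x) := by
  have e := hS.nullStructure.chib_4 u v x p.u p.v p.x
  have hr := p.r_ne
  have hO := p.Om_ne
  funext I
  have e := congrFun e I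
  simp [nab4, mulF, trchi, trchib, D2] at e ⊢
  field_simp at e ⊢
  linear_combination e

theorem dU_etab (hS : G.IsSolution S) (p : G.Pt u v x) : G.dU S.etab u v x =
    -(G.Om u v ^ 2 / G.r u v) • (S.eta u v x - S.etab u v x)
      + G.Om u v • (S.betab u v x + G.rhoF u v • S.betabF u v x) := by
  have e := hS.nullStructure.etab_3 u v x p.u p.v p.x
  have hr := p.r_ne
  have hO := p.Om_ne
  funext I
  have e := congrFun e I
  simp [nab3, mulF, trchib] at e ⊢
  field_simp at e ⊢
  linear_combination e

theorem dV_eta (hS : G.IsSolution S) (p : G.Pt u v x) : G.dV S.eta u v x =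
    -(G.Om u v ^ 2 / G.r u v) • (S.eta u v x - S.etab u v x)
      - G.Om u v • (S.beta u v x + G.rhoF u v • S.betaF u v x) := by
  have e := hS.nullStructure.eta_4 u v x p.u p.v p.x
  have hr := p.r_ne
  have hO := p.Om_ne
  funext I
  have e := congrFun e I
  simp [nab4, mulF, trchi] at e ⊢
  field_simp at e ⊢
  linear_combination e

theorem dV_etab (hS : G.IsSolution S) (p : G.Pt u v x) : G.dV S.etab u v x =
    (2 / G.r u v) • nabla (S.om u v) x - (2 * G.Om u v ^ 2 / G.r u v) • S.etab u v x
      + G.Om u v • (S.beta u v x + G.rhoF u v • S.betaF u v x) := by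
  have e := hS.nullStructure.etab_4 u v x p.u p.v p.x
  have hr := p.r_ne
  have hO := p.Om_ne
  funext I
  have e := congrFun e I
  simp [nab4, mulF, trchi, grad] at e ⊢
  field_simp at e ⊢
  linear_combination e

theorem dU_betaF (hS : G.IsSolution S) (p : G.Pt u v x) : G.dU S.betaF u v x =
    (G.Om u v ^ 2 / G.r u v + G.om u v) • S.betaF u v x
      - (G.Om u v / G.r u v) • sD1 (S.rhoF u v) (S.sigmaF u v) x + (2 * G.rhoF u v * G.Om u v) • S.eta u v x := by
  have e := hS.maxwell.betaF_3 u v x p.u p.v p.x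
  have hr := p.r_ne
  have hO := p.Om_ne
  funext I
  have e := congrFun e I
  simp [nab3, mulF, trchib, ombh, omb, D1] at e ⊢
  field_simp at e ⊢
  linear_combination e

theorem dV_betabF (hS : G.IsSolution S) (p : G.Pt u v x) : G.dV S.betabF u v x =
    -(G.Om u v ^ 2 / G.r u v + G.om u v) • S.betabF u v x
      + (G.Om u v / G.r u v) • sD1 (S.rhoF u v) (-S.sigmaF u v) x - (2 * G.rhoF u v * G.Om u v) • S.etab u v x := by
  have e := hS.maxwell.betabF_4 u v x p.u p.v p.x
  have hr := p.r_ne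
  have hO := p.Om_ne
  funext I
  have e := congrFun e I
  simp [nab4, mulF, trchi, omh, D1] at e ⊢
  field_simp at e ⊢
  linear_combination e

theorem dU_rhoF (hS : G.IsSolution S) (p : G.Pt u v x) : G.dU S.rhoF u v x =
    (2 * G.Om u v ^ 2 / G.r u v) • S.rhoF u v x - (G.Om u v / G.r u v) • sdiv (S.betabF u v) x
      - G.rhoF u v • S.otxb u v x := by
  have e := hS.maxwell.rhoF_3 u v x p.u p.v p.x
  have hr := p.r_ne
  have hO := p.Om_ne
  funext I
  have e := congrFun e I
  simp [nab3, mulF, trchib, div] at e ⊢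
  field_simp at e ⊢
  linear_combination e

theorem dV_rhoF (hS : G.IsSolution S) (p : G.Pt u v x) : G.dV S.rhoF u v x =
    -(2 * G.Om u v ^ 2 / G.r u v) • S.rhoF u v x + (G.Om u v / G.r u v) • sdiv (S.betaF u v) x
      - G.rhoF u v • S.otx u v x := by
  have e := hS.maxwell.rhoF_4 u v x p.u p.v p.x
  have hr := p.r_ne
  have hO := p.Om_ne
  funext I
  have e := congrFun e I
  simp [nab4, mulF, trchi, div] at e ⊢
  field_simp at e ⊢
  linear_combination e

theorem dU_sigmaF (hS : G.IsSolution S) (p : G.Pt u v x) : G.dU S.sigmaF u v x =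
    (2 * G.Om u v ^ 2 / G.r u v) • S.sigmaF u v x
      + (G.Om u v / G.r u v) • scurl (S.betabF u v) x := by
  have e := hS.maxwell.sigmaF_3 u v x p.u p.v p.x
  have hr := p.r_ne
  have hO := p.Om_ne
  funext I
  have e := congrFun e I
  simp [nab3, mulF, trchib, curl] at e ⊢
  field_simp at e ⊢
  linear_combination e

theorem dV_sigmaF (hS : G.IsSolution S) (p : G.Pt u v x) : G.dV S.sigmaF u v x =
    -(2 * G.Om u v ^ 2 / G.r u v) • S.sigmaF u v x
      + (G.Om u v / G.r u v) • scurl (S.betaF u v) x := by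
  have e := hS.maxwell.sigmaF_4 u v x p.u p.v p.x
  have hr := p.r_ne
  have hO := p.Om_ne
  funext I
  have e := congrFun e I
  simp [nab4, mulF, trchi, curl] at e ⊢
  field_simp at e ⊢
  linear_combination e

theorem dU_otx (hS : G.IsSolution S) (p : G.Pt u v x) : G.dU S.otx u v x =
    (2 * G.Om u v ^ 2) • ((1 / G.r u v) • sdiv (S.eta u v) x + S.rho u v x
      + (2 * G.rho u v) • S.lO u v x) - (G.Om u v ^ 2 / G.r u v) • (S.otxb u v x - S.otx u v x) := by
  have e := hS.nullStructure.otx_u u v x p.u p.v p.x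
  have hr := p.r_ne
  have hO := p.Om_ne
  funext I
  have e := congrFun e I
  simp [mulF, trchi, div] at e ⊢
  field_simp at e ⊢
  linear_combination e

theorem dV_otxb (hS : G.IsSolution S) (p : G.Pt u v x) : G.dV S.otxb u v x =
    (2 * G.Om u v ^ 2) • ((1 / G.r u v) • sdiv (S.etab u v) x + S.rho u v x
      + (2 * G.rho u v) • S.lO u v x) - (G.Om u v ^ 2 / G.r u v) • (S.otxb u v x - S.otx u v x) := by
  have e := hS.nullStructure.otxb_v u v x p.u p.v p.x
  have hr := p.r_ne
  have hO := p.Om_ne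
  funext I
  have e := congrFun e I
  simp [mulF, trchi, div] at e ⊢
  field_simp at e ⊢
  linear_combination e

theorem dV_otx (hS : G.IsSolution S) (p : G.Pt u v x) : G.dV S.otx u v x =
    (2 * G.om u v - 2 * G.Om u v ^ 2 / G.r u v) • S.otx u v x
      + (4 * G.Om u v ^ 2 / G.r u v) • S.om u v x := by
  have e := hS.nullStructure.otx_v u v x p.u p.v p.x
  have hr := p.r_ne
  have hO := p.Om_ne
  funext I
  have e := congrFun e I
  simp [mulF, trchi] at e ⊢
  field_simp at e ⊢
  linear_combination e

theorem dU_rho (hS : G.IsSolution S) (p : G.Pt u v x) : G.dU S.rho u v x =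
    (3 * G.Om u v ^ 2 / G.r u v) • S.rho u v x - (G.Om u v / G.r u v) • sdiv (S.betab u v) x
      - (G.rhoF u v * G.Om u v / G.r u v) • sdiv (S.betabF u v) x - (3 / 2 * G.rho u v + G.rhoF u v ^ 2) • S.otxb u v x
      + (4 * G.Om u v ^ 2 / G.r u v * G.rhoF u v) • S.rhoF u v x := by
  have e := hS.bianchi.rho_3 u v x p.u p.v p.x
  have hr := p.r_ne
  have hO := p.Om_ne
  funext I
  have e := congrFun e I
  simp [nab3, mulF, trchib, div] at e ⊢
  field_simp at e ⊢
  linear_combination e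

theorem dV_rho (hS : G.IsSolution S) (p : G.Pt u v x) : G.dV S.rho u v x =
    -(3 * G.Om u v ^ 2 / G.r u v) • S.rho u v x + (G.Om u v / G.r u v) • sdiv (S.beta u v) x
      + (G.rhoF u v * G.Om u v / G.r u v) • sdiv (S.betaF u v) x - (3 / 2 * G.rho u v + G.rhoF u v ^ 2) • S.otx u v x
      - (4 * G.Om u v ^ 2 / G.r u v * G.rhoF u v) • S.rhoF u v x := by
  have e := hS.bianchi.rho_4 u v x p.u p.v p.x
  have hr := p.r_ne
  have hO := p.Om_ne
  funext I
  have e := congrFun e I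
  simp [nab4, mulF, trchi, div] at e ⊢
  field_simp at e ⊢
  linear_combination e

end Geom

theorem SphSmooth.add {V : Type*} [NormedAddCommGroup V] [NormedSpace ℝ V] {T T' : E3 → V}
    (hT : SphSmooth T) (hT' : SphSmooth T') : SphSmooth fun x => T x + T' x := ContDiffOn.add hT hT'

theorem SphSmooth.const_smul {V : Type*} [NormedAddCommGroup V] [NormedSpace ℝ V] {T : E3 → V}
    (hT : SphSmooth T) (k : ℝ) : SphSmooth fun x => k • T x := ContDiffOn.const_smul k hT

/-! ## Bilinearity of the inner product of tensors -/

section Inner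

variable {n : ℕ} (A B C : Tensor n) (k : ℝ)

theorem tinner_add_left : tinner (A + B) C = tinner A C + tinner B C := by
  simp [tinner, add_mul, Finset.sum_add_distrib]

theorem tinner_add_right : tinner A (B + C) = tinner A B + tinner A C := by
  simp [tinner, mul_add, Finset.sum_add_distrib]

theorem tinner_sub_left : tinner (A - B) C = tinner A C - tinner B C := by
  simp [tinner, sub_mul, Finset.sum_sub_distrib]

theorem tinner_sub_right : tinner A (B - C) = tinner A B - tinner A C := by
  simp [tinner, mul_sub, Finset.sum_sub_distrib]

theorem tinner_neg_left : tinner (-A) C = -tinner A C := by simp [tinner]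

theorem tinner_smul_left : tinner (k • A) B = k * tinner A B := by
  simp [tinner, Finset.mul_sum, mul_assoc]

theorem tinner_smul_right : tinner A (k • B) = k * tinner A B := by
  simp [tinner, Finset.mul_sum, mul_left_comm]

theorem tinner_comm : tinner A B = tinner B A := by simp [tinner, mul_comm]

theorem tsq_nonneg : 0 ≤ tsq A := Finset.sum_nonneg fun _ _ => mul_self_nonneg _

theorem tsq_smul : tsq (k • A) = k ^ 2 * tsq A := by
  rw [tsq, tinner_smul_left, tinner_smul_right, tsq]; ring

theorem tsq_zero_rank (A : Tensor 0) : tsq A = A ![] ^ 2 := by rw [tsq, tinner_zero, sq]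

theorem _root_.HasDerivWithinAt.tinner {A B : ℝ → Tensor n} {A' B' : Tensor n} {s : Set ℝ} {t : ℝ}
    (hA : HasDerivWithinAt A A' s t) (hB : HasDerivWithinAt B B' s t) :
    HasDerivWithinAt (fun t => tinner (A t) (B t)) (tinner A' (B t) + tinner (A t) B') s t := by
  have h : HasDerivWithinAt (fun t => ∑ I, A t I * B t I) (∑ I, (A' I * B t I + A t I * B' I)) s t :=
    HasDerivWithinAt.fun_sum fun I _ =>
      (hasDerivWithinAt_pi.1 hA I).mul (hasDerivWithinAt_pi.1 hB I)
  exact h.congr_deriv (by simp [RN.tinner, Finset.sum_add_distrib])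

theorem _root_.HasDerivWithinAt.tsq {A : ℝ → Tensor n} {A' : Tensor n} {s : Set ℝ} {t : ℝ}
    (hA : HasDerivWithinAt A A' s t) :
    HasDerivWithinAt (fun t => tsq (A t)) (2 * RN.tinner A' (A t)) s t :=
  (hA.tinner hA).congr_deriv (by rw [tinner_comm (A t)]; ring)

end Inner

/-! ### Codazzi, Gauss and the commuted equations for the torsions. -/

namespace Geom

variable {G : Geom} {S : Pert} {u v : ℝ} {x : E3}

theorem sdiv_chi (hS : G.IsSolution S) (p : G.Pt u v x) : sdiv (S.chi u v) x =
    -G.Om u v • S.etab u v x - G.r u v • S.beta u v x + (G.r u v * G.rhoF u v) • S.betaF u v x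
      + (1 / (2 * G.Om u v)) • nabla (S.otx u v) x := by
  have e := hS.nullStructure.codazzi u v x p.u p.v p.x
  have hr := p.r_ne
  have hO := p.Om_ne
  funext I
  have e := congrFun e I
  simp [mulF, trchi, div, grad] at e ⊢
  field_simp at e ⊢
  linear_combination e

theorem sdiv_chib (hS : G.IsSolution S) (p : G.Pt u v x) : sdiv (S.chib u v) x =
    G.Om u v • S.eta u v x + G.r u v • S.betab u v x - (G.r u v * G.rhoF u v) • S.betabF u v x
      + (1 / (2 * G.Om u v)) • nabla (S.otxb u v) x := by
  have e := hS.nullStructure.codazzi_b u v x p.u p.v p.x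
  have hr := p.r_ne
  have hO := p.Om_ne
  funext I
  have e := congrFun e I
  simp [mulF, trchib, div, grad] at e ⊢
  field_simp at e ⊢
  linear_combination e

theorem nabla_lO (hS : G.IsSolution S) (p : G.Pt u v x) : nabla (S.lO u v) x =
    (G.r u v / 2) • (S.eta u v x + S.etab u v x) := by
  have e := hS.nullStructure.lO_grad u v x p.u p.v p.x
  have hr := p.r_ne
  funext I
  have e := congrFun e I
  simp [mulF, grad] at e ⊢
  field_simp at e ⊢
  linear_combination e

theorem K_eq (hS : G.IsSolution S) (p : G.Pt u v x) : S.K u v x =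
    -S.rho u v x + (2 * G.rhoF u v) • S.rhoF u v x
      - (1 / (2 * G.r u v)) • (S.otxb u v x - S.otx u v x)
      - (2 * G.Om u v ^ 2 / G.r u v ^ 2) • S.lO u v x := by
  have e := hS.nullStructure.gauss u v x p.u p.v p.x
  have hr := p.r_ne
  have hO := p.Om_ne
  funext I
  have e := congrFun e I
  simp [mulF, trchib, trchi] at e ⊢
  field_simp at e ⊢
  linear_combination e / 2

/-- The evolution equation is applied at every point of the sphere and the unit-sphere divergence,
which commutes with the derivative in u, is taken termwise. -/
theorem dU_sdiv_etab (hS : G.IsSolution S) (p : G.Pt u v x) :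
    G.dU (fun u v => sdiv (S.etab u v)) u v x =
      -(G.Om u v ^ 2 / G.r u v) • (sdiv (S.eta u v) x - sdiv (S.etab u v) x)
      + G.Om u v • (sdiv (S.betab u v) x + G.rhoF u v • sdiv (S.betabF u v) x) := by
  rw [Smooth.dU_sdiv hS.smooth.etab.1 p.u p.v p.x]
  have h1 := Smooth.slice hS.smooth.eta.1 p.u p.v
  have h2 := Smooth.slice hS.smooth.etab.1 p.u p.v
  have h3 := Smooth.slice hS.smooth.betab.1 p.u p.v
  have h4 := Smooth.slice hS.smooth.betabF.1 p.u p.v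
  rw [sdiv_congr (T := fun y => ((-(G.Om u v ^ 2 / G.r u v)) • S.eta u v y
    + (G.Om u v ^ 2 / G.r u v) • S.etab u v y) + (G.Om u v • S.betab u v y
    + (G.Om u v * G.rhoF u v) • S.betabF u v y)) (fun y hy => ?_) p.ne,
    sdiv_add ((h1.const_smul _).add (h2.const_smul _)) ((h3.const_smul _).add (h4.const_smul _)) p.ne,
    sdiv_add (h1.const_smul _) (h2.const_smul _) p.ne, sdiv_add (h3.const_smul _) (h4.const_smul _) p.ne]
  · simp only [sdiv_const_smul]; module
  · rw [dU_etab hS ⟨p.sub, p.u, p.v, hy⟩]; module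

theorem dV_sdiv_eta (hS : G.IsSolution S) (p : G.Pt u v x) :
    G.dV (fun u v => sdiv (S.eta u v)) u v x =
      -(G.Om u v ^ 2 / G.r u v) • (sdiv (S.eta u v) x - sdiv (S.etab u v) x)
      - G.Om u v • (sdiv (S.beta u v) x + G.rhoF u v • sdiv (S.betaF u v) x) := by
  rw [Smooth.dV_sdiv hS.smooth.eta.1 p.u p.v p.x]
  have h1 := Smooth.slice hS.smooth.eta.1 p.u p.v
  have h2 := Smooth.slice hS.smooth.etab.1 p.u p.v
  have h3 := Smooth.slice hS.smooth.beta.1 p.u p.v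
  have h4 := Smooth.slice hS.smooth.betaF.1 p.u p.v
  rw [sdiv_congr (T := fun y => ((-(G.Om u v ^ 2 / G.r u v)) • S.eta u v y
    + (G.Om u v ^ 2 / G.r u v) • S.etab u v y) + ((-G.Om u v) • S.beta u v y
    + (-(G.Om u v * G.rhoF u v)) • S.betaF u v y)) (fun y hy => ?_) p.ne,
    sdiv_add ((h1.const_smul _).add (h2.const_smul _)) ((h3.const_smul _).add (h4.const_smul _)) p.ne,
    sdiv_add (h1.const_smul _) (h2.const_smul _) p.ne, sdiv_add (h3.const_smul _) (h4.const_smul _) p.ne]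
  · simp only [sdiv_const_smul]; module
  · rw [dV_eta hS ⟨p.sub, p.u, p.v, hy⟩]; module

/-! ## The conservation law -/

/-- The integrand of `outDensity`. -/
def outField (G : Geom) (S : Pert) (u v : ℝ) (x : E3) : ℝ :=
  (tsq ((G.Om ⊙ S.chi) u v x) + 2 * tsq ((G.Om ⊙ S.etab) u v x)
    + 2 * tsq ((G.Om ⊙ S.betaF) u v x) + 2 * tsq ((G.Om ⊙ S.sigmaF) u v x)
    + 2 * tsq ((G.Om ⊙ S.rhoF) u v x)
    + G.r u v * tinner (S.otx u v x) ((S.rho + G.div S.etab) u v x)) * G.r u v ^ 2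

/-- The integrand of `inDensity`. -/
def inField (G : Geom) (S : Pert) (u v : ℝ) (x : E3) : ℝ :=
  (tsq ((G.Om ⊙ S.chib) u v x) + 2 * tsq ((G.Om ⊙ S.eta) u v x)
    + 2 * tsq ((G.Om ⊙ S.betabF) u v x) + 2 * tsq ((G.Om ⊙ S.sigmaF) u v x)
    + 2 * tsq ((G.Om ⊙ S.rhoF) u v x)
    - G.r u v * tinner (S.otxb u v x) ((S.rho + G.div S.eta) u v x)) * G.r u v ^ 2

/-- Collects the powers of r and Ω so that only derivatives on the unit sphere remain to be
differentiated in u. -/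
theorem outField_eq (p : G.Pt u v x) : outField G S u v x =
    G.r u v ^ 2 * tsq ((G.Om ⊙ S.chi) u v x)
    + 2 * (G.r u v * G.Om u v) ^ 2 * (tsq (S.etab u v x) + tsq (S.betaF u v x)
      + tsq (S.sigmaF u v x) + tsq (S.rhoF u v x))
    + G.r u v ^ 2 * tinner (S.otx u v x) (G.r u v • S.rho u v x + sdiv (S.etab u v) x) := by
  have hr := p.r_ne
  simp only [outField, mulF, tsq_smul, div, Pi.add_apply, tinner_add_right, Pi.inv_apply,
    tinner_smul_right]
  field_simp
  ring

theorem inField_eq (p : G.Pt u v x) : inField G S u v x =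
    G.r u v ^ 2 * tsq ((G.Om ⊙ S.chib) u v x)
    + 2 * (G.r u v * G.Om u v) ^ 2 * (tsq (S.eta u v x) + tsq (S.betabF u v x)
      + tsq (S.sigmaF u v x) + tsq (S.rhoF u v x))
    - G.r u v ^ 2 * tinner (S.otxb u v x) (G.r u v • S.rho u v x + sdiv (S.eta u v) x) := by
  have hr := p.r_ne
  simp only [inField, mulF, tsq_smul, div, Pi.add_apply, tinner_add_right, Pi.inv_apply,
    tinner_smul_right]
  field_simp
  ring

-- Every bracket on the right has zero mean on the sphere by `sphNull_sD2`, `sphNull_sD1` or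
-- `sphNull_mul_sdiv_add`; all other terms cancel pointwise, the divergences of the torsions and the
-- Codazzi equations absorbing β and β̲. The last two brackets arise because rρ = -2ω for the
-- background: they collect the terms ρ·`lO` in the equations for `otx` and `otxb`, and through
-- ∇`lO` = (r/2)(η + η̲) also the terms |η|² - |η̲|² produced by differentiating Ω².
set_option maxHeartbeats 1000000 in
theorem outField_inField_deriv (hS : G.IsSolution S) (p : G.Pt u v x) : ∃ a b : ℝ,
    HasDerivWithinAt (fun s => outField G S s v x) a (Ici G.u₀) u ∧
    HasDerivWithinAt (fun s => inField G S u s x) b (Ici G.v₀) v ∧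
    a + b = -(4 * G.r u v * G.Om u v ^ 3) *
        (tinner (S.chi u v x) (sD2 (S.eta u v) x) - tinner (sdiv (S.chi u v) x) (S.eta u v x))
      + -(4 * G.r u v * G.Om u v ^ 3) *
        (tinner (S.chib u v x) (sD2 (S.etab u v) x) - tinner (sdiv (S.chib u v) x) (S.etab u v x))
      + -(4 * G.r u v * G.Om u v ^ 3) *
        (tinner (S.betaF u v x) (sD1 (S.rhoF u v) (S.sigmaF u v) x)
          - S.rhoF u v x ![] * sdiv (S.betaF u v) x ![]
          - S.sigmaF u v x ![] * scurl (S.betaF u v) x ![])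
      + (4 * G.r u v * G.Om u v ^ 3) *
        (tinner (S.betabF u v x) (sD1 (S.rhoF u v) (-S.sigmaF u v) x)
          - S.rhoF u v x ![] * sdiv (S.betabF u v) x ![]
          - (-S.sigmaF u v) x ![] * scurl (S.betabF u v) x ![])
      + -(2 * G.r u v * G.Om u v ^ 2) *
        (S.otx u v x ![] * sdiv (S.eta u v) x ![] + tinner (S.eta u v x) (nabla (S.otx u v) x))
      + -(2 * G.r u v * G.Om u v ^ 2) *
        (S.otxb u v x ![] * sdiv (S.etab u v) x ![] + tinner (S.etab u v x) (nabla (S.otxb u v) x))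
      + (8 * G.om u v * G.Om u v ^ 2 * G.r u v) *
        (S.lO u v x ![] * sdiv (S.eta u v) x ![] + tinner (S.eta u v x) (nabla (S.lO u v) x))
      + -(8 * G.om u v * G.Om u v ^ 2 * G.r u v) *
        (S.lO u v x ![] * sdiv (S.etab u v) x ![] + tinner (S.etab u v x) (nabla (S.lO u v) x)) := by
  have hr := p.r_ne
  have hO := p.Om_ne
  have sm := hS.smooth
  have cO := contDiffOn_Om p.sub
  have ru := (hasDerivAt_r_u p.sub u v).hasDerivWithinAt (s := Ici G.u₀)
  have rv := (hasDerivAt_r_v p.sub u v).hasDerivWithinAt (s := Ici G.v₀)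
  have Ou := (hasDerivAt_Om_u p.sub u v).hasDerivWithinAt (s := Ici G.u₀)
  have Ov := (hasDerivAt_Om_v p.sub u v).hasDerivWithinAt (s := Ici G.v₀)
  have a1 := (Smooth.hasDerivWithinAt_dU (sm.chi.1.mulF cO) p.u p.v p.x).tsq
  have a2 := (Smooth.hasDerivWithinAt_dU sm.etab.1 p.u p.v p.x).tsq
  have a3 := (Smooth.hasDerivWithinAt_dU sm.betaF.1 p.u p.v p.x).tsq
  have a4 := (Smooth.hasDerivWithinAt_dU sm.sigmaF p.u p.v p.x).tsq
  have a5 := (Smooth.hasDerivWithinAt_dU sm.rhoF p.u p.v p.x).tsq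
  have a6 := (Smooth.hasDerivWithinAt_dU sm.otx p.u p.v p.x).tinner
    ((ru.fun_smul (Smooth.hasDerivWithinAt_dU sm.rho p.u p.v p.x)).fun_add
      (Smooth.hasDerivWithinAt_dU sm.etab.1.sdiv p.u p.v p.x))
  have b1 := (Smooth.hasDerivWithinAt_dV (sm.chib.1.mulF cO) p.u p.v p.x).tsq
  have b2 := (Smooth.hasDerivWithinAt_dV sm.eta.1 p.u p.v p.x).tsq
  have b3 := (Smooth.hasDerivWithinAt_dV sm.betabF.1 p.u p.v p.x).tsq
  have b4 := (Smooth.hasDerivWithinAt_dV sm.sigmaF p.u p.v p.x).tsq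
  have b5 := (Smooth.hasDerivWithinAt_dV sm.rhoF p.u p.v p.x).tsq
  have b6 := (Smooth.hasDerivWithinAt_dV sm.otxb p.u p.v p.x).tinner
    ((rv.fun_smul (Smooth.hasDerivWithinAt_dV sm.rho p.u p.v p.x)).fun_add
      (Smooth.hasDerivWithinAt_dV sm.eta.1.sdiv p.u p.v p.x))
  have ha := (((ru.fun_pow 2).fun_mul a1).fun_add ((((ru.fun_mul Ou).fun_pow 2).const_mul 2).fun_mul
    (((a2.fun_add a3).fun_add a4).fun_add a5))).fun_add ((ru.fun_pow 2).fun_mul a6)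
  have hb := (((rv.fun_pow 2).fun_mul b1).fun_add ((((rv.fun_mul Ov).fun_pow 2).const_mul 2).fun_mul
    (((b2.fun_add b3).fun_add b4).fun_add b5))).fun_sub ((rv.fun_pow 2).fun_mul b6)
  refine ⟨_, _, ha.congr (fun s hs => ?_) (outField_eq p), hb.congr (fun s hs => ?_)
    (inField_eq p), ?_⟩
  · exact outField_eq ⟨p.sub, hs, p.v, p.x⟩
  · exact inField_eq ⟨p.sub, p.u, hs, p.x⟩
  simp only [dU_Om_chi hS p, dV_Om_chib hS p, dU_etab hS p, dV_eta hS p, dU_betaF hS p,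
    dV_betabF hS p, dU_rhoF hS p, dV_rhoF hS p, dU_sigmaF hS p, dV_sigmaF hS p, dU_otx hS p,
    dV_otxb hS p, dU_rho hS p, dV_rho hS p, dU_sdiv_etab hS p, dV_sdiv_eta hS p, sdiv_chi hS p,
    sdiv_chib hS p, nabla_lO hS p, mulF, tsq, tinner_zero, tinner_add_left, tinner_add_right,
    tinner_sub_left, tinner_smul_left, tinner_smul_right, tinner_neg_left,
    Pi.add_apply, Pi.sub_apply, Pi.smul_apply, Pi.neg_apply, smul_eq_mul, neg_smul,
    Nat.cast_ofNat, Nat.add_one_sub_one, pow_one]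
  rw [tinner_comm (S.etab u v x) (S.eta u v x), tinner_comm (S.chib u v x) (S.chi u v x),
    tinner_comm (sD2 (S.eta u v) x) (S.chi u v x), tinner_comm (sD2 (S.etab u v) x) (S.chib u v x),
    tinner_comm (sD1 _ _ x) (S.betaF u v x), tinner_comm (sD1 _ _ x) (S.betabF u v x),
    tinner_comm (S.beta u v x) (S.eta u v x), tinner_comm (S.betaF u v x) (S.eta u v x),
    tinner_comm (S.betab u v x) (S.etab u v x), tinner_comm (S.betabF u v x) (S.etab u v x),
    tinner_comm (nabla (S.otx u v) x) (S.eta u v x), tinner_comm (nabla (S.otxb u v) x) (S.etab u v x)]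
  simp only [rho, rhoF, om]
  field_simp
  ring

end Geom

/-! ### Sphere integrals of smooth fields, and fluxes through characteristic rectangles. -/

namespace Geom

variable {G : Geom} {S : Pert} {u v : ℝ} {x : E3}

section Deriv

variable {V : Type*} [NormedAddCommGroup V] [NormedSpace ℝ V] {T : ℝ → ℝ → E3 → V}

theorem famSmooth_derivU (hT : FamSmooth G.Reg fun q => T q.1 q.2) :
    FamSmooth G.Reg fun q x => derivWithin (fun s => T s q.2 x) (Ici G.u₀) q.1 := by
  set F : (ℝ × ℝ) × E3 → V := fun p => ext (T p.1.1 p.1.2) p.2 with hF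
  have h1 : ContDiffOn ℝ ∞ (fun p => fderivWithin ℝ F (G.Reg ×ˢ {0}ᶜ) p ((1, 0), 0))
      (G.Reg ×ˢ {0}ᶜ) :=
    (ContDiffOn.fderivWithin hT (uniqueDiffOn_fam uniqueDiffOn_Reg) (by simp)).clm_apply
      contDiffOn_const
  refine ContDiffOn.congr h1 fun p hp => ?_
  have hd : DifferentiableWithinAt ℝ F (G.Reg ×ˢ {0}ᶜ) p :=
    ContDiffOn.differentiableOn hT (by simp) p hp
  have h2 : HasDerivWithinAt (fun s : ℝ => ((s, p.1.2), p.2)) ((1, 0), 0) (Ici G.u₀) p.1.1 :=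
    ((hasDerivWithinAt_id _ _).prodMk (hasDerivWithinAt_const _ _ _)).prodMk
      (hasDerivWithinAt_const _ _ _)
  have h3 : MapsTo (fun s : ℝ => ((s, p.1.2), p.2)) (Ici G.u₀) (G.Reg ×ˢ ({0}ᶜ : Set E3)) :=
    fun s hs => ⟨⟨hs, hp.1.2⟩, hp.2⟩
  exact (hd.hasFDerivWithinAt.comp_hasDerivWithinAt p.1.1 h2 h3).derivWithin
    (uniqueDiffOn_Ici _ _ hp.1.1)

theorem famSmooth_derivV (hT : FamSmooth G.Reg fun q => T q.1 q.2) :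
    FamSmooth G.Reg fun q x => derivWithin (fun s => T q.1 s x) (Ici G.v₀) q.2 := by
  set F : (ℝ × ℝ) × E3 → V := fun p => ext (T p.1.1 p.1.2) p.2 with hF
  have h1 : ContDiffOn ℝ ∞ (fun p => fderivWithin ℝ F (G.Reg ×ˢ {0}ᶜ) p ((0, 1), 0))
      (G.Reg ×ˢ {0}ᶜ) :=
    (ContDiffOn.fderivWithin hT (uniqueDiffOn_fam uniqueDiffOn_Reg) (by simp)).clm_apply
      contDiffOn_const
  refine ContDiffOn.congr h1 fun p hp => ?_
  have hd : DifferentiableWithinAt ℝ F (G.Reg ×ˢ {0}ᶜ) p :=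
    ContDiffOn.differentiableOn hT (by simp) p hp
  have h2 : HasDerivWithinAt (fun s : ℝ => ((p.1.1, s), p.2)) ((0, 1), 0) (Ici G.v₀) p.1.2 :=
    ((hasDerivWithinAt_const _ _ _).prodMk (hasDerivWithinAt_id _ _)).prodMk
      (hasDerivWithinAt_const _ _ _)
  have h3 : MapsTo (fun s : ℝ => ((p.1.1, s), p.2)) (Ici G.v₀) (G.Reg ×ˢ ({0}ᶜ : Set E3)) :=
    fun s hs => ⟨⟨hp.1.1, hs⟩, hp.2⟩
  exact (hd.hasFDerivWithinAt.comp_hasDerivWithinAt p.1.2 h2 h3).derivWithin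
    (uniqueDiffOn_Ici _ _ hp.1.2)

end Deriv

section Continuity

variable {f : ℝ → ℝ → E3 → ℝ}

theorem isClosed_Reg : IsClosed G.Reg := isClosed_Ici.prod isClosed_Ici

theorem continuousOn_sphInt_Reg (hf : FamSmooth G.Reg fun q => f q.1 q.2) :
    ContinuousOn (fun q : ℝ × ℝ => sphInt (f q.1 q.2)) G.Reg :=
  continuousOn_sphInt isClosed_Reg hf.continuousOn

theorem continuousOn_sphInt_u (hf : FamSmooth G.Reg fun q => f q.1 q.2) (hv : G.v₀ ≤ v) :
    ContinuousOn (fun u => sphInt (f u v)) (Ici G.u₀) :=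
  continuousOn_sphInt isClosed_Ici (famSmooth_u hf hv).continuousOn

theorem continuousOn_sphInt_v (hf : FamSmooth G.Reg fun q => f q.1 q.2) (hu : G.u₀ ≤ u) :
    ContinuousOn (fun v => sphInt (f u v)) (Ici G.v₀) :=
  continuousOn_sphInt isClosed_Ici (famSmooth_v hf hu).continuousOn

theorem intervalIntegrable_sphInt_u (hf : FamSmooth G.Reg fun q => f q.1 q.2) (hv : G.v₀ ≤ v)
    {u₁ : ℝ} (hu : G.u₀ ≤ u₁) :
    IntervalIntegrable (fun u => sphInt (f u v)) volume G.u₀ u₁ :=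
  ((continuousOn_sphInt_u hf hv).mono (by
    rw [uIcc_of_le hu]; exact Icc_subset_Ici_self)).intervalIntegrable

theorem intervalIntegrable_sphInt_v (hf : FamSmooth G.Reg fun q => f q.1 q.2) (hu : G.u₀ ≤ u)
    {v₁ : ℝ} (hv : G.v₀ ≤ v₁) :
    IntervalIntegrable (fun v => sphInt (f u v)) volume G.v₀ v₁ :=
  ((continuousOn_sphInt_v hf hu).mono (by
    rw [uIcc_of_le hv]; exact Icc_subset_Ici_self)).intervalIntegrable

theorem continuousOn_S2 (hf : FamSmooth G.Reg fun q => f q.1 q.2) (hu : G.u₀ ≤ u) (hv : G.v₀ ≤ v) :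
    ContinuousOn (f u v) S2 :=
  (FamSmooth.slice (T := fun q : ℝ × ℝ => f q.1 q.2) hf (q := (u, v)) ⟨hu, hv⟩).continuousOn

theorem sphInt_sub_u (hf : FamSmooth G.Reg fun q => f q.1 q.2) (hv : G.v₀ ≤ v) {u₁ : ℝ}
    (hu : G.u₀ ≤ u₁) : sphInt (f u₁ v) - sphInt (f G.u₀ v) =
      ∫ u in G.u₀..u₁, sphInt fun x => derivWithin (fun s => f s v x) (Ici G.u₀) u := by
  refine sphInt_sub_eq_integral (f := fun t => f t v) hu (fun x hx t ht => ?_)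
    (continuousOn_S2 hf le_rfl hv) (continuousOn_S2 hf hu hv) ?_
  · exact (famSmooth_u hf hv).hasDerivWithinAt ht.1 hx
  · have := (famSmooth_u (T := fun u v x => derivWithin (fun s => f s v x) (Ici G.u₀) u)
      (famSmooth_derivU hf) hv).continuousOn
    exact this.mono (prod_mono Icc_subset_Ici_self le_rfl)

theorem sphInt_sub_v (hf : FamSmooth G.Reg fun q => f q.1 q.2) (hu : G.u₀ ≤ u) {v₁ : ℝ}
    (hv : G.v₀ ≤ v₁) : sphInt (f u v₁) - sphInt (f u G.v₀) =
      ∫ v in G.v₀..v₁, sphInt fun x => derivWithin (fun s => f u s x) (Ici G.v₀) v := by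
  refine sphInt_sub_eq_integral (f := fun t => f u t) hv (fun x hx t ht => ?_)
    (continuousOn_S2 hf hu le_rfl) (continuousOn_S2 hf hu hv) ?_
  · exact (famSmooth_v hf hu).hasDerivWithinAt ht.1 hx
  · have := (famSmooth_v (T := fun u v x => derivWithin (fun s => f u s x) (Ici G.v₀) v)
      (famSmooth_derivV hf) hu).continuousOn
    exact this.mono (prod_mono Icc_subset_Ici_self le_rfl)

/-- A divergence-free pair of densities has equal total flux through the two pairs of opposite
faces of a rectangle. -/
theorem integral_conservation {g : ℝ → ℝ → E3 → ℝ} (hf : FamSmooth G.Reg fun q => f q.1 q.2)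
    (hg : FamSmooth G.Reg fun q => g q.1 q.2)
    (hfg : ∀ u v, G.u₀ ≤ u → G.v₀ ≤ v → sphInt (fun x =>
      derivWithin (fun s => f s v x) (Ici G.u₀) u + derivWithin (fun s => g u s x) (Ici G.v₀) v) = 0)
    {u₁ v₁ : ℝ} (hu : G.u₀ ≤ u₁) (hv : G.v₀ ≤ v₁) :
    (∫ v in G.v₀..v₁, sphInt (f u₁ v)) + ∫ u in G.u₀..u₁, sphInt (g u v₁) =
      (∫ v in G.v₀..v₁, sphInt (f G.u₀ v)) + ∫ u in G.u₀..u₁, sphInt (g u G.v₀) := by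
  set fu : ℝ → ℝ → ℝ := fun u v => sphInt fun x => derivWithin (fun s => f s v x) (Ici G.u₀) u
  set gv : ℝ → ℝ → ℝ := fun u v => sphInt fun x => derivWithin (fun s => g u s x) (Ici G.v₀) v
  have sf := famSmooth_derivU hf
  have sg := famSmooth_derivV hg
  have hneg : ∀ u v, G.u₀ ≤ u → G.v₀ ≤ v → fu u v = -gv u v := fun u v hu hv => by
    have := hfg u v hu hv
    rw [sphInt_add (continuousOn_S2
        (f := fun u v x => derivWithin (fun s => f s v x) (Ici G.u₀) u) sf hu hv)
      (continuousOn_S2 (f := fun u v x => derivWithin (fun s => g u s x) (Ici G.v₀) v)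
        sg hu hv)] at this
    exact eq_neg_of_add_eq_zero_left this
  have e1 : (∫ v in G.v₀..v₁, sphInt (f u₁ v)) - ∫ v in G.v₀..v₁, sphInt (f G.u₀ v) =
      ∫ v in G.v₀..v₁, ∫ u in G.u₀..u₁, fu u v := by
    rw [← intervalIntegral.integral_sub (intervalIntegrable_sphInt_v hf hu hv)
      (intervalIntegrable_sphInt_v hf le_rfl hv)]
    refine intervalIntegral.integral_congr fun v hv' => ?_
    rw [uIcc_of_le hv] at hv'
    exact sphInt_sub_u hf hv'.1 hu
  have e2 : (∫ u in G.u₀..u₁, sphInt (g u v₁)) - ∫ u in G.u₀..u₁, sphInt (g u G.v₀) =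
      ∫ u in G.u₀..u₁, ∫ v in G.v₀..v₁, gv u v := by
    rw [← intervalIntegral.integral_sub (intervalIntegrable_sphInt_u hg hv hu)
      (intervalIntegrable_sphInt_u hg le_rfl hu)]
    refine intervalIntegral.integral_congr fun u hu' => ?_
    rw [uIcc_of_le hu] at hu'
    exact sphInt_sub_v hg hu'.1 hv
  -- On each sphere the two derivatives have opposite means; with Fubini the two double integrals
  -- cancel.
  have e3 : ∫ u in G.u₀..u₁, ∫ v in G.v₀..v₁, gv u v =
      -∫ u in G.u₀..u₁, ∫ v in G.v₀..v₁, fu u v := by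
    rw [← intervalIntegral.integral_neg]
    refine intervalIntegral.integral_congr fun u hu' => ?_
    rw [uIcc_of_le hu] at hu'
    rw [← intervalIntegral.integral_neg]
    refine intervalIntegral.integral_congr fun v hv' => ?_
    rw [uIcc_of_le hv] at hv'
    simp only [hneg u v hu'.1 hv'.1, neg_neg]
  have e4 : ∫ u in G.u₀..u₁, ∫ v in G.v₀..v₁, fu u v = ∫ v in G.v₀..v₁, ∫ u in G.u₀..u₁, fu u v := by
    refine intervalIntegral_intervalIntegral_swap ?_
    have hc : ContinuousOn (Function.uncurry fu) (Icc G.u₀ u₁ ×ˢ Icc G.v₀ v₁) :=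
      (continuousOn_sphInt_Reg (f := fun u v x => derivWithin (fun s => f s v x) (Ici G.u₀) u)
        sf).mono (prod_mono Icc_subset_Ici_self Icc_subset_Ici_self)
    refine (hc.integrableOn_compact (isCompact_Icc.prod isCompact_Icc)).mono_set ?_
    rw [uIoc_of_le hu, uIoc_of_le hv]
    exact prod_mono Ioc_subset_Icc_self Ioc_subset_Icc_self
  linarith

end Continuity

theorem famSmooth_outField (hM : |G.Q| < G.M) (hS : G.IsSolution S) :
    FamSmooth G.Reg fun q => outField G S q.1 q.2 := by
  have cO := contDiffOn_Om (G := G) hM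
  have cr := contDiffOn_r (G := G) hM
  have sm := hS.smooth
  have m : ∀ {n : ℕ} {T : SField n}, G.Smooth T → FamSmooth G.Reg fun q x =>
    tsq ((G.Om ⊙ T) q.1 q.2 x) := fun hT => (smooth_iff.1 (hT.mulF cO)).tsq
  have two : ContDiffOn ℝ ∞ (fun _ : ℝ × ℝ => (2 : ℝ)) G.Reg := contDiffOn_const
  have hdiv : G.Smooth (G.div S.etab) :=
    sm.etab.1.sdiv.mulF (c := G.r⁻¹) (cr.inv fun q _ => (r_pos hM _ _).ne')
  exact ((((((m sm.chi.1).add ((m sm.etab.1).const_mul two)).add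
    ((m sm.betaF.1).const_mul two)).add ((m sm.sigmaF).const_mul two)).add
    ((m sm.rhoF).const_mul two)).add (((smooth_iff.1 sm.otx).tinner
      (smooth_iff.1 (Smooth.add sm.rho hdiv))).const_mul cr)).mul
    (famSmooth_of_contDiffOn (cr.pow 2))

theorem famSmooth_inField (hM : |G.Q| < G.M) (hS : G.IsSolution S) :
    FamSmooth G.Reg fun q => inField G S q.1 q.2 := by
  have cO := contDiffOn_Om (G := G) hM
  have cr := contDiffOn_r (G := G) hM
  have sm := hS.smooth
  have m : ∀ {n : ℕ} {T : SField n}, G.Smooth T → FamSmooth G.Reg fun q x =>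
    tsq ((G.Om ⊙ T) q.1 q.2 x) := fun hT => (smooth_iff.1 (hT.mulF cO)).tsq
  have two : ContDiffOn ℝ ∞ (fun _ : ℝ × ℝ => (2 : ℝ)) G.Reg := contDiffOn_const
  have hdiv : G.Smooth (G.div S.eta) :=
    sm.eta.1.sdiv.mulF (c := G.r⁻¹) (cr.inv fun q _ => (r_pos hM _ _).ne')
  exact ((((((m sm.chib.1).add ((m sm.eta.1).const_mul two)).add
    ((m sm.betabF.1).const_mul two)).add ((m sm.sigmaF).const_mul two)).add
    ((m sm.rhoF).const_mul two)).sub (((smooth_iff.1 sm.otxb).tinner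
      (smooth_iff.1 (Smooth.add sm.rho hdiv))).const_mul cr)).mul
    (famSmooth_of_contDiffOn (cr.pow 2))

theorem sphNull_deriv (hM : |G.Q| < G.M) (hS : G.IsSolution S) (hu : G.u₀ ≤ u) (hv : G.v₀ ≤ v) :
    SphNull fun x => derivWithin (fun s => outField G S s v x) (Ici G.u₀) u +
      derivWithin (fun s => inField G S u s x) (Ici G.v₀) v := by
  have sm := hS.smooth
  have sl : ∀ {n : ℕ} {T : SField n}, G.Smooth T → SphSmooth (T u v) := fun h => h.slice hu hv
  have tg : ∀ {ξ : SField 1}, G.IsOneForm ξ → Tangential (ξ u v) :=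
    fun h x hx => h.2 u v x hu hv hx
  have st : ∀ {θ : SField 2}, G.IsSymTraceless θ → SymTraceless (θ u v) :=
    fun h x hx => h.2 u v x hu hv hx
  have z1 := sphNull_sD2 (sl sm.chi.1) (st sm.chi) (sl sm.eta.1) (tg sm.eta)
  have z2 := sphNull_sD2 (sl sm.chib.1) (st sm.chib) (sl sm.etab.1) (tg sm.etab)
  have z3 := sphNull_sD1 (sl sm.rhoF) (sl sm.sigmaF) (sl sm.betaF.1) (tg sm.betaF)
  have z4 := sphNull_sD1 (sl sm.rhoF) (sl (Smooth.neg sm.sigmaF)) (sl sm.betabF.1) (tg sm.betabF)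
  have z5 := sphNull_mul_sdiv_add (sl sm.otx) (sl sm.eta.1) (tg sm.eta)
  have z6 := sphNull_mul_sdiv_add (sl sm.otxb) (sl sm.etab.1) (tg sm.etab)
  have z7 := sphNull_mul_sdiv_add (sl sm.lO) (sl sm.eta.1) (tg sm.eta)
  have z8 := sphNull_mul_sdiv_add (sl sm.lO) (sl sm.etab.1) (tg sm.etab)
  refine ((((((((z1.const_mul (-(4 * G.r u v * G.Om u v ^ 3))).add
    (z2.const_mul (-(4 * G.r u v * G.Om u v ^ 3)))).add
    (z3.const_mul (-(4 * G.r u v * G.Om u v ^ 3)))).add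
    (z4.const_mul (4 * G.r u v * G.Om u v ^ 3))).add
    (z5.const_mul (-(2 * G.r u v * G.Om u v ^ 2)))).add
    (z6.const_mul (-(2 * G.r u v * G.Om u v ^ 2)))).add
    (z7.const_mul (8 * G.om u v * G.Om u v ^ 2 * G.r u v))).add
    (z8.const_mul (-(8 * G.om u v * G.Om u v ^ 2 * G.r u v)))).congr fun x hx => ?_
  obtain ⟨a, b, ha, hb, hab⟩ := outField_inField_deriv hS (x := x) ⟨hM, hu, hv, hx⟩
  rw [ha.derivWithin (uniqueDiffOn_Ici _ _ hu), hb.derivWithin (uniqueDiffOn_Ici _ _ hv), hab]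
  rfl

/-- Conservation of the canonical energy on characteristic rectangles. -/
theorem energy_conservation (hM : |G.Q| < G.M) (hS : G.IsSolution S) {u₁ v₁ : ℝ}
    (hu : G.u₀ ≤ u₁) (hv : G.v₀ ≤ v₁) :
    (∫ v in G.v₀..v₁, G.outDensity S u₁ v) + ∫ u in G.u₀..u₁, G.inDensity S u v₁ =
      (∫ v in G.v₀..v₁, G.outDensity S G.u₀ v) + ∫ u in G.u₀..u₁, G.inDensity S u G.v₀ :=
  integral_conservation (famSmooth_outField hM hS) (famSmooth_inField hM hS)
    (fun _ _ hu hv => (sphNull_deriv hM hS hu hv).2) hu hv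

end Geom

namespace Geom

variable {G : Geom} {S : Pert} {u v : ℝ} {x : E3}

/-! ## Coercivity on outgoing cones -/

theorem lam_eq : G.lam S u v x =
    (G.r u v / G.Om u v ^ 2) • S.otx u v x - (4 : ℝ) • S.lO u v x := rfl

theorem lap_eq {n : ℕ} (T : SField n) :
    G.lap T u v x = (1 / G.r u v ^ 2) • sdiv (nabla (T u v)) x := by
  have : (fun u v => sdiv (G.grad T u v)) u v x = (1 / G.r u v) • sdiv (nabla (T u v)) x := by
    have := sdiv_const_smul (1 / G.r u v) (nabla (T u v)) x
    rw [← this, one_div]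
    rfl
  simp only [lap, div, mulF] at this ⊢
  rw [this, smul_smul, Pi.inv_apply, Pi.inv_apply]
  congr 1
  ring

theorem X_eq (p : G.Pt u v x) : G.X S u v x = (2 * G.r u v ^ 3) • S.rho u v x
    - (2 * G.r u v ^ 2) • sdiv (S.etab u v) x
    + (G.r u v ^ 2 / G.Om u v ^ 2) • sdiv (nabla (S.otx u v)) x := by
  have hr := p.r_ne
  have hO := p.Om_ne
  have e : G.X S u v x = (2 * G.r u v ^ 3) • (S.rho u v x - (G.r u v)⁻¹ • sdiv (S.etab u v) x)
    + (G.r u v ^ 2 / G.Om u v ^ 2) • (G.r u v ^ 2 • G.lap S.otx u v x) := rfl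
  rw [e, lap_eq]
  funext I
  simp
  field_simp

theorem smooth_lam (hM : |G.Q| < G.M) (hS : G.IsSolution S) : G.Smooth (G.lam S) :=
  Smooth.sub (Smooth.mulF (c := G.r / G.Om ^ 2) ((contDiffOn_r hM).div ((contDiffOn_Om hM).pow 2)
      fun q _ => pow_ne_zero 2 (Om_pos hM _ _).ne') hS.smooth.otx)
    (Smooth.mulF (c := 4) contDiffOn_const hS.smooth.lO)

theorem smooth_X (hM : |G.Q| < G.M) (hS : G.IsSolution S) : G.Smooth (G.X S) := by
  have cr := contDiffOn_r (G := G) hM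
  have cO := contDiffOn_Om (G := G) hM
  have ci : ContDiffOn ℝ ∞ (fun q : ℝ × ℝ => (G.r⁻¹) q.1 q.2) G.Reg :=
    cr.inv fun q _ => (r_pos hM _ _).ne'
  have h1 : G.Smooth (G.div S.etab) := hS.smooth.etab.1.sdiv.mulF ci
  have h2 : G.Smooth (G.grad S.otx) := Smooth.mulF ci (Smooth.nabla hS.smooth.otx)
  have h3 : G.Smooth (G.lap S.otx) := Smooth.mulF ci h2.sdiv
  exact Smooth.add (Smooth.mulF (c := 2 * G.r ^ 3) (contDiffOn_const.mul (cr.pow 3))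
      (Smooth.sub hS.smooth.rho h1))
    (Smooth.mulF (c := G.r ^ 2 / G.Om ^ 2) ((cr.pow 2).div (cO.pow 2)
      fun q _ => pow_ne_zero 2 (Om_pos hM _ _).ne') (Smooth.mulF (c := G.r ^ 2) (cr.pow 2) h3))

theorem dV_sdiv_etab (hS : G.IsSolution S) (p : G.Pt u v x) :
    G.dV (fun u v => sdiv (S.etab u v)) u v x =
      (2 / G.r u v) • sdiv (nabla (S.om u v)) x - (2 * G.Om u v ^ 2 / G.r u v) • sdiv (S.etab u v) x
      + G.Om u v • (sdiv (S.beta u v) x + G.rhoF u v • sdiv (S.betaF u v) x) := by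
  rw [Smooth.dV_sdiv hS.smooth.etab.1 p.u p.v p.x]
  have h1 := Smooth.slice (Smooth.nabla hS.smooth.om) p.u p.v
  have h2 := Smooth.slice hS.smooth.etab.1 p.u p.v
  have h3 := Smooth.slice hS.smooth.beta.1 p.u p.v
  have h4 := Smooth.slice hS.smooth.betaF.1 p.u p.v
  rw [sdiv_congr (T := fun y => ((2 / G.r u v) • nabla (S.om u v) y
    + (-(2 * G.Om u v ^ 2 / G.r u v)) • S.etab u v y) + (G.Om u v • S.beta u v y
    + (G.Om u v * G.rhoF u v) • S.betaF u v y)) (fun y hy => ?_) p.ne,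
    sdiv_add ((h1.const_smul _).add (h2.const_smul _)) ((h3.const_smul _).add (h4.const_smul _)) p.ne,
    sdiv_add (h1.const_smul _) (h2.const_smul _) p.ne, sdiv_add (h3.const_smul _) (h4.const_smul _) p.ne]
  · simp only [sdiv_const_smul]; module
  · rw [dV_etab hS ⟨p.sub, p.u, p.v, hy⟩]; module

theorem dV_lap_otx (hS : G.IsSolution S) (p : G.Pt u v x) :
    G.dV (fun u v => sdiv (nabla (S.otx u v))) u v x =
      (2 * G.om u v - 2 * G.Om u v ^ 2 / G.r u v) • sdiv (nabla (S.otx u v)) x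
      + (4 * G.Om u v ^ 2 / G.r u v) • sdiv (nabla (S.om u v)) x := by
  have h1 := Smooth.slice hS.smooth.otx p.u p.v
  have h2 := Smooth.slice hS.smooth.om p.u p.v
  have h3 := Smooth.slice (Smooth.nabla hS.smooth.otx) p.u p.v
  have h4 := Smooth.slice (Smooth.nabla hS.smooth.om) p.u p.v
  rw [Smooth.dV_sdiv (Smooth.nabla hS.smooth.otx) p.u p.v p.x]
  rw [sdiv_congr (T := fun y =>
    (2 * G.om u v - 2 * G.Om u v ^ 2 / G.r u v) • nabla (S.otx u v) y
      + (4 * G.Om u v ^ 2 / G.r u v) • nabla (S.om u v) y) (fun y hy => ?_) p.ne,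
    sdiv_add (h3.const_smul _) (h4.const_smul _) p.ne]
  · simp only [sdiv_const_smul]
  · have hy0 := ne_zero_of_norm_one hy
    rw [Smooth.dV_nabla hS.smooth.otx p.u p.v hy, nabla_congr (T := fun z =>
      (2 * G.om u v - 2 * G.Om u v ^ 2 / G.r u v) • S.otx u v z
      + (4 * G.Om u v ^ 2 / G.r u v) • S.om u v z) (fun z hz => ?_) hy0,
      nabla_add (h1.const_smul _) (h2.const_smul _) hy0]
    · simp only [nabla_const_smul]
    · rw [dV_otx hS ⟨p.sub, p.u, p.v, hz⟩]

/-- The `lO` part of λ removes `om`, and the weight r/Ω² leaves -1 as the coefficient of τ. So τ is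
an exact v-derivative, which is what allows the energy density to be integrated along the cone. -/
theorem hasDerivWithinAt_lam (hS : G.IsSolution S) (p : G.Pt u v x) :
    HasDerivWithinAt (fun s => G.lam S u s x ![]) (-S.otx u v x ![]) (Ici G.v₀) v := by
  have hr := p.r_ne
  have hO := p.Om_ne
  have rv := (hasDerivAt_r_v p.sub u v).hasDerivWithinAt (s := Ici G.v₀)
  have Ov := (hasDerivAt_Om_v p.sub u v).hasDerivWithinAt (s := Ici G.v₀)
  have h1 := hasDerivWithinAt_pi.1 (Smooth.hasDerivWithinAt_dV hS.smooth.otx p.u p.v p.x) ![]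
  have h2 := hasDerivWithinAt_pi.1 (Smooth.hasDerivWithinAt_dV hS.smooth.lO p.u p.v p.x) ![]
  have h := ((rv.fun_div (Ov.fun_pow 2) (pow_ne_zero 2 hO)).fun_mul h1).fun_sub (h2.const_mul 4)
  refine HasDerivWithinAt.congr_deriv h ?_
  rw [dV_otx hS p, hS.nullStructure.lO_v u v x p.u p.v p.x]
  simp
  field_simp
  ring

/-- The weights make the β and β_F terms of `rho` and `etab` cancel, and the τ-Laplacian with weight
r²/Ω² cancels the Laplacian of `om`. No angular derivative survives, so X can be paired with λ. -/
theorem hasDerivWithinAt_X (hS : G.IsSolution S) (p : G.Pt u v x) :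
    HasDerivWithinAt (fun s => G.X S u s x ![]) ((6 * G.M - 8 * G.Q ^ 2 / G.r u v) * S.otx u v x ![]
      - 8 * G.Om u v ^ 2 * G.Q * S.rhoF u v x ![]) (Ici G.v₀) v := by
  have hr := p.r_ne
  have hO := p.Om_ne
  have rv := (hasDerivAt_r_v p.sub u v).hasDerivWithinAt (s := Ici G.v₀)
  have Ov := (hasDerivAt_Om_v p.sub u v).hasDerivWithinAt (s := Ici G.v₀)
  have h1 := hasDerivWithinAt_pi.1 (Smooth.hasDerivWithinAt_dV hS.smooth.rho p.u p.v p.x) ![]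
  have h2 := hasDerivWithinAt_pi.1
    (Smooth.hasDerivWithinAt_dV hS.smooth.etab.1.sdiv p.u p.v p.x) ![]
  have h3 := hasDerivWithinAt_pi.1 (Smooth.hasDerivWithinAt_dV
    (Smooth.nabla hS.smooth.otx).sdiv p.u p.v p.x) ![]
  have h := ((((rv.fun_pow 3).const_mul 2).fun_mul h1).fun_sub
    (((rv.fun_pow 2).const_mul 2).fun_mul h2)).fun_add
    (((rv.fun_pow 2).fun_div (Ov.fun_pow 2) (pow_ne_zero 2 hO)).fun_mul h3)
  refine HasDerivWithinAt.congr_deriv (h.congr (fun s hs => ?_) ?_) ?_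
  · rw [X_eq ⟨p.sub, p.u, hs, p.x⟩]; rfl
  · rw [X_eq p]; rfl
  rw [dV_rho hS p, dV_sdiv_etab hS p, dV_lap_otx hS p]
  simp only [Pi.add_apply, Pi.sub_apply, Pi.smul_apply, smul_eq_mul, neg_smul, Pi.neg_apply,
    rho, rhoF, Nat.cast_ofNat, Nat.add_one_sub_one, pow_one]
  field_simp
  ring

/-- The integrand of `masterDensity`. -/
def masterField (G : Geom) (S : Pert) (u v : ℝ) (x : E3) : ℝ :=
  (tsq (S.chi u v x)
    + tsq ((S.etab - (1 / 2) ⊙ G.rnab ((G.Om ^ 2)⁻¹ ⊙ S.otx)) u v x)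
    + tsq (S.betaF u v x) + tsq (S.sigmaF u v x)
    + tsq ((S.rhoF - (fun u v => G.Q / G.r u v ^ 2) ⊙ G.lam S) u v x))
      * (G.Om u v ^ 2 * G.r u v ^ 2)

theorem masterField_eq (p : G.Pt u v x) : masterField G S u v x =
    (G.Om u v * G.r u v) ^ 2 * (tsq (S.chi u v x)
      + tsq (S.etab u v x - (1 / (2 * G.Om u v ^ 2)) • nabla (S.otx u v) x)
      + tsq (S.betaF u v x) + tsq (S.sigmaF u v x)
      + (S.rhoF u v x ![] - G.Q / G.r u v ^ 2 * G.lam S u v x ![]) ^ 2) := by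
  have hr := p.r_ne
  have e : (S.etab - (1 / 2) ⊙ G.rnab ((G.Om ^ 2)⁻¹ ⊙ S.otx)) u v x =
      S.etab u v x - (1 / (2 * G.Om u v ^ 2)) • nabla (S.otx u v) x := by
    have h := nabla_const_smul (G.Om u v ^ 2)⁻¹ (S.otx u v) x
    have h' : (S.etab - (1 / 2) ⊙ G.rnab ((G.Om ^ 2)⁻¹ ⊙ S.otx)) u v x = S.etab u v x -
      (1 / 2 : ℝ) • G.r u v • (G.r u v)⁻¹ • nabla (fun y => (G.Om u v ^ 2)⁻¹ • S.otx u v y) x := rfl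
    rw [h', h, smul_smul (G.r u v), mul_inv_cancel₀ hr, one_smul, smul_smul]
    congr 2
    ring
  have e2 : tsq ((S.rhoF - (fun u v => G.Q / G.r u v ^ 2) ⊙ G.lam S) u v x) =
      (S.rhoF u v x ![] - G.Q / G.r u v ^ 2 * G.lam S u v x ![]) ^ 2 := tsq_zero_rank _
  rw [masterField, e, e2]
  ring

theorem famSmooth_masterField (hM : |G.Q| < G.M) (hS : G.IsSolution S) :
    FamSmooth G.Reg fun q => masterField G S q.1 q.2 := by
  have cO := contDiffOn_Om (G := G) hM
  have cr := contDiffOn_r (G := G) hM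
  have sm := hS.smooth
  have h1 : G.Smooth ((1 / 2) ⊙ G.rnab ((G.Om ^ 2)⁻¹ ⊙ S.otx)) :=
    Smooth.mulF (c := 1 / 2) (contDiffOn_const (c := (1 / 2 : ℝ))) (Smooth.mulF cr (Smooth.mulF (c := G.r⁻¹)
      (cr.inv fun q _ => (r_pos hM _ _).ne') (Smooth.nabla (Smooth.mulF (c := (G.Om ^ 2)⁻¹)
        ((cO.pow 2).inv fun q _ => pow_ne_zero 2 (Om_pos hM _ _).ne') sm.otx))))
  have h2 : G.Smooth ((fun u v => G.Q / G.r u v ^ 2) ⊙ G.lam S) :=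
    Smooth.mulF (contDiffOn_const.div (cr.pow 2) fun q _ => pow_ne_zero 2 (r_pos hM _ _).ne')
      (smooth_lam hM hS)
  exact (((((smooth_iff.1 sm.chi.1).tsq.add (smooth_iff.1 (Smooth.sub sm.etab.1 h1)).tsq).add
    (smooth_iff.1 sm.betaF.1).tsq).add (smooth_iff.1 sm.sigmaF).tsq).add
    (smooth_iff.1 (Smooth.sub sm.rhoF h2)).tsq).mul
    (famSmooth_of_contDiffOn ((cO.pow 2).mul (cr.pow 2)))

/-- The potential whose `v`-derivative completes the canonical energy density to a sum of squares. -/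
def psi (G : Geom) (S : Pert) (δ : ℝ) (u v : ℝ) (x : E3) : ℝ :=
  -(1 / 2) * (G.lam S u v x ![] * G.X S u v x ![]
    + 1 / 2 * (6 * G.M - 8 * G.Q ^ 2 / G.r u v) * G.lam S u v x ![] ^ 2)
  + (G.X S u v x ![] + (6 * G.M - 8 * G.Q ^ 2 / G.r u v) * G.lam S u v x ![]) ^ 2
    / (4 * (6 * G.M - 8 * G.Q ^ 2 / ((1 - δ) * G.r u v)))

/-- Completion of squares. The bracketed terms have zero mean and exchange ⟨η̲, ∇τ⟩ and |∇τ|² for τ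
div η̲ and τΔτ, producing the square of η̲ - ∇τ/(2Ω²). The remaining τX/2 becomes -½∂_v(λX + ½mλ²)
plus exactly the terms that complete `rhoF`² to g². The v-derivative of Y²/(4m_δ) is -4Ω²Qgy -
2Ω²Q²y²/((1-δ)r²) with y = Y/m_δ, which a fraction 1 - δ of 2Ω²r²g² absorbs. -/
theorem outField_ge (hS : G.IsSolution S) (p : G.Pt u v x) {δ : ℝ} (h0 : 0 ≤ δ) (h1 : δ < 1)
    (hm : 0 < 6 * G.M - 8 * G.Q ^ 2 / ((1 - δ) * G.r u v)) :
    ∃ a, HasDerivWithinAt (fun s => psi G S δ u s x) a (Ici G.v₀) v ∧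
      δ * masterField G S u v x + a
        + (2 * G.r u v ^ 2 * (S.otx u v x ![] * sdiv (S.etab u v) x ![]
            + tinner (S.etab u v x) (nabla (S.otx u v) x))
          + -(G.r u v ^ 2 / (2 * G.Om u v ^ 2)) *
            (S.otx u v x ![] * sdiv (nabla (S.otx u v)) x ![]
              + tinner (nabla (S.otx u v) x) (nabla (S.otx u v) x)))
        ≤ outField G S u v x := by
  have hr := p.r_ne
  have hO := p.Om_ne
  have hd : 1 - δ ≠ 0 := by linarith
  have hdp : 0 < 1 - δ := by linarith
  have rv := (hasDerivAt_r_v p.sub u v).hasDerivWithinAt (s := Ici G.v₀)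
  have hl := hasDerivWithinAt_lam hS p
  have hX := hasDerivWithinAt_X hS p
  have m1 := ((hasDerivWithinAt_const v (Ici G.v₀) (8 * G.Q ^ 2)).fun_div rv hr).const_sub (6 * G.M)
  have m2 := ((((hasDerivWithinAt_const v (Ici G.v₀) (8 * G.Q ^ 2)).fun_div (rv.const_mul (1 - δ))
    (mul_ne_zero hd hr))).const_sub (6 * G.M)).const_mul 4
  have hp := (((hl.fun_mul hX).fun_add ((m1.const_mul (1 / 2)).fun_mul (hl.fun_pow 2))).const_mul
    (-(1 / 2))).fun_add (((hX.fun_add (m1.fun_mul hl)).fun_pow 2).fun_div m2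
      (mul_ne_zero four_ne_zero hm.ne'))
  refine ⟨_, hp, ?_⟩
  rw [masterField_eq p, outField_eq p]
  set md := 6 * G.M - 8 * G.Q ^ 2 / ((1 - δ) * G.r u v) with hmd
  have hX' : G.X S u v x ![] = 2 * G.r u v ^ 3 * S.rho u v x ![]
    - 2 * G.r u v ^ 2 * sdiv (S.etab u v) x ![]
    + G.r u v ^ 2 / G.Om u v ^ 2 * sdiv (nabla (S.otx u v)) x ![] := by rw [X_eq p]; rfl
  set l := G.lam S u v x ![]
  -- The curvature is eliminated in favour of X, the quantity with a derivative-free transport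
  -- equation.
  have hXi : S.rho u v x ![] = (G.X S u v x ![] + 2 * G.r u v ^ 2 * sdiv (S.etab u v) x ![]
    - G.r u v ^ 2 / G.Om u v ^ 2 * sdiv (nabla (S.otx u v)) x ![]) / (2 * G.r u v ^ 3) := by
    rw [hX']; field_simp; ring
  set Y := G.X S u v x ![]
  set t := S.otx u v x ![]
  set c := tsq (S.chi u v x) with hc
  have hc0 : 0 ≤ c := tsq_nonneg _
  set bF := tsq (S.betaF u v x) with hbF
  have hb0 : 0 ≤ bF := tsq_nonneg _
  have e1 : tsq (S.sigmaF u v x) = S.sigmaF u v x ![] ^ 2 := tsq_zero_rank _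
  have e2 : tsq (S.rhoF u v x) = S.rhoF u v x ![] ^ 2 := tsq_zero_rank _
  have e3 : tsq (S.etab u v x - (1 / (2 * G.Om u v ^ 2)) • nabla (S.otx u v) x) =
      tsq (S.etab u v x) - 1 / G.Om u v ^ 2 * tinner (S.etab u v x) (nabla (S.otx u v) x)
      + 1 / (4 * G.Om u v ^ 4) * tinner (nabla (S.otx u v) x) (nabla (S.otx u v) x) := by
    simp only [tsq, tinner_sub_left, tinner_sub_right, tinner_smul_left, tinner_smul_right]
    rw [tinner_comm (nabla (S.otx u v) x) (S.etab u v x)]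
    field_simp
    ring
  have h30 := tsq_nonneg (S.etab u v x - (1 / (2 * G.Om u v ^ 2)) • nabla (S.otx u v) x)
  rw [e3] at h30 ⊢
  rw [e1, e2]
  simp only [mulF, tsq_smul, tinner_zero, Pi.add_apply, Pi.smul_apply, smul_eq_mul, hXi, ← hc]
  set y := (Y + (6 * G.M - 8 * G.Q ^ 2 / G.r u v) * l) / md with hy
  set g := S.rhoF u v x ![] - G.Q / G.r u v ^ 2 * l with hg
  have hR : S.rhoF u v x ![] = g + G.Q / G.r u v ^ 2 * l := by rw [hg]; ring
  have hYy : Y = y * md - (6 * G.M - 8 * G.Q ^ 2 / G.r u v) * l := by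
    rw [hy]; field_simp; ring
  set sF := S.sigmaF u v x ![]
  set eN := tinner (S.etab u v x) (nabla (S.otx u v) x)
  set NN := tinner (nabla (S.otx u v) x) (nabla (S.otx u v) x)
  set ee := tsq (S.etab u v x)
  -- This is the exact surplus of the inequality. The last square is (1-δ)·2Ω²r²g² completed by the
  -- terms from ∂_v(Y²/(4m_δ)); the other g² term is what remains after subtracting δ times the
  -- master density.
  have pos : 0 ≤ (G.Om u v * G.r u v) ^ 2 * ((1 - δ) * c
      + (2 - δ) * (ee - 1 / G.Om u v ^ 2 * eN + 1 / (4 * G.Om u v ^ 4) * NN)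
      + (2 - δ) * bF + (2 - δ) * sF ^ 2 + δ * g ^ 2)
      + 2 * G.Om u v ^ 2 * (1 - δ) * (G.r u v * g + G.Q * y / ((1 - δ) * G.r u v)) ^ 2 := by
    have : 0 ≤ 2 - δ := by linarith
    positivity
  have hM : G.M = (md + 8 * G.Q ^ 2 / ((1 - δ) * G.r u v)) / 6 := by rw [hmd]; ring
  clear_value md y g l Y
  refine le_of_sub_nonneg (pos.trans_eq ?_)
  subst hYy
  rw [hR]
  have hm0 := hm.ne'
  simp only [hM, Nat.cast_ofNat, Nat.add_one_sub_one, pow_one, zero_mul, zero_sub]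
  field_simp
  ring

/-- The negative square hidden in the first part of `psi` has coefficient 1/(4m), while the added
one has 1/(4m_δ); since m_δ ≤ m ≤ 6M the sum is at least X²/(4m). -/
theorem psi_ge (hM : |G.Q| < G.M) {δ : ℝ} (h0 : 0 ≤ δ) (h1 : δ < 1)
    (hm : 0 < 6 * G.M - 8 * G.Q ^ 2 / ((1 - δ) * G.r u v)) :
    G.X S u v x ![] ^ 2 / (24 * G.M) ≤ psi G S δ u v x := by
  have hr := r_pos hM u v
  have hM0 : 0 < G.M := (abs_nonneg _).trans_lt hM
  have hle : 8 * G.Q ^ 2 / G.r u v ≤ 8 * G.Q ^ 2 / ((1 - δ) * G.r u v) := by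
    apply div_le_div_of_nonneg_left (by positivity) (mul_pos (by linarith) hr)
    nlinarith
  have hq : 0 ≤ 8 * G.Q ^ 2 / G.r u v := by positivity
  rw [psi]
  set md := 6 * G.M - 8 * G.Q ^ 2 / ((1 - δ) * G.r u v)
  set m := 6 * G.M - 8 * G.Q ^ 2 / G.r u v with hmm
  set Y := G.X S u v x ![]
  set l := G.lam S u v x ![]
  have hmp : 0 < m := by linarith
  have a1 : -(1 / 2) * (l * Y + 1 / 2 * m * l ^ 2) = Y ^ 2 / (4 * m) - (Y + m * l) ^ 2 / (4 * m) := by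
    field_simp; ring
  have a2 : (Y + m * l) ^ 2 / (4 * m) ≤ (Y + m * l) ^ 2 / (4 * md) :=
    div_le_div_of_nonneg_left (sq_nonneg _) (by linarith) (by linarith)
  have a3 : Y ^ 2 / (24 * G.M) ≤ Y ^ 2 / (4 * m) :=
    div_le_div_of_nonneg_left (sq_nonneg _) (by linarith) (by linarith)
  linarith

/-- Controls the potential at the corner (u₁, v₀) by data. The term 1/4 bounds -½λX, the term -¼mλ²
is dropped, and the rest uses m ≤ 6M together with m_δ ≥ c. -/
theorem psi_le (hM : |G.Q| < G.M) {δ c : ℝ} (h0 : 0 ≤ δ) (h1 : δ < 1) (hc : 0 < c)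
    (hm : c ≤ 6 * G.M - 8 * G.Q ^ 2 / ((1 - δ) * G.r u v)) :
    psi G S δ u v x ≤ (1 / 4 + (1 + 36 * G.M ^ 2) / (2 * c))
      * (G.lam S u v x ![] ^ 2 + G.X S u v x ![] ^ 2) := by
  have hr := r_pos hM u v
  have hM0 : 0 < G.M := (abs_nonneg _).trans_lt hM
  have hle : 8 * G.Q ^ 2 / G.r u v ≤ 8 * G.Q ^ 2 / ((1 - δ) * G.r u v) := by
    apply div_le_div_of_nonneg_left (by positivity) (mul_pos (by linarith) hr)
    nlinarith
  have hq : 0 ≤ 8 * G.Q ^ 2 / G.r u v := by positivity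
  rw [psi]
  set md := 6 * G.M - 8 * G.Q ^ 2 / ((1 - δ) * G.r u v)
  set m := 6 * G.M - 8 * G.Q ^ 2 / G.r u v with hmm
  set Y := G.X S u v x ![]
  set l := G.lam S u v x ![]
  have hmp : 0 < m := by linarith
  have hmM : m ≤ 6 * G.M := by linarith
  have a2 : (Y + m * l) ^ 2 / (4 * md) ≤ (Y + m * l) ^ 2 / (4 * c) :=
    div_le_div_of_nonneg_left (sq_nonneg _) (by linarith) (by linarith)
  have a4 : m ^ 2 ≤ 36 * G.M ^ 2 := by nlinarith
  have a5 : (Y + m * l) ^ 2 ≤ 2 * (1 + 36 * G.M ^ 2) * (l ^ 2 + Y ^ 2) := by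
    nlinarith [sq_nonneg (Y - m * l), mul_le_mul_of_nonneg_right a4 (sq_nonneg l), sq_nonneg l,
      mul_nonneg (sq_nonneg G.M) (sq_nonneg Y)]
  have a6 : (Y + m * l) ^ 2 / (4 * c) ≤ (1 + 36 * G.M ^ 2) / (2 * c) * (l ^ 2 + Y ^ 2) := by
    rw [div_mul_eq_mul_div, div_le_div_iff₀ (by positivity) (by positivity)]
    nlinarith [mul_le_mul_of_nonneg_right a5 (show 0 ≤ 2 * c by linarith)]
  nlinarith [sq_nonneg (l + Y), mul_nonneg hmp.le (sq_nonneg l)]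

/-- Below the charge threshold the coefficient occurring in the potential is uniformly positive. -/
theorem exists_coercivity {M Q : ℝ} (hQ : |Q| < √15 / 4 * M) : |Q| < M ∧ ∃ δ c : ℝ, 0 < δ ∧ δ < 1 ∧
    0 < c ∧ ∀ r, rPlus M Q < r → c ≤ 6 * M - 8 * Q ^ 2 / ((1 - δ) * r) := by
  have h15 : √15 ^ 2 = 15 := Real.sq_sqrt (by norm_num)
  have h15' : 0 < √15 := by positivity
  have hM : 0 < M := by
    by_contra h
    nlinarith [abs_nonneg Q]
  have hq : Q ^ 2 < 15 / 16 * M ^ 2 := by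
    have := mul_self_lt_mul_self (abs_nonneg Q) hQ
    rw [abs_mul_abs_self] at this
    nlinarith
  -- The charge threshold enters here: Q² < 15M²/16 makes √(M² - Q²) exceed M/4, so r₊ > 5M/4 and 6M
  -- r₊ > 15M²/2 > 8Q².
  have hs : M / 4 < √(M ^ 2 - Q ^ 2) := Real.lt_sqrt_of_sq_lt (by nlinarith)
  have hp : 5 * M / 4 < rPlus M Q := by unfold rPlus; linarith
  have hp0 : 0 < rPlus M Q := by linarith
  set k := 8 * Q ^ 2 / rPlus M Q with hk
  have hk0 : 0 ≤ k := by positivity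
  have hk1 : k < 6 * M := by
    rw [hk, div_lt_iff₀ hp0]; nlinarith
  -- With k = 8Q²/r₊ < 6M, this δ gives 1 - δ = (k + 6M)/(12M), the average of k/(6M) and 1. Then
  -- k/(1 - δ) < 6M, and c is the gap, attained in the limit r → r₊.
  refine ⟨abs_lt_of_sq_lt_sq (by nlinarith) hM.le, (6 * M - k) / (12 * M),
    6 * M - k / ((k + 6 * M) / (12 * M)), by apply div_pos <;> linarith, ?_, ?_, fun r hr => ?_⟩
  · rw [div_lt_one (by positivity)]; linarith
  · rw [sub_pos, div_lt_iff₀ (by positivity)]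
    field_simp
    linarith
  · have e : 1 - (6 * M - k) / (12 * M) = (k + 6 * M) / (12 * M) := by field_simp; ring
    rw [e]
    have hw : 0 < (k + 6 * M) / (12 * M) := by positivity
    have : 8 * Q ^ 2 / ((k + 6 * M) / (12 * M) * r) ≤ k / ((k + 6 * M) / (12 * M)) := by
      rw [mul_comm ((k + 6 * M) / (12 * M)), ← div_div]
      apply div_le_div_of_nonneg_right _ hw.le
      exact div_le_div_of_nonneg_left (by positivity) hp0 hr.le
    linarith

theorem famSmooth_psi (hM : |G.Q| < G.M) (hS : G.IsSolution S) {δ : ℝ} (h1 : δ < 1)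
    (hm : ∀ u v, 6 * G.M - 8 * G.Q ^ 2 / ((1 - δ) * G.r u v) ≠ 0) :
    FamSmooth G.Reg fun q => psi G S δ q.1 q.2 := by
  have cr := contDiffOn_r (G := G) hM
  have hr : ∀ u v, G.r u v ≠ 0 := fun u v => (r_pos hM u v).ne'
  have c1 : ContDiffOn ℝ ∞ (fun q : ℝ × ℝ => 6 * G.M - 8 * G.Q ^ 2 / G.r q.1 q.2) G.Reg :=
    contDiffOn_const.sub (contDiffOn_const.div cr fun q _ => hr _ _)
  have c2 : ContDiffOn ℝ ∞ (fun q : ℝ × ℝ =>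
      (4 * (6 * G.M - 8 * G.Q ^ 2 / ((1 - δ) * G.r q.1 q.2)))⁻¹) G.Reg :=
    (contDiffOn_const.mul (contDiffOn_const.sub (contDiffOn_const.div (contDiffOn_const.mul cr)
      fun q _ => mul_ne_zero (by linarith) (hr _ _)))).inv
      fun q _ => mul_ne_zero four_ne_zero (hm _ _)
  have hl := (smooth_iff.1 (smooth_lam hM hS)).apply ![]
  have hX := (smooth_iff.1 (smooth_X hM hS)).apply ![]
  have s1 := (((hl.mul hX).add ((hl.mul hl).const_mul ((contDiffOn_const (c := (1 / 2 : ℝ))).mul c1))).const_mul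
    (c := fun _ => -(1 / 2 : ℝ)) contDiffOn_const).add
    (((hX.add (hl.const_mul c1)).mul (hX.add (hl.const_mul c1))).const_mul c2)
  refine s1.congr fun q _ x _ => ?_
  simp only [psi]
  ring

theorem tangential_nabla {f : E3 → Tensor 0} (hf : SphSmooth f) : Tangential (nabla f) := by
  intro x hx
  have hx0 := ne_zero_of_norm_one hx
  have h := sum_smul_dd hf hx0
  have := congrFun h ![]
  simpa [nabla_zero_apply hf hx0] using this

/-- Coercivity of the canonical energy on outgoing cones up to boundary terms. -/
theorem integral_outDensity_ge (hM : |G.Q| < G.M) (hS : G.IsSolution S) {δ : ℝ} (h0 : 0 ≤ δ)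
    (h1 : δ < 1) (hm : ∀ u v, 0 < 6 * G.M - 8 * G.Q ^ 2 / ((1 - δ) * G.r u v)) {u v : ℝ}
    (hu : G.u₀ ≤ u) (hv : G.v₀ ≤ v) :
    δ * (∫ s in G.v₀..v, G.masterDensity S u s) + sphInt (psi G S δ u v)
      - sphInt (psi G S δ u G.v₀) ≤ ∫ s in G.v₀..v, G.outDensity S u s := by
  have fp := famSmooth_psi hM hS h1 fun u v => (hm u v).ne'
  have fd := famSmooth_derivV fp
  have fm := famSmooth_masterField hM hS
  have fo := famSmooth_outField hM hS
  rw [add_sub_assoc, sphInt_sub_v fp hu hv, ← intervalIntegral.integral_const_mul,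
    ← intervalIntegral.integral_add]
  rotate_left
  · exact (intervalIntegrable_sphInt_v fm hu hv).const_mul δ
  · exact intervalIntegrable_sphInt_v
      (f := fun u v x => derivWithin (fun s => psi G S δ u s x) (Ici G.v₀) v) fd hu hv
  refine intervalIntegral.integral_mono_on hv
    (((intervalIntegrable_sphInt_v fm hu hv).const_mul δ).add (intervalIntegrable_sphInt_v
      (f := fun u v x => derivWithin (fun s => psi G S δ u s x) (Ici G.v₀) v) fd hu hv))
    (intervalIntegrable_sphInt_v fo hu hv) fun s hs => ?_
  have sm := hS.smooth
  have c1 := continuousOn_S2 fm hu hs.1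
  have c2 := continuousOn_S2
    (f := fun u v x => derivWithin (fun s => psi G S δ u s x) (Ici G.v₀) v) fd hu hs.1
  have c3 := continuousOn_S2 fo hu hs.1
  have z1 := sphNull_mul_sdiv_add (sm.otx.slice hu hs.1) (Smooth.slice sm.etab.1 hu hs.1)
    (fun x hx => sm.etab.2 u s x hu hs.1 hx)
  have z2 := sphNull_mul_sdiv_add (sm.otx.slice hu hs.1)
    (Smooth.slice (Smooth.nabla sm.otx) hu hs.1) (tangential_nabla (sm.otx.slice hu hs.1))
  -- The correction in `outField_ge` is a combination of two divergences, so it disappears on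
  -- integrating over the sphere.
  have z := (z1.const_mul (2 * G.r u s ^ 2)).add (z2.const_mul (-(G.r u s ^ 2 / (2 * G.Om u s ^ 2))))
  have i1 := (integrable_sphere_of_continuousOn c1).const_mul δ
  have i2 := integrable_sphere_of_continuousOn c2
  have i3 := integrable_sphere_of_continuousOn c3
  have key := integral_mono ((i1.add i2).add z.1) i3 fun x => by
    have hx : ‖(x : E3)‖ = 1 := by simp
    obtain ⟨a, ha, hle⟩ := outField_ge hS ⟨hM, hu, hs.1, hx⟩ h0 h1 (hm u s)
    rw [← ha.derivWithin (uniqueDiffOn_Ici _ _ hs.1)] at hle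
    exact hle
  rw [integral_add' (i1.add i2) z.1, integral_add' i1 i2, integral_const_mul] at key
  have hz := z.2
  rw [sphInt] at hz
  rw [hz, add_zero] at key
  exact key

end Geom

/-! ## Bounds on strips -/

theorem sq_le_tsq {n : ℕ} (A : Tensor n) (I : Fin n → Fin 3) : A I ^ 2 ≤ tsq A := by
  rw [sq]
  exact Finset.single_le_sum (f := fun J => A J * A J) (fun _ _ => mul_self_nonneg _)
    (Finset.mem_univ I)

theorem abs_tinner_le {n : ℕ} (A B : Tensor n) : |tinner A B| ≤ (tsq A + tsq B) / 2 := by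
  have h1 := tsq_nonneg (A + B)
  have h2 := tsq_nonneg (A - B)
  simp only [tsq, tinner_add_left, tinner_add_right, tinner_sub_left, tinner_sub_right,
    tinner_comm B A] at h1 h2 ⊢
  rw [abs_le]
  constructor <;> linarith

namespace Geom

variable {G : Geom} {S : Pert} {u v u₁ : ℝ} {x : E3}

/-- Boundedness on the strip `[u₀, u₁] × {v ≥ v₀} × S²`. -/
def Bdd (G : Geom) (u₁ : ℝ) (f : ℝ → ℝ → E3 → ℝ) : Prop :=
  ∃ C : ℝ, ∀ u v x, u ∈ Icc G.u₀ u₁ → G.v₀ ≤ v → ‖x‖ = 1 → |f u v x| ≤ C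

namespace Bdd

variable {f g : ℝ → ℝ → E3 → ℝ}

theorem congr (hf : G.Bdd u₁ f)
    (h : ∀ u v x, u ∈ Icc G.u₀ u₁ → G.v₀ ≤ v → ‖x‖ = 1 → g u v x = f u v x) : G.Bdd u₁ g := by
  obtain ⟨C, hC⟩ := hf
  exact ⟨C, fun u v x hu hv hx => by rw [h u v x hu hv hx]; exact hC u v x hu hv hx⟩

theorem of_abs_le (hf : G.Bdd u₁ f)
    (h : ∀ u v x, u ∈ Icc G.u₀ u₁ → G.v₀ ≤ v → ‖x‖ = 1 → |g u v x| ≤ f u v x) :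
    G.Bdd u₁ g := by
  obtain ⟨C, hC⟩ := hf
  exact ⟨C, fun u v x hu hv hx =>
    (h u v x hu hv hx).trans ((le_abs_self _).trans (hC u v x hu hv hx))⟩

theorem const (c : ℝ) : G.Bdd u₁ fun _ _ _ => c := ⟨|c|, fun _ _ _ _ _ _ => le_rfl⟩

theorem add (hf : G.Bdd u₁ f) (hg : G.Bdd u₁ g) : G.Bdd u₁ fun u v x => f u v x + g u v x := by
  obtain ⟨C, hC⟩ := hf
  obtain ⟨D, hD⟩ := hg
  exact ⟨C + D, fun u v x hu hv hx =>
    (abs_add_le _ _).trans (add_le_add (hC u v x hu hv hx) (hD u v x hu hv hx))⟩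

theorem mul (hf : G.Bdd u₁ f) (hg : G.Bdd u₁ g) : G.Bdd u₁ fun u v x => f u v x * g u v x := by
  obtain ⟨C, hC⟩ := hf
  obtain ⟨D, hD⟩ := hg
  exact ⟨C * D, fun u v x hu hv hx => by
    rw [abs_mul]
    exact mul_le_mul (hC u v x hu hv hx) (hD u v x hu hv hx) (abs_nonneg _)
      ((abs_nonneg _).trans (hC u v x hu hv hx))⟩

theorem const_mul (hf : G.Bdd u₁ f) (c : ℝ) : G.Bdd u₁ fun u v x => c * f u v x :=
  (const c).mul hf

theorem sub (hf : G.Bdd u₁ f) (hg : G.Bdd u₁ g) : G.Bdd u₁ fun u v x => f u v x - g u v x :=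
  (hf.add (hg.const_mul (-1))).congr fun _ _ _ _ _ _ => by ring

theorem tinner {n : ℕ} {A B : SField n} (hA : G.Bdd u₁ fun u v x => tsq (A u v x))
    (hB : G.Bdd u₁ fun u v x => tsq (B u v x)) :
    G.Bdd u₁ fun u v x => RN.tinner (A u v x) (B u v x) :=
  ((hA.add hB).const_mul (1 / 2)).of_abs_le fun _ _ _ _ _ _ =>
    (abs_tinner_le _ _).trans_eq (by ring)

theorem apply {n : ℕ} {A : SField n} (hA : G.Bdd u₁ fun u v x => tsq (A u v x))
    (I : Fin n → Fin 3) : G.Bdd u₁ fun u v x => A u v x I := by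
  refine (hA.add (const 1)).of_abs_le fun u v x _ _ _ => ?_
  have := sq_le_tsq (A u v x) I
  rw [abs_le]
  constructor <;> nlinarith

theorem tsq_zero {A : SField 0} (hA : G.Bdd u₁ fun u v x => A u v x ![]) :
    G.Bdd u₁ fun u v x => tsq (A u v x) :=
  (hA.mul hA).congr fun _ _ _ _ _ _ => by rw [tsq_zero_rank, sq]

theorem tsq_sub {n : ℕ} {A B : SField n} (hA : G.Bdd u₁ fun u v x => tsq (A u v x))
    (hB : G.Bdd u₁ fun u v x => tsq (B u v x)) :
    G.Bdd u₁ fun u v x => tsq (A u v x - B u v x) :=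
  ((hA.add hB).sub ((tinner hA hB).const_mul 2)).congr fun u v x _ _ _ => by
    simp only [tsq, tinner_sub_left, tinner_sub_right, tinner_comm (B u v x) (A u v x)]
    ring

theorem tsq_smul {n : ℕ} {A : SField n} (hf : G.Bdd u₁ f)
    (hA : G.Bdd u₁ fun u v x => tsq (A u v x)) :
    G.Bdd u₁ fun u v x => tsq (f u v x • A u v x) :=
  ((hf.mul hf).mul hA).congr fun u v x _ _ _ => by rw [RN.tsq_smul, sq]

end Bdd

theorem bdd_inv_r (hM : |G.Q| < G.M) : G.Bdd u₁ fun u v _ => (G.r u v)⁻¹ := by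
  refine ⟨(rPlus G.M G.Q)⁻¹, fun u v x _ _ _ => ?_⟩
  have := r_gt hM u v
  rw [abs_of_pos (inv_pos.2 (r_pos hM u v))]
  exact inv_anti₀ (rPlus_pos hM) this.le

theorem bdd_Om (hM : |G.Q| < G.M) : G.Bdd u₁ fun u v _ => G.Om u v :=
  ⟨1, fun u v _ _ _ _ => by rw [abs_of_pos (Om_pos hM u v)]; exact Om_le_one hM u v⟩

/-- Ω decreases in u and increases in v, so its minimum over the strip is at (u₁, v₀). The bound
degenerates as u₁ → ∞, but strip bounds serve only convergence and vanishing errors, never the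
constant of the estimate. -/
theorem bdd_inv_Om (hM : |G.Q| < G.M) : G.Bdd u₁ fun u v _ => (G.Om u v)⁻¹ := by
  refine ⟨(G.Om u₁ G.v₀)⁻¹, fun u v x hu hv _ => ?_⟩
  rw [abs_of_pos (inv_pos.2 (Om_pos hM u v))]
  exact inv_anti₀ (Om_pos hM _ _) (Om_mono hM hu.2 hv)

section Decays

variable {n : ℕ} {T : SField n}

/-- Weights depending only on (u, v) commute with angular derivatives, and r∇ is the derivative of
the unit sphere. -/
theorem rnab_mulF (hM : |G.Q| < G.M) (c : ℝ → ℝ → ℝ) (T : SField n) :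
    G.rnab (c ⊙ T) = c ⊙ fun u v => nabla (T u v) := by
  funext u v x
  have h := nabla_const_smul (c u v) (T u v) x
  have h' : G.rnab (c ⊙ T) u v x =
    G.r u v • (G.r u v)⁻¹ • nabla (fun y => c u v • T u v y) x := rfl
  rw [h', h, smul_smul, mul_inv_cancel₀ (r_pos hM u v).ne', one_smul]
  rfl

theorem Decays.bdd_iter (h : G.Decays T) (i : ℕ) (hi : i ≤ 2) :
    G.Bdd u₁ fun u v x => tsq (G.rnabPow T i u v x) := by
  -- The decay assumption concerns strips with u₁ > u₀ strictly; enlarging the strip covers u₁ = u₀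
  -- as well.
  obtain ⟨C, hC⟩ := (h i 0 (by simpa using hi)).2 (max u₁ G.u₀ + 1)
    (by linarith [le_max_right u₁ G.u₀])
  refine ⟨C ^ 2, fun u v x hu hv hx => ?_⟩
  have := hC u v x ⟨hu.1, by linarith [hu.2, le_max_left u₁ G.u₀]⟩ hv hx
  rw [abs_of_nonneg (tsq_nonneg _)]
  exact (Real.sqrt_le_left ((Real.sqrt_nonneg _).trans this)).1 this

theorem Decays.bdd (h : G.Decays T) : G.Bdd u₁ fun u v x => tsq (T u v x) := h.bdd_iter 0 (by simp)

theorem Decays.bdd_scalar {T : SField 0} (h : G.Decays T) : G.Bdd u₁ fun u v x => T u v x ![] :=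
  Bdd.apply h.bdd _

theorem Decays.bdd_nabla (hM : |G.Q| < G.M) {c : ℝ → ℝ → ℝ} (h : G.Decays (c ⊙ T)) :
    G.Bdd u₁ fun u v x => tsq (c u v • nabla (T u v) x) := by
  have := h.bdd_iter (u₁ := u₁) 1 (by simp)
  exact this.congr fun u v x _ _ _ =>
    congrArg tsq (congrFun (congrFun (congrFun (rnab_mulF hM c T).symm u) v) x)

theorem rnab_rnab_mulF (hM : |G.Q| < G.M) (c : ℝ → ℝ → ℝ) (T : SField n) :
    G.rnab (G.rnab (c ⊙ T)) = c ⊙ fun u v => nabla (nabla (T u v)) := by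
  rw [rnab_mulF hM, rnab_mulF hM]

theorem sdiv_nabla_apply (f : E3 → Tensor 0) (x : E3) :
    sdiv (nabla f) x ![] = ∑ a, nabla (nabla f) x ![a, a] := rfl

theorem Decays.bdd_laplacian (hM : |G.Q| < G.M) {c : ℝ → ℝ → ℝ} {T : SField 0}
    (h : G.Decays (c ⊙ T)) : G.Bdd u₁ fun u v x => c u v * sdiv (nabla (T u v)) x ![] := by
  have h2 := h.bdd_iter (u₁ := u₁) 2 le_rfl
  have h3 : G.Bdd u₁ fun u v x => tsq (c u v • nabla (nabla (T u v)) x) := h2.congr fun u v x _ _ _ =>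
    congrArg tsq (congrFun (congrFun (congrFun (rnab_rnab_mulF hM c T).symm u) v) x)
  have h4 : ∀ a : Fin 3, G.Bdd u₁ fun u v x => c u v * nabla (nabla (T u v)) x ![a, a] :=
    fun a => Bdd.apply (A := fun u v x => c u v • nabla (nabla (T u v)) x) h3 ![a, a]
  refine (((h4 0).add (h4 1)).add (h4 2)).congr fun u v x _ _ _ => ?_
  rw [sdiv_nabla_apply, Fin.sum_univ_three]
  ring

theorem Decays.exists_tendsto (h : G.Decays T) (hu : G.u₀ ≤ u) (hx : ‖x‖ = 1) :
    ∃ L, Tendsto (fun v => T u v x) atTop (𝓝 L) := (h 0 0 (by simp)).1 u x hu hx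

theorem Decays.exists_tendsto_laplacian (hM : |G.Q| < G.M) {c : ℝ → ℝ → ℝ} {T : SField 0}
    (h : G.Decays (c ⊙ T)) (hu : G.u₀ ≤ u) (hx : ‖x‖ = 1) :
    ∃ L, Tendsto (fun v => c u v * sdiv (nabla (T u v)) x ![]) atTop (𝓝 L) := by
  obtain ⟨L, hL⟩ := (h 2 0 (by simp)).1 u x hu hx
  have h2 : Tendsto (fun v => c u v • nabla (nabla (T u v)) x) atTop (𝓝 L) :=
    hL.congr fun v => congrFun (congrFun (congrFun (rnab_rnab_mulF hM c T) u) v) x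
  refine ⟨∑ a, L ![a, a], ?_⟩
  have h3 := tendsto_finsetSum (Finset.univ : Finset (Fin 3)) fun a _ => (tendsto_pi_nhds.1 h2) ![a, a]
  refine h3.congr fun v => ?_
  rw [sdiv_nabla_apply, Finset.mul_sum]
  rfl

end Decays

/-- The bounds on strips that the decay assumptions provide, without derivatives in `u`, `v`. -/
structure StripBounds (G : Geom) (S : Pert) (u₁ : ℝ) : Prop where
  rho : G.Bdd u₁ fun u v x => G.r u v ^ 3 * S.rho u v x ![]
  K : G.Bdd u₁ fun u v x => G.r u v ^ 3 * S.K u v x ![]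
  otx : G.Bdd u₁ fun u v x => G.r u v ^ 2 * S.otx u v x ![]
  nabla_otx : G.Bdd u₁ fun u v x => tsq (G.r u v ^ 2 • nabla (S.otx u v) x)
  lap_otx : G.Bdd u₁ fun u v x => G.r u v ^ 2 * sdiv (nabla (S.otx u v)) x ![]
  otxb : G.Bdd u₁ fun u v x => G.r u v * S.otxb u v x ![]
  rhoF : G.Bdd u₁ fun u v x => G.r u v ^ 2 * S.rhoF u v x ![]
  sigmaF : G.Bdd u₁ fun u v x => G.r u v ^ 2 * S.sigmaF u v x ![]
  lO : G.Bdd u₁ fun u v x => S.lO u v x ![]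
  nabla_lO : G.Bdd u₁ fun u v x => tsq (nabla (S.lO u v) x)
  chi : G.Bdd u₁ fun u v x => tsq (G.r u v ^ 2 • S.chi u v x)
  etab : G.Bdd u₁ fun u v x => tsq (G.r u v ^ 2 • S.etab u v x)
  sdiv_etab : G.Bdd u₁ fun u v x => G.r u v ^ 2 * sdiv (S.etab u v) x ![]
  sdiv_eta : G.Bdd u₁ fun u v x => G.r u v * sdiv (S.eta u v) x ![]
  betaF : G.Bdd u₁ fun u v x => tsq (G.r u v ^ 2 • S.betaF u v x)
  chib : G.Bdd u₁ fun u v x => tsq (G.r u v • S.chib u v x)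
  betabF : G.Bdd u₁ fun u v x => tsq (G.r u v • S.betabF u v x)

theorem DecayAssumptions.stripBounds (hM : |G.Q| < G.M) (hD : G.DecayAssumptions S) :
    G.StripBounds S u₁ := by
  obtain ⟨s, hs, h⟩ := hD
  refine ⟨h.rho.bdd_scalar, h.K.bdd_scalar, h.otx.bdd_scalar, h.otx.bdd_nabla hM,
    h.otx.bdd_laplacian hM, h.otxb.bdd_scalar, h.rhoF.bdd_scalar, h.sigmaF.bdd_scalar,
    h.lO.bdd_scalar, ?_, h.chi.bdd, h.etab.bdd, ?_, ?_, ?_, h.chib.bdd, h.betabF.bdd⟩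
  · have e : (fun _ _ => (1 : ℝ)) ⊙ S.lO = S.lO := by
      funext u v x
      simp [mulF]
    have := h.lO
    rw [← e] at this
    exact (this.bdd_nabla hM).congr fun u v x _ _ _ => by rw [one_smul]
  · refine h.div_etab.bdd_scalar.congr fun u v x _ _ _ => ?_
    have hr := (r_pos hM u v).ne'
    simp [mulF, div]
    field_simp
  · refine h.div_eta.bdd_scalar.congr fun u v x _ _ _ => ?_
    have hr := (r_pos hM u v).ne'
    simp [mulF, div]
    field_simp
  -- The extra decay r^{-s} is not needed: r^s is bounded below by r₊^s, so the weight r^{2+s} can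
  -- be lowered to r².
  · have hb : G.Bdd u₁ fun u v x => (G.r u v ^ s)⁻¹ := by
      refine ⟨(rPlus G.M G.Q ^ s)⁻¹, fun u v x _ _ _ => ?_⟩
      have h1 := rPlus_pos hM
      have h2 := Real.rpow_pos_of_pos h1 s
      have h3 := Real.rpow_le_rpow h1.le (r_gt hM u v).le hs.1.le
      rw [abs_of_pos (inv_pos.2 (h2.trans_le h3))]
      exact inv_anti₀ h2 h3
    refine (hb.tsq_smul h.betaF.bdd).congr fun u v x _ _ _ => ?_
    have hr := r_pos hM u v
    simp only [mulF, rpw, smul_smul]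
    rw [Real.rpow_add hr, mul_comm, mul_assoc, mul_inv_cancel₀ (Real.rpow_pos_of_pos hr s).ne',
      mul_one, Real.rpow_two]

end Geom

namespace Geom

variable {G : Geom} {S : Pert} {u v u₁ : ℝ} {x : E3}

/-! ## Limits at null infinity -/

theorem bdd_lam (hM : |G.Q| < G.M) (h : G.StripBounds S u₁) :
    G.Bdd u₁ fun u v x => G.lam S u v x ![] := by
  have i := bdd_inv_Om (u₁ := u₁) hM
  refine ((((i.mul i).mul (bdd_inv_r hM)).mul h.otx).sub (h.lO.const_mul 4)).congr
    fun u v x _ _ _ => ?_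
  have hr := (r_pos hM u v).ne'
  have hO := (Om_pos hM u v).ne'
  rw [lam_eq]
  simp
  field_simp

theorem bdd_X (hM : |G.Q| < G.M) (h : G.StripBounds S u₁) :
    G.Bdd u₁ fun u v x => G.X S u v x ![] := by
  have i := bdd_inv_Om (u₁ := u₁) hM
  refine (((h.rho.const_mul 2).sub (h.sdiv_etab.const_mul 2)).add ((i.mul i).mul h.lap_otx)).congr
    fun u v x hu hv hx => ?_
  have hr := (r_pos hM u v).ne'
  have hO := (Om_pos hM u v).ne'
  rw [X_eq ⟨hM, hu.1, hv, hx⟩]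
  simp
  field_simp

theorem bdd_outField (hM : |G.Q| < G.M) (h : G.StripBounds S u₁) :
    G.Bdd u₁ fun u v x => G.r u v ^ 2 * outField G S u v x := by
  have o := bdd_Om (u₁ := u₁) hM
  refine (((o.mul o).mul (h.chi.add ((((h.etab.add h.betaF).add
    (Bdd.tsq_zero (A := fun u v x => G.r u v ^ 2 • S.sigmaF u v x) h.sigmaF)).add
    (Bdd.tsq_zero (A := fun u v x => G.r u v ^ 2 • S.rhoF u v x) h.rhoF)).const_mul 2))).add
    (h.otx.mul (h.rho.add h.sdiv_etab))).congr fun u v x hu hv hx => ?_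
  rw [outField_eq ⟨hM, hu.1, hv, hx⟩]
  simp only [tsq_smul, mulF, tinner_zero, Pi.add_apply, Pi.smul_apply, smul_eq_mul]
  ring

theorem bdd_masterField (hM : |G.Q| < G.M) (h : G.StripBounds S u₁) :
    G.Bdd u₁ fun u v x => G.r u v ^ 2 * masterField G S u v x := by
  have o := bdd_Om (u₁ := u₁) hM
  have i := bdd_inv_Om (u₁ := u₁) hM
  have g := h.rhoF.sub ((bdd_lam hM h).const_mul G.Q)
  refine ((o.mul o).mul ((((h.chi.add (Bdd.tsq_sub h.etab (Bdd.tsq_smul (i.mul i)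
    (Bdd.tsq_smul (Bdd.const (1 / 2)) h.nabla_otx)))).add h.betaF).add
    (Bdd.tsq_zero (A := fun u v x => G.r u v ^ 2 • S.sigmaF u v x) h.sigmaF)).add
    (g.mul g))).congr fun u v x hu hv hx => ?_
  have hr := (r_pos hM u v).ne'
  have hO := (Om_pos hM u v).ne'
  rw [masterField_eq ⟨hM, hu.1, hv, hx⟩]
  have e : G.r u v ^ 2 • S.etab u v x - ((G.Om u v)⁻¹ * (G.Om u v)⁻¹) • (1 / 2 : ℝ) •
      G.r u v ^ 2 • nabla (S.otx u v) x = G.r u v ^ 2 • (S.etab u v x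
        - (1 / (2 * G.Om u v ^ 2)) • nabla (S.otx u v) x) := by
    rw [smul_sub, smul_smul, smul_smul, smul_smul]
    congr 2
    field_simp
  rw [e]
  simp only [tsq_smul]
  field_simp

/-- The leading part of the ingoing flux density at null infinity. -/
def radField (G : Geom) (S : Pert) (u v : ℝ) (x : E3) : ℝ :=
  tsq (((G.r * G.Om) ⊙ S.chib) u v x) + tsq (((G.r * G.Om) ⊙ S.betabF) u v x)

theorem radField_eq : radField G S u v x =
    G.Om u v ^ 2 * (tsq (G.r u v • S.chib u v x) + tsq (G.r u v • S.betabF u v x)) := by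
  simp only [radField, mulF, tsq_smul, Pi.mul_apply]
  ring

theorem famSmooth_radField (hM : |G.Q| < G.M) (hS : G.IsSolution S) :
    FamSmooth G.Reg fun q => radField G S q.1 q.2 := by
  have c : ContDiffOn ℝ ∞ (fun q : ℝ × ℝ => (G.r * G.Om) q.1 q.2) G.Reg :=
    (contDiffOn_r hM).mul (contDiffOn_Om hM)
  exact (smooth_iff.1 (hS.smooth.chib.1.mulF c)).tsq.add
    (smooth_iff.1 (hS.smooth.betabF.1.mulF c)).tsq

theorem bdd_radField (hM : |G.Q| < G.M) (h : G.StripBounds S u₁) : G.Bdd u₁ (radField G S) :=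
  (((bdd_Om hM).mul (bdd_Om hM)).mul (h.chib.add h.betabF)).congr fun u v x _ _ _ => by
    rw [radField_eq, sq]

theorem laplacian_lO (hS : G.IsSolution S) (p : G.Pt u v x) : sdiv (nabla (S.lO u v)) x ![] =
    G.r u v / 2 * (sdiv (S.eta u v) x ![] + sdiv (S.etab u v) x ![]) := by
  have h1 := Smooth.slice hS.smooth.eta.1 p.u p.v
  have h2 := Smooth.slice hS.smooth.etab.1 p.u p.v
  rw [sdiv_congr (T := fun y => (G.r u v / 2) • (S.eta u v y + S.etab u v y)) (fun y hy => ?_) p.ne,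
    sdiv_const_smul, sdiv_add h1 h2 p.ne]
  · rfl
  · exact nabla_lO hS ⟨p.sub, p.u, p.v, hy⟩

/-- The terms 2r²Ω²|η|² and -r³`otxb` div η are as large as the radiation field at null infinity.
Substituting rη = 2∇`lO` - rη̲ and the Gauss equation turns their leading parts into the displayed
zero-mean combination of `lO`, with all other indefinite terms of size O(1/r). -/
theorem exists_inField_ge (hM : |G.Q| < G.M) (hS : G.IsSolution S) (h : G.StripBounds S u₁) :
    ∃ C, ∀ u v x, u ∈ Icc G.u₀ u₁ → G.v₀ ≤ v → ‖x‖ = 1 →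
      radField G S u v x + 8 * G.Om u v ^ 2 * (S.lO u v x ![] * sdiv (nabla (S.lO u v)) x ![]
        + tinner (nabla (S.lO u v) x) (nabla (S.lO u v) x)) - C / G.r u v
      ≤ inField G S u v x := by
  have o := bdd_Om (u₁ := u₁) hM
  have i := bdd_inv_r (u₁ := u₁) hM
  -- By the Gauss equation this bounded quantity is -(r²`otxb` + 4Ω²r`lO`): the 1/r part of `otxb`
  -- is -4Ω²`lO`/r.
  have e := ((((h.K.const_mul 2).add (h.rho.const_mul 2)).sub
    ((i.mul h.rhoF).const_mul (4 * G.Q))).sub h.otx)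
  have b := (((e.mul h.sdiv_eta).sub (((o.mul o).mul (h.nabla_lO.tinner h.etab)).const_mul 8)).sub
    (h.otxb.mul h.rho)).sub (((o.mul o).mul (h.lO.mul h.sdiv_etab)).const_mul 4)
  obtain ⟨C, hC⟩ := b
  refine ⟨C, fun u v x hu hv hx => ?_⟩
  have p : G.Pt u v x := ⟨hM, hu.1, hv, hx⟩
  have hr := p.r_ne
  have hrp := r_pos hM u v
  have hb := (abs_le.1 (hC u v x hu hv hx)).1
  simp only at hb
  have key : inField G S u v x - radField G S u v x
      - 8 * G.Om u v ^ 2 * (S.lO u v x ![] * sdiv (nabla (S.lO u v)) x ![]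
        + tinner (nabla (S.lO u v) x) (nabla (S.lO u v) x)) =
      (G.r u v * G.Om u v) ^ 2 * (tsq (S.betabF u v x) + 2 * S.sigmaF u v x ![] ^ 2
        + 2 * S.rhoF u v x ![] ^ 2 + 2 * tsq (S.etab u v x))
      + ((2 * (G.r u v ^ 3 * S.K u v x ![]) + 2 * (G.r u v ^ 3 * S.rho u v x ![])
          - 4 * G.Q * ((G.r u v)⁻¹ * (G.r u v ^ 2 * S.rhoF u v x ![]))
          - G.r u v ^ 2 * S.otx u v x ![]) * (G.r u v * sdiv (S.eta u v) x ![])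
        - 8 * (G.Om u v * G.Om u v * tinner (nabla (S.lO u v) x) (G.r u v ^ 2 • S.etab u v x))
        - G.r u v * S.otxb u v x ![] * (G.r u v ^ 3 * S.rho u v x ![])
        - 4 * (G.Om u v * G.Om u v * (S.lO u v x ![] * (G.r u v ^ 2 * sdiv (S.etab u v) x ![]))))
        / G.r u v := by
    rw [inField_eq p, radField_eq, laplacian_lO hS p, nabla_lO hS p, K_eq hS p]
    simp only [tsq_smul, mulF, tsq_zero_rank (S.sigmaF u v x), tsq_zero_rank (S.rhoF u v x)]
    simp only [tsq, tinner_zero, tinner_add_left, tinner_add_right, tinner_smul_left,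
      tinner_smul_right, Pi.add_apply, Pi.sub_apply, Pi.smul_apply, Pi.neg_apply, smul_eq_mul, rhoF,
      tinner_comm (S.etab u v x) (S.eta u v x)]
    field_simp
    ring
  -- Nonnegative leftovers, including half of the β̲_F term, are discarded.
  have hn : 0 ≤ (G.r u v * G.Om u v) ^ 2 * (tsq (S.betabF u v x) + 2 * S.sigmaF u v x ![] ^ 2
        + 2 * S.rhoF u v x ![] ^ 2 + 2 * tsq (S.etab u v x)) := by
    have := tsq_nonneg (S.betabF u v x)
    have := tsq_nonneg (S.etab u v x)
    positivity
  have hb' := div_le_div_of_nonneg_right hb hrp.le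
  have hneg : -C / G.r u v = -(C / G.r u v) := neg_div _ _
  linarith

/-- On ingoing cones the canonical energy density dominates the radiation field up to terms
vanishing at null infinity. -/
theorem exists_inDensity_ge (hM : |G.Q| < G.M) (hS : G.IsSolution S) (h : G.StripBounds S u₁) :
    ∃ C, ∀ u v, u ∈ Icc G.u₀ u₁ → G.v₀ ≤ v →
      sphInt (radField G S u v) - C / G.r u v ≤ G.inDensity S u v := by
  obtain ⟨C, hC⟩ := exists_inField_ge hM hS h
  refine ⟨C * sphArea, fun u v hu hv => ?_⟩
  have sw := hS.smooth.lO.slice hu.1 hv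
  have z := (sphNull_mul_sdiv_add sw (Smooth.slice (Smooth.nabla hS.smooth.lO) hu.1 hv)
    (tangential_nabla sw)).const_mul (8 * G.Om u v ^ 2)
  have i1 := integrable_sphere_of_continuousOn
    (continuousOn_S2 (famSmooth_radField hM hS) hu.1 hv)
  have i2 := integrable_sphere_of_continuousOn
    (continuousOn_S2 (famSmooth_inField hM hS) hu.1 hv)
  have i3 : Integrable (fun _ : Metric.sphere (0 : E3) 1 => C / G.r u v)
    (volume : Measure E3).toSphere := integrable_const _
  have key := integral_mono ((i1.add z.1).sub i3) i2 fun x => hC u v x hu hv (by simp)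
  rw [integral_sub' (i1.add z.1) i3, integral_add' i1 z.1, integral_const, smul_eq_mul] at key
  have hz := z.2
  rw [sphInt] at hz
  rw [hz, add_zero] at key
  refine le_trans (le_of_eq ?_) key
  rw [sphInt, sphArea]
  ring

/-- Functions dominated by `r⁻²` are integrable along outgoing cones. -/
theorem integrableOn_sphInt (hM : |G.Q| < G.M) {f : ℝ → ℝ → E3 → ℝ}
    (hf : FamSmooth G.Reg fun q => f q.1 q.2) (hu : G.u₀ ≤ u)
    (hb : G.Bdd u fun u v x => G.r u v ^ 2 * f u v x) :
    IntegrableOn (fun v => sphInt (f u v)) (Ioi G.v₀) := by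
  obtain ⟨C, hC⟩ := hb
  -- Ω²/r² is the exact v-derivative of -1/r, hence integrable. Replacing Ω² by its smallest value
  -- Ω(u, v₀)² on the cone turns a bound by r⁻² into one by this function.
  have hd : ∀ v ∈ Ici G.v₀, HasDerivAt (fun v => -(G.r u v)⁻¹)
      (G.Om u v ^ 2 / G.r u v ^ 2) v := fun v _ =>
    ((hasDerivAt_r_v hM u v).fun_inv (r_pos hM u v).ne').fun_neg.congr_deriv (by ring)
  have h1 : IntegrableOn (fun v => G.Om u v ^ 2 / G.r u v ^ 2) (Ioi G.v₀) := by
    refine integrableOn_Ioi_deriv_of_nonneg' (l := -0) hd (fun v _ => by positivity) ?_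
    exact (tendsto_inv_atTop_zero.comp (tendsto_r hM u)).neg
  have hO := Om_pos hM u G.v₀
  have hCn : 0 ≤ C := (abs_nonneg _).trans
    (hC u G.v₀ (EuclideanSpace.single 0 1) ⟨hu, le_rfl⟩ le_rfl (by simp))
  refine Integrable.mono' (h1.const_mul (C * sphArea / G.Om u G.v₀ ^ 2))
    (((continuousOn_sphInt_v hf hu).mono Ioi_subset_Ici_self).aestronglyMeasurable
      measurableSet_Ioi) ?_
  filter_upwards [ae_restrict_mem measurableSet_Ioi] with v hv
  have hv' : G.v₀ ≤ v := le_of_lt hv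
  have hr := r_pos hM u v
  have hb : |sphInt (f u v)| ≤ C / G.r u v ^ 2 * sphArea := abs_sphInt_le fun x hx => by
    have := hC u v x ⟨hu, le_rfl⟩ hv' hx
    rw [abs_mul, abs_of_pos (by positivity : 0 < G.r u v ^ 2)] at this
    rw [le_div_iff₀ (by positivity)]
    linarith
  have hOm : G.Om u G.v₀ ^ 2 ≤ G.Om u v ^ 2 :=
    pow_le_pow_left₀ hO.le (Om_mono hM le_rfl hv') 2
  rw [Real.norm_eq_abs]
  refine hb.trans ?_
  have hA := sphArea_nonneg
  have e : C * sphArea / G.Om u G.v₀ ^ 2 * (G.Om u v ^ 2 / G.r u v ^ 2) =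
      C / G.r u v ^ 2 * sphArea * (G.Om u v ^ 2 / G.Om u G.v₀ ^ 2) := by
    field_simp
  rw [e]
  exact le_mul_of_one_le_right (by positivity) ((one_le_div (by positivity)).2 hOm)

theorem integrableOn_outDensity (hM : |G.Q| < G.M) (hS : G.IsSolution S) (hu : G.u₀ ≤ u)
    (h : G.StripBounds S u) : IntegrableOn (G.outDensity S u) (Ioi G.v₀) :=
  integrableOn_sphInt hM (famSmooth_outField hM hS) hu (bdd_outField hM h)

theorem integrableOn_masterDensity (hM : |G.Q| < G.M) (hS : G.IsSolution S) (hu : G.u₀ ≤ u)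
    (h : G.StripBounds S u) : IntegrableOn (G.masterDensity S u) (Ioi G.v₀) :=
  integrableOn_sphInt hM (famSmooth_masterField hM hS) hu (bdd_masterField hM h)

theorem tendsto_Om_sq (hM : |G.Q| < G.M) (u : ℝ) :
    Tendsto (fun v => G.Om u v ^ 2) atTop (𝓝 1) := by
  have h := tendsto_inv_atTop_zero.comp (tendsto_r hM u)
  have h2 : Tendsto (fun v => 1 - 2 * G.M * (G.r u v)⁻¹ + G.Q ^ 2 * ((G.r u v)⁻¹) ^ 2) atTop
      (𝓝 (1 - 2 * G.M * 0 + G.Q ^ 2 * 0 ^ 2)) :=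
    ((h.const_mul (2 * G.M)).const_sub 1).add ((h.pow 2).const_mul (G.Q ^ 2))
  norm_num at h2
  refine h2.congr fun v => ?_
  rw [Om_sq hM]
  ring

theorem tendsto_tsq {n : ℕ} {T : ℝ → Tensor n} {L : Tensor n}
    (h : Tendsto T atTop (𝓝 L)) : Tendsto (fun v => tsq (T v)) atTop (𝓝 (tsq L)) :=
  tendsto_finsetSum _ fun I _ => ((tendsto_pi_nhds.1 h) I).mul ((tendsto_pi_nhds.1 h) I)

/-- Each weighted term of X has a limit by assumption, and Ω → 1 removes the remaining weight on the
Laplacian of τ. -/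
theorem exists_tendsto_X (hM : |G.Q| < G.M) (hD : G.DecayAssumptions S) (hu : G.u₀ ≤ u)
    (hx : ‖x‖ = 1) : ∃ L, Tendsto (fun v => G.X S u v x) atTop (𝓝 L) := by
  obtain ⟨s, -, h⟩ := hD
  obtain ⟨a, ha⟩ := h.rho.exists_tendsto hu hx
  obtain ⟨b, hb⟩ := h.div_etab.exists_tendsto hu hx
  obtain ⟨c, hc⟩ := h.otx.exists_tendsto_laplacian hM hu hx
  have ho := (tendsto_Om_sq hM u).inv₀ one_ne_zero
  refine ⟨fun I => 2 * a I - 2 * b I + 1⁻¹ * c, tendsto_pi_nhds.2 fun I => ?_⟩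
  obtain rfl : I = ![] := Subsingleton.elim _ _
  refine ((((tendsto_pi_nhds.1 ha ![]).const_mul 2).sub ((tendsto_pi_nhds.1 hb ![]).const_mul 2)).add
    (ho.mul hc)).congr' ?_
  filter_upwards [eventually_ge_atTop G.v₀] with v hv
  have hr := (r_pos hM u v).ne'
  have hO := (Om_pos hM u v).ne'
  rw [X_eq ⟨hM, hu, hv, hx⟩]
  simp [mulF, div]
  field_simp

theorem exists_tendsto_sphInt_radField (hM : |G.Q| < G.M) (hS : G.IsSolution S)
    (hD : G.DecayAssumptions S) (hu : G.u₀ ≤ u) :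
    ∃ L, Tendsto (fun v => sphInt (radField G S u v)) atTop (𝓝 L) := by
  obtain ⟨C, hC⟩ := bdd_radField (u₁ := u) hM (hD.stripBounds hM)
  obtain ⟨s, -, h⟩ := hD
  have hp : ∀ x, ‖x‖ = 1 → ∃ L, Tendsto (fun v => radField G S u v x) atTop (𝓝 L) := fun x hx => by
    obtain ⟨a, ha⟩ := h.chib.exists_tendsto hu hx
    obtain ⟨b, hb⟩ := h.betabF.exists_tendsto hu hx
    refine ⟨_, ((tendsto_Om_sq hM u).mul ((tendsto_tsq ha).add
      (tendsto_tsq hb))).congr fun v => ?_⟩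
    rw [radField_eq]
    rfl
  choose! L hL using hp
  exact ⟨_, tendsto_sphInt (v₀ := G.v₀) (fun v hv => continuousOn_S2 (famSmooth_radField hM hS) hu hv)
    (fun v hv x hx => hC u v x ⟨hu, le_rfl⟩ hv hx) hL⟩

/-- Dominated convergence in u: the sphere integrals converge for each u and share one bound on the
strip. -/
theorem exists_tendsto_radFlux (hM : |G.Q| < G.M) (hS : G.IsSolution S)
    (hD : G.DecayAssumptions S) (hu : G.u₀ ≤ u₁) :
    ∃ F, Tendsto (fun v => G.radFlux S u₁ v) atTop (𝓝 F) := by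
  obtain ⟨C, hC⟩ := bdd_radField (u₁ := u₁) hM (hD.stripBounds hM)
  have hp : ∀ u, G.u₀ ≤ u → ∃ L, Tendsto (fun v => sphInt (radField G S u v)) atTop (𝓝 L) :=
    fun u hu => exists_tendsto_sphInt_radField hM hS hD hu
  choose! L hL using hp
  refine ⟨∫ u in G.u₀..u₁, L u, ?_⟩
  refine intervalIntegral.tendsto_integral_filter_of_dominated_convergence
    (fun _ => C * sphArea) ?_ ?_ intervalIntegrable_const ?_
  · filter_upwards [eventually_ge_atTop G.v₀] with v hv
    rw [uIoc_of_le hu]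
    exact ((continuousOn_sphInt_u (famSmooth_radField hM hS) hv).mono fun u hu' =>
      hu'.1.le).aestronglyMeasurable measurableSet_Ioc
  · filter_upwards [eventually_ge_atTop G.v₀] with v hv
    refine Eventually.of_forall fun u hu' => ?_
    rw [uIoc_of_le hu] at hu'
    exact abs_sphInt_le fun x hx => hC u v x ⟨hu'.1.le, hu'.2⟩ hv hx
  · refine Eventually.of_forall fun u hu' => ?_
    rw [uIoc_of_le hu] at hu'
    exact hL u hu'.1.le

end Geom

namespace Geom

variable {G : Geom} {S : Pert} {u v u₁ : ℝ} {x : E3}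

/-! ## The energy estimate -/

theorem normSq_eq (T : SField 0) : normSq T u v = sphInt fun x => T u v x ![] ^ 2 :=
  sphInt_congr fun _ _ => tsq_zero_rank _

theorem normSq_le_inv_Om (hM : |G.Q| < G.M) {n : ℕ} (T : SField n) :
    normSq T u v ≤ normSq (G.Om⁻¹ ⊙ T) u v := by
  have hO := Om_pos hM u v
  have e : normSq (G.Om⁻¹ ⊙ T) u v = (G.Om u v)⁻¹ ^ 2 * normSq T u v := by
    rw [normSq, normSq, ← sphInt_const_mul]
    exact sphInt_congr fun x _ => tsq_smul _ _
  rw [e]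
  refine le_mul_of_one_le_left (sphInt_nonneg fun x _ => tsq_nonneg _) ?_
  exact one_le_pow₀ (one_le_inv_iff₀.2 ⟨hO, Om_le_one hM u v⟩)

theorem sphInt_psi_ge (hM : |G.Q| < G.M) (hS : G.IsSolution S) {δ : ℝ} (h0 : 0 ≤ δ) (h1 : δ < 1)
    (hm : ∀ u v, 0 < 6 * G.M - 8 * G.Q ^ 2 / ((1 - δ) * G.r u v)) (hu : G.u₀ ≤ u)
    (hv : G.v₀ ≤ v) : (24 * G.M)⁻¹ * normSq (G.X S) u v ≤ sphInt (psi G S δ u v) := by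
  have fX := (smooth_iff.1 (smooth_X hM hS)).apply ![]
  rw [normSq_eq, ← sphInt_const_mul]
  refine sphInt_mono ?_ (continuousOn_S2 (famSmooth_psi hM hS h1 fun u v => (hm u v).ne') hu hv)
    fun x _ => (psi_ge hM h0 h1 (hm u v)).trans_eq' (by ring)
  exact continuousOn_const.mul ((continuousOn_S2 (f := fun u v x => G.X S u v x ![]) fX hu hv).pow 2)

theorem sphInt_psi_le (hM : |G.Q| < G.M) (hS : G.IsSolution S) {δ c : ℝ} (h0 : 0 ≤ δ) (h1 : δ < 1)
    (hc : 0 < c) (hm : ∀ u v, c ≤ 6 * G.M - 8 * G.Q ^ 2 / ((1 - δ) * G.r u v)) (hu : G.u₀ ≤ u)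
    (hv : G.v₀ ≤ v) : sphInt (psi G S δ u v) ≤ (1 / 4 + (1 + 36 * G.M ^ 2) / (2 * c))
      * (normSq (G.lam S) u v + normSq (G.X S) u v) := by
  have fX := (smooth_iff.1 (smooth_X hM hS)).apply ![]
  have fl := (smooth_iff.1 (smooth_lam hM hS)).apply ![]
  have cX : ContinuousOn (fun x => G.X S u v x ![] ^ 2) S2 :=
    (continuousOn_S2 (f := fun u v x => G.X S u v x ![]) fX hu hv).pow 2
  have cl : ContinuousOn (fun x => G.lam S u v x ![] ^ 2) S2 := (continuousOn_S2 (f := fun u v x => G.lam S u v x ![]) fl hu hv).pow 2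
  rw [normSq_eq, normSq_eq, ← sphInt_add cl cX, ← sphInt_const_mul]
  exact sphInt_mono (continuousOn_S2
    (famSmooth_psi hM hS h1 fun u v => (hc.trans_le (hm u v)).ne') hu hv)
    (continuousOn_const.mul (cl.add cX)) fun x _ => psi_le hM h0 h1 hc (hm u v)

theorem exists_integral_inDensity_ge (hM : |G.Q| < G.M) (hS : G.IsSolution S)
    (h : G.StripBounds S u₁) (hu : G.u₀ ≤ u₁) : ∃ C, ∀ v, G.v₀ ≤ v →
      G.radFlux S u₁ v - C / G.r u₁ v ≤ ∫ u in G.u₀..u₁, G.inDensity S u v := by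
  obtain ⟨C, hC⟩ := exists_inDensity_ge hM hS h
  refine ⟨|C| * (u₁ - G.u₀), fun v hv => ?_⟩
  have i1 := intervalIntegrable_sphInt_u (famSmooth_radField hM hS) hv hu
  have i2 := intervalIntegrable_sphInt_u (famSmooth_inField hM hS) hv hu
  have i3 : IntervalIntegrable (fun _ => |C| / G.r u₁ v) volume G.u₀ u₁ := intervalIntegrable_const
  have key := intervalIntegral.integral_mono_on hu (i1.sub i3) i2 fun u hu' => by
    -- On a fixed ingoing cone r decreases in u, so 1/r is largest at u₁; this makes the error
    -- uniform in u.
    refine le_trans (sub_le_sub_left ?_ _) (hC u v hu' hv)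
    have hr := r_pos hM u₁ v
    exact (div_le_div_of_nonneg_right (le_abs_self C) (r_pos hM u v).le).trans
      (div_le_div_of_nonneg_left (abs_nonneg C) hr (r_mono hM hu'.2 le_rfl))
  rw [intervalIntegral.integral_sub i1 i3, intervalIntegral.integral_const, smul_eq_mul] at key
  refine le_trans (le_of_eq ?_) key
  rw [mul_div_assoc', mul_comm (u₁ - G.u₀)]
  rfl

theorem tendsto_normSq_X (hM : |G.Q| < G.M) (hS : G.IsSolution S) (hD : G.DecayAssumptions S)
    (hu : G.u₀ ≤ u) {L : E3 → Tensor 0}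
    (hL : ∀ x, ‖x‖ = 1 → Tendsto (fun v => G.X S u v x) atTop (𝓝 (L x))) :
    Tendsto (fun v => normSq (G.X S) u v) atTop (𝓝 (sphInt fun x => tsq (L x))) := by
  obtain ⟨C, hC⟩ := Bdd.tsq_zero (bdd_X (u₁ := u) hM (hD.stripBounds hM))
  exact tendsto_sphInt (v₀ := G.v₀) (f := fun v x => tsq (G.X S u v x))
    (fun v hv => continuousOn_S2 (f := fun u v x => tsq (G.X S u v x))
      (smooth_iff.1 (smooth_X hM hS)).tsq hu hv)
    (fun v hv x hx => hC u v x ⟨hu, le_rfl⟩ hv hx) fun x hx => tendsto_tsq (hL x hx)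

theorem integral_masterDensity_nonneg : 0 ≤ ∫ v in Ioi G.v₀, G.masterDensity S u v :=
  integral_nonneg fun v => sphInt_nonneg fun x _ => by
    have := tsq_nonneg (S.chi u v x)
    have := tsq_nonneg (S.betaF u v x)
    have := tsq_nonneg (S.sigmaF u v x)
    have := tsq_nonneg ((S.etab - (1 / 2) ⊙ G.rnab ((G.Om ^ 2)⁻¹ ⊙ S.otx)) u v x)
    have := tsq_nonneg ((S.rhoF - (fun u v => G.Q / G.r u v ^ 2) ⊙ G.lam S) u v x)
    positivity

theorem radFlux_nonneg (hu : G.u₀ ≤ u₁) : 0 ≤ G.radFlux S u₁ v :=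
  intervalIntegral.integral_nonneg hu fun u _ => sphInt_nonneg fun x _ =>
    add_nonneg (tsq_nonneg _) (tsq_nonneg _)

/-- At finite v: conservation on the rectangle, coercivity on u = u₁, the lower bound on the ingoing
flux, and positivity of `psi` at the far end. As v → ∞ the strip error C/r disappears, so the
constants involve only δ, c and M. -/
theorem energy_estimate (hM : |G.Q| < G.M) {δ c : ℝ} (h0 : 0 < δ) (h1 : δ < 1) (hc : 0 < c)
    (hm : ∀ u v, c ≤ 6 * G.M - 8 * G.Q ^ 2 / ((1 - δ) * G.r u v)) (hS : G.IsSolution S)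
    (hD : G.DecayAssumptions S) (hu : G.u₀ ≤ u₁) {L : E3 → Tensor 0} {F : ℝ}
    (hL : ∀ x, ‖x‖ = 1 → Tendsto (fun v => G.X S u₁ v x) atTop (𝓝 (L x)))
    (hF : Tendsto (fun v => G.radFlux S u₁ v) atTop (𝓝 F)) :
    δ * (∫ v in Ioi G.v₀, G.masterDensity S u₁ v) + (24 * G.M)⁻¹ * sphInt (fun x => tsq (L x)) + F ≤
      G.dataEnergy (1 + (1 + 36 * G.M ^ 2) / (2 * c)) S u₁ := by
  have hb := DecayAssumptions.stripBounds (u₁ := u₁) hM hD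
  have hb0 := DecayAssumptions.stripBounds (u₁ := G.u₀) hM hD
  obtain ⟨C, hC⟩ := exists_integral_inDensity_ge hM hS hb hu
  have t1 := intervalIntegral_tendsto_integral_Ioi G.v₀ (integrableOn_masterDensity hM hS hu hb)
    tendsto_id
  have t2 := intervalIntegral_tendsto_integral_Ioi G.v₀ (integrableOn_outDensity hM hS le_rfl hb0)
    tendsto_id
  have t3 := tendsto_normSq_X hM hS hD hu hL
  have t4 := (tendsto_inv_atTop_zero.comp (tendsto_r hM u₁)).const_mul C
  have tl := (((t1.const_mul δ).add (t3.const_mul (24 * G.M)⁻¹)).add hF).sub t4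
  have tr := t2.add_const (G.inFlux S u₁ + sphInt (psi G S δ u₁ G.v₀))
  have hle := le_of_tendsto_of_tendsto tl tr (by
    filter_upwards [eventually_ge_atTop G.v₀] with v hv
    have a1 := integral_outDensity_ge hM hS h0.le h1 (fun u v => hc.trans_le (hm u v)) hu hv
    have a2 := hC v hv
    have a3 := energy_conservation hM hS hu hv
    have a4 := sphInt_psi_ge hM hS h0.le h1 (fun u v => hc.trans_le (hm u v)) hu hv
    rw [div_eq_mul_inv] at a2
    simp only [id_eq, Function.comp_apply, inFlux] at *
    linarith)
  have b1 := sphInt_psi_le hM hS h0.le h1 hc hm hu le_rfl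
  have b2 := normSq_le_inv_Om hM (G.lam S) (u := u₁) (v := G.v₀)
  have b3 := normSq_le_inv_Om hM (G.X S) (u := u₁) (v := G.v₀)
  have b4 : 0 ≤ normSq (G.lam S) u₁ G.v₀ + normSq (G.X S) u₁ G.v₀ :=
    add_nonneg (sphInt_nonneg fun x _ => tsq_nonneg _) (sphInt_nonneg fun x _ => tsq_nonneg _)
  -- The coefficient 1/4 in `sphInt_psi_le` is raised to 1 below, so that Λ ≥ 1; since Ω ≤ 1, the
  -- factors Ω⁻¹ only enlarge the data norms.
  have hk : 0 ≤ (1 + 36 * G.M ^ 2) / (2 * c) := by positivity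
  have b5 := mul_le_mul (show 1 / 4 + (1 + 36 * G.M ^ 2) / (2 * c) ≤
    1 + (1 + 36 * G.M ^ 2) / (2 * c) by linarith) (add_le_add b2 b3) b4 (by linarith)
  rw [mul_zero, sub_zero] at hle
  rw [dataEnergy, outFlux]
  linarith

/-- Removes the coefficients δ, (24M)⁻¹ and 1 of the three nonnegative terms by multiplying with the
sum of their inverses. -/
theorem masterEnergy_add_le (hM : |G.Q| < G.M) {δ c : ℝ} (h0 : 0 < δ) (h1 : δ < 1) (hc : 0 < c)
    (hm : ∀ u v, c ≤ 6 * G.M - 8 * G.Q ^ 2 / ((1 - δ) * G.r u v)) (hS : G.IsSolution S)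
    (hD : G.DecayAssumptions S) (hu : G.u₀ ≤ u₁) {L : E3 → Tensor 0} {F : ℝ}
    (hL : ∀ x, ‖x‖ = 1 → Tendsto (fun v => G.X S u₁ v x) atTop (𝓝 (L x)))
    (hF : Tendsto (fun v => G.radFlux S u₁ v) atTop (𝓝 F)) :
    G.masterEnergy S u₁ L + F ≤
      (1 + δ⁻¹ + 24 * G.M) * G.dataEnergy (1 + (1 + 36 * G.M ^ 2) / (2 * c)) S u₁ := by
  have hM0 : 0 < G.M := (abs_nonneg _).trans_lt hM
  have key := energy_estimate hM h0 h1 hc hm hS hD hu hL hF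
  set A := ∫ v in Ioi G.v₀, G.masterDensity S u₁ v with hA
  set B := sphInt (fun x => tsq (L x)) with hB
  have hA0 : 0 ≤ A := integral_masterDensity_nonneg
  have hB0 : 0 ≤ B := sphInt_nonneg fun x _ => tsq_nonneg _
  have hF0 : 0 ≤ F := ge_of_tendsto' hF fun v => radFlux_nonneg hu
  have hδ : 0 < δ⁻¹ := inv_pos.2 h0
  refine le_trans ?_ (mul_le_mul_of_nonneg_left key (by positivity))
  rw [masterEnergy, ← hA, ← hB]
  have e1 : δ⁻¹ * (δ * A) = A := by field_simp
  have e2 : 24 * G.M * ((24 * G.M)⁻¹ * B) = B := by field_simp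
  have p1 : 0 ≤ δ * A := by positivity
  have p2 : 0 ≤ (24 * G.M)⁻¹ * B := by positivity
  have p3 : 0 ≤ δ⁻¹ * ((24 * G.M)⁻¹ * B + F) := by positivity
  have p4 : 0 ≤ 24 * G.M * (δ * A + F) := by positivity
  nlinarith

end Geom

/-! ### Laplacians on the sphere, and decay by integration from infinity. -/

theorem SphSmooth.nabla {n : ℕ} {T : E3 → Tensor n} (hT : SphSmooth T) : SphSmooth (nabla T) :=
  FamSmooth.slice (FamSmooth.nabla uniqueDiffOn_univ
    (famSmooth_of_sphSmooth (E := ℝ) (s := univ) hT)) (mem_univ (0 : ℝ))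

theorem laplacian_const_smul {n : ℕ} (k : ℝ) (T : E3 → Tensor n) (x : E3) :
    sdiv (nabla fun y => k • T y) x = k • sdiv (nabla T) x := by
  rw [show (nabla fun y => k • T y) = fun y => k • nabla T y from
    funext fun y => nabla_const_smul k T y, sdiv_const_smul]

theorem laplacian_add {n : ℕ} {A B : E3 → Tensor n} (hA : SphSmooth A) (hB : SphSmooth B) {x : E3}
    (hx : x ≠ 0) : sdiv (nabla fun y => A y + B y) x = sdiv (nabla A) x + sdiv (nabla B) x := by
  rw [sdiv_congr (T := fun y => nabla A y + nabla B y)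
    (fun y hy => nabla_add hA hB (ne_zero_of_norm_one hy)) hx, sdiv_add hA.nabla hB.nabla hx]

theorem laplacian_congr {n : ℕ} {A B : E3 → Tensor n} (h : ∀ x, ‖x‖ = 1 → A x = B x) {x : E3}
    (hx : x ≠ 0) : sdiv (nabla A) x = sdiv (nabla B) x :=
  sdiv_congr (fun _ hy => nabla_congr h (ne_zero_of_norm_one hy)) hx

/-- A function tending to zero whose derivative decays exponentially decays at the same rate. -/
theorem abs_le_of_deriv_le_exp {h h' : ℝ → ℝ} {a b C : ℝ} (hb : 0 < b)
    (hd : ∀ u, a ≤ u → HasDerivWithinAt h (h' u) (Ici a) u)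
    (hC : ∀ u, a ≤ u → |h' u| ≤ C * Real.exp (-(b * u))) (h0 : Tendsto h atTop (𝓝 0)) {u : ℝ}
    (hu : a ≤ u) : |h u| ≤ C / b * Real.exp (-(b * u)) := by
  have he : ∀ u, HasDerivAt (fun u => C / b * Real.exp (-(b * u))) (-(C * Real.exp (-(b * u)))) u :=
    fun u => ((((hasDerivAt_id u).const_mul b).neg.exp).const_mul (C / b)).congr_deriv (by
      simp only [id_eq, mul_one, Pi.neg_apply]; field_simp)
  have te : Tendsto (fun u => C / b * Real.exp (-(b * u))) atTop (𝓝 0) := by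
    have := (Real.tendsto_exp_neg_atTop_nhds_zero.comp
      (tendsto_id.const_mul_atTop hb)).const_mul (C / b)
    rwa [mul_zero] at this
  have gen : ∀ k k' : ℝ → ℝ, (∀ u, a ≤ u → HasDerivWithinAt k (k' u) (Ici a) u) →
      (∀ u, a ≤ u → k' u ≤ C * Real.exp (-(b * u))) → Tendsto k atTop (𝓝 0) →
      -(C / b * Real.exp (-(b * u))) ≤ k u := by
    intro k k' hk hk' tk
    -- Adding the antiderivative of the bound gives a nonincreasing function with limit zero, hence
    -- a nonnegative one; applied to ±h this is the two-sided bound.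
    have hanti : AntitoneOn (fun u => k u + C / b * Real.exp (-(b * u))) (Ici a) := by
      have hh : ∀ u ∈ Ici a, HasDerivWithinAt (fun u => k u + C / b * Real.exp (-(b * u)))
          (k' u + -(C * Real.exp (-(b * u)))) (Ici a) u := fun u hu =>
        (hk u hu).add (he u).hasDerivWithinAt
      refine antitoneOn_of_hasDerivWithinAt_nonpos (convex_Ici a)
        (fun u hu => (hh u hu).continuousWithinAt)
        (fun u hu => (hh u (interior_subset hu)).mono interior_subset) fun u hu => ?_
      linarith [hk' u (interior_subset hu)]
    have tl := tk.add te
    rw [add_zero] at tl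
    have := le_of_tendsto tl (by
      filter_upwards [eventually_ge_atTop u] with w hw
      exact hanti hu (hu.trans hw) hw)
    linarith
  refine abs_le.2 ⟨gen h h' hd (fun u hu => (le_abs_self _).trans (hC u hu)) h0, ?_⟩
  have := gen (fun u => -h u) (fun u => -h' u) (fun u hu => (hd u hu).neg)
    (fun u hu => (neg_le_abs _).trans (hC u hu)) (by simpa using h0.neg)
  linarith

namespace Geom

variable {G : Geom} {S : Pert} {u v u₁ : ℝ} {x : E3}

/-! ## The event horizon -/

/-- The regular coordinate `U = e^{-2κu}` at the event horizon. -/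
def kru (G : Geom) (u : ℝ) : ℝ := Real.exp (-(2 * G.kappa * u))

theorem kru_pos : 0 < G.kru u := Real.exp_pos _

theorem kappa_pos (hM : |G.Q| < G.M) : 0 < G.kappa := by
  obtain ⟨h0, h1, -, -⟩ := horizon_facts hM
  have := rPlus_pos hM
  unfold kappa
  apply div_pos <;> nlinarith

theorem kru_le (hM : |G.Q| < G.M) (hu : G.u₀ ≤ u) : G.kru u ≤ G.kru G.u₀ := by
  have := kappa_pos hM
  exact Real.exp_le_exp.2 (by nlinarith)

theorem kru_mem (hM : |G.Q| < G.M) (hu : G.u₀ ≤ u) : G.kru u ∈ Icc 0 (G.kru G.u₀) :=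
  ⟨kru_pos.le, kru_le hM hu⟩

theorem tendsto_kru (hM : |G.Q| < G.M) : Tendsto G.kru atTop (𝓝 0) :=
  Real.tendsto_exp_neg_atTop_nhds_zero.comp
    (tendsto_id.const_mul_atTop (by have := kappa_pos hM; positivity))

/-- On v = v₀ one has -2κu = 2κ(r_* - v₀), and κ is exactly the constant for which 2κr_* contains
log(r - r₊) with coefficient 1. So U = (r - r₊)·exp(…) with an exponent that is bounded for r₊ < r ≤
r(u₀, v₀). -/
theorem exists_r_sub_rPlus (hM : |G.Q| < G.M) : ∃ C, 0 < C ∧ ∀ u, G.u₀ ≤ u →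
    G.r u G.v₀ - rPlus G.M G.Q ≤ C * G.kru u ∧ G.kru u ≤ C * (G.r u G.v₀ - rPlus G.M G.Q) := by
  obtain ⟨h0, h1, h2, h3⟩ := horizon_facts hM
  have hp0 := rPlus_pos hM
  have hk0 := kappa_pos hM
  set p := rPlus G.M G.Q with hp
  set m := rMinus G.M G.Q with hm
  set R := G.r G.u₀ G.v₀
  -- A and B bound the exponent below and above: the linear term and the logarithm are each
  -- evaluated at the end of the interval that is extremal for them.
  set A := 2 * G.kappa * (p - G.v₀) - m ^ 2 / p ^ 2 * Real.log (R - m)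
  set B := 2 * G.kappa * (R - G.v₀) - m ^ 2 / p ^ 2 * Real.log (p - m)
  refine ⟨max (Real.exp (-A)) (Real.exp B), lt_max_of_lt_left (Real.exp_pos _), fun u hu => ?_⟩
  obtain ⟨hr, ht⟩ := G.r_spec hM u G.v₀
  have hrR : G.r u G.v₀ ≤ R := r_mono hM hu le_rfl
  set r := G.r u G.v₀
  have hrp : 0 < r - p := sub_pos.2 hr
  have hpm : 0 < p - m := sub_pos.2 h1
  have e : -(2 * G.kappa * u) = Real.log (r - p)
      + (2 * G.kappa * (r - G.v₀) - m ^ 2 / p ^ 2 * Real.log (r - m)) := by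
    have hu' : u = G.v₀ - tortoise G.M G.Q r := by rw [ht]; ring
    rw [hu', tortoise, ← hp, ← hm, kappa, ← hp, ← hm]
    field_simp
    ring
  have eU : G.kru u = (r - p) *
      Real.exp (2 * G.kappa * (r - G.v₀) - m ^ 2 / p ^ 2 * Real.log (r - m)) := by
    rw [kru, e, Real.exp_add, Real.exp_log hrp]
  have hq : 0 ≤ m ^ 2 / p ^ 2 := by positivity
  have l1 : Real.log (r - m) ≤ Real.log (R - m) := Real.log_le_log (by linarith) (by linarith)
  have l2 : Real.log (p - m) ≤ Real.log (r - m) := Real.log_le_log hpm (by linarith)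
  have x1 : A ≤ 2 * G.kappa * (r - G.v₀) - m ^ 2 / p ^ 2 * Real.log (r - m) := by
    have := mul_le_mul_of_nonneg_left l1 hq
    have : 2 * G.kappa * (p - G.v₀) ≤ 2 * G.kappa * (r - G.v₀) := by gcongr
    simp only [A]
    linarith
  have x2 : 2 * G.kappa * (r - G.v₀) - m ^ 2 / p ^ 2 * Real.log (r - m) ≤ B := by
    have := mul_le_mul_of_nonneg_left l2 hq
    have : 2 * G.kappa * (r - G.v₀) ≤ 2 * G.kappa * (R - G.v₀) := by gcongr
    simp only [B]
    linarith
  constructor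
  · refine le_trans ?_ (mul_le_mul_of_nonneg_right (le_max_left _ _) kru_pos.le)
    rw [eU, mul_left_comm, ← Real.exp_add]
    exact le_mul_of_one_le_right hrp.le (Real.one_le_exp (by linarith))
  · refine le_trans ?_ (mul_le_mul_of_nonneg_right (le_max_right _ _) hrp.le)
    rw [eU, mul_comm]
    exact mul_le_mul_of_nonneg_right (Real.exp_le_exp.2 x2) hrp.le

/-- Ω² is r - r₊ times (r - r₋)/r², and the second factor is bounded above and below by positive
constants along the cone. -/
theorem exists_Om_sq_kru (hM : |G.Q| < G.M) : ∃ C, 0 < C ∧ ∀ u, G.u₀ ≤ u →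
    G.Om u G.v₀ ^ 2 ≤ C * G.kru u ∧ G.kru u ≤ C * G.Om u G.v₀ ^ 2 := by
  obtain ⟨C, hC0, hC⟩ := exists_r_sub_rPlus hM
  obtain ⟨h0, h1, h2, h3⟩ := horizon_facts hM
  have hp0 := rPlus_pos hM
  have hR0 := r_pos hM G.u₀ G.v₀
  have hpm : 0 < rPlus G.M G.Q - rMinus G.M G.Q := sub_pos.2 h1
  refine ⟨max (C * (G.r G.u₀ G.v₀ / rPlus G.M G.Q ^ 2))
    (C * (G.r G.u₀ G.v₀ ^ 2 / (rPlus G.M G.Q - rMinus G.M G.Q))),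
    lt_max_of_lt_left (by positivity), fun u hu => ?_⟩
  obtain ⟨a, b⟩ := hC u hu
  have hr := r_gt hM u G.v₀
  have hr0 := r_pos hM u G.v₀
  have hrR := r_mono hM hu (le_refl G.v₀)
  have hk : 0 < G.kru u := kru_pos
  rw [Om_sq' hM, lapse_eq hM hr0]
  set p := rPlus G.M G.Q
  set m := rMinus G.M G.Q
  set r := G.r u G.v₀
  set R := G.r G.u₀ G.v₀
  constructor
  · refine le_trans ?_ (mul_le_mul_of_nonneg_right (le_max_left _ _) hk.le)
    have y1 : (r - m) / r ^ 2 ≤ R / p ^ 2 :=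
      div_le_div₀ hR0.le (by linarith) (by positivity) (pow_le_pow_left₀ hp0.le hr.le 2)
    calc (r - p) * (r - m) / r ^ 2 = (r - p) * ((r - m) / r ^ 2) := by ring
      _ ≤ (C * G.kru u) * (R / p ^ 2) := mul_le_mul a y1
        (div_nonneg (by linarith) (by positivity)) (by positivity)
      _ = _ := by ring
  · refine le_trans ?_ (mul_le_mul_of_nonneg_right (le_max_right _ _)
      (div_nonneg (mul_nonneg (by linarith) (by linarith)) (by positivity)))
    have y1 : 1 ≤ R ^ 2 / (p - m) * ((r - m) / r ^ 2) := by
      rw [div_mul_div_comm, one_le_div (by positivity), mul_comm]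
      exact mul_le_mul (pow_le_pow_left₀ hr0.le hrR 2) (by linarith) hpm.le (by positivity)
    calc G.kru u ≤ C * (r - p) := b
      _ ≤ C * (r - p) * (R ^ 2 / (p - m) * ((r - m) / r ^ 2)) :=
        le_mul_of_one_le_right (mul_nonneg hC0.le (by linarith)) y1
      _ = _ := by ring

theorem tendsto_r_horizon (hM : |G.Q| < G.M) :
    Tendsto (fun u => G.r u G.v₀) atTop (𝓝 (rPlus G.M G.Q)) := by
  obtain ⟨C, hC0, hC⟩ := exists_r_sub_rPlus hM
  have h : Tendsto (fun u => G.r u G.v₀ - rPlus G.M G.Q) atTop (𝓝 0) := by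
    refine squeeze_zero' (Eventually.of_forall fun u => (sub_pos.2 (r_gt hM u G.v₀)).le) ?_
      (by simpa using (tendsto_kru hM).const_mul C)
    filter_upwards [eventually_ge_atTop G.u₀] with u hu
    exact (hC u hu).1
  simpa using h.add_const (rPlus G.M G.Q)

section HorExt

variable {V : Type*} [NormedAddCommGroup V] [NormedSpace ℝ V]

/-- Smooth extension to `U = 0` of a family of sphere fields along an ingoing cone. -/
def HorExt (G : Geom) (T : ℝ → E3 → V) : Prop :=
  ∃ g : ℝ → E3 → V, FamSmooth (Icc 0 (G.kru G.u₀)) g ∧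
    ∀ u x, G.u₀ ≤ u → ‖x‖ = 1 → T u x = g (G.kru u) x

theorem uniqueDiffOn_kru : UniqueDiffOn ℝ (Icc 0 (G.kru G.u₀)) := uniqueDiffOn_Icc kru_pos

theorem ExtendsToHorizon.horExt {n : ℕ} {T : SField n} (h : G.ExtendsToHorizon T) :
    G.HorExt fun u => T u G.v₀ := by
  obtain ⟨g, hg, hT⟩ := h
  refine ⟨fun U x => g (U, x), ?_, hT⟩
  -- The given extension is prescribed only at unit vectors; composing with the radial retraction
  -- makes it a family of homogeneous extensions.
  have hc : ContDiffOn ℝ ∞ (fun p : ℝ × E3 => (p.1, ‖p.2‖⁻¹ • p.2))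
      (Icc 0 (G.kru G.u₀) ×ˢ {0}ᶜ) := by
    refine contDiffOn_fst.prodMk (ContDiffOn.fun_smul (ContDiffOn.fun_inv ?_ ?_) contDiffOn_snd)
    · exact contDiffOn_snd.norm ℝ fun p hp => hp.2
    · exact fun p hp => norm_ne_zero_iff.2 hp.2
  exact ContDiffOn.comp hg hc fun p hp =>
    ⟨hp.1, smul_ne_zero (inv_ne_zero (norm_ne_zero_iff.2 hp.2)) hp.2⟩

namespace HorExt

variable {T T' : ℝ → E3 → V}

theorem add (hT : G.HorExt T) (hT' : G.HorExt T') : G.HorExt fun u x => T u x + T' u x := by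
  obtain ⟨g, hg, e⟩ := hT
  obtain ⟨g', hg', e'⟩ := hT'
  exact ⟨_, hg.add hg', fun u x hu hx => congrArg₂ (· + ·) (e u x hu hx) (e' u x hu hx)⟩

theorem const_smul (hT : G.HorExt T) (c : ℝ) : G.HorExt fun u x => c • T u x := by
  obtain ⟨g, hg, e⟩ := hT
  exact ⟨_, hg.const_smul (c := fun _ => c) contDiffOn_const, fun u x hu hx =>
    congrArg (c • ·) (e u x hu hx)⟩

theorem nabla {n : ℕ} {T : ℝ → E3 → Tensor n} (hT : G.HorExt T) :
    G.HorExt fun u => nabla (T u) := by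
  obtain ⟨g, hg, e⟩ := hT
  exact ⟨_, hg.nabla uniqueDiffOn_kru, fun u x hu hx =>
    nabla_congr (fun y hy => e u y hu hy) (ne_zero_of_norm_one hx)⟩

theorem sdiv {n : ℕ} {T : ℝ → E3 → Tensor (n + 1)} (hT : G.HorExt T) :
    G.HorExt fun u => sdiv (T u) := by
  obtain ⟨g, hg, e⟩ := hT
  exact ⟨_, hg.sdiv uniqueDiffOn_kru, fun u x hu hx =>
    sdiv_congr (fun y hy => e u y hu hy) (ne_zero_of_norm_one hx)⟩

theorem sphSmooth (hM : |G.Q| < G.M) (hT : G.HorExt T) (hu : G.u₀ ≤ u) : SphSmooth (T u) := by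
  obtain ⟨g, hg, e⟩ := hT
  exact (hg.slice (kru_mem hM hu)).congr fun x hx => e u x hu hx

theorem exists_norm_le (hM : |G.Q| < G.M) (hT : G.HorExt T) :
    ∃ C, ∀ u x, G.u₀ ≤ u → ‖x‖ = 1 → ‖T u x‖ ≤ C := by
  obtain ⟨g, hg, e⟩ := hT
  obtain ⟨C, hC⟩ := (isCompact_Icc.prod (isCompact_sphere (0 : E3) 1)).exists_bound_of_continuousOn
    hg.continuousOn
  exact ⟨C, fun u x hu hx => by
    rw [e u x hu hx]
    exact hC (G.kru u, x) ⟨kru_mem hM hu, by simpa using hx⟩⟩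

/-- An extension vanishing on the horizon is of first order in `U`. -/
theorem exists_norm_le_kru (hM : |G.Q| < G.M) {g : ℝ → E3 → V}
    (hg : FamSmooth (Icc 0 (G.kru G.u₀)) g) (h0 : ∀ x, ‖x‖ = 1 → g 0 x = 0) :
    ∃ C, ∀ u x, G.u₀ ≤ u → ‖x‖ = 1 → ‖g (G.kru u) x‖ ≤ C * G.kru u := by
  set s := Icc 0 (G.kru G.u₀) with hs
  set F : ℝ × E3 → V := fun p => ext (g p.1) p.2 with hF
  -- The U-derivative is continuous on a compact set, hence bounded, and the mean value inequality
  -- from U = 0 gives the factor U.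
  have hc : ContinuousOn (fun p => fderivWithin ℝ F (s ×ˢ {0}ᶜ) p (1, 0)) (s ×ˢ S2) := by
    have h1 : ContDiffOn ℝ ∞ (fun p => fderivWithin ℝ F (s ×ˢ {0}ᶜ) p (1, 0)) (s ×ˢ {0}ᶜ) :=
      (ContDiffOn.fderivWithin hg (uniqueDiffOn_fam uniqueDiffOn_kru) (by simp)).clm_apply
        contDiffOn_const
    exact h1.continuousOn.mono fun p hp => ⟨hp.1, ne_zero_of_norm_one (by simpa using hp.2)⟩
  obtain ⟨C, hC⟩ := (isCompact_Icc.prod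
    (isCompact_sphere (0 : E3) 1)).exists_bound_of_continuousOn hc
  refine ⟨C, fun u x hu hx => ?_⟩
  have hx0 := ne_zero_of_norm_one hx
  have hd : ∀ t ∈ s, HasDerivWithinAt (fun t => g t x)
      (fderivWithin ℝ F (s ×ˢ {0}ᶜ) (t, x) (1, 0)) s t := fun t ht => by
    have hd : DifferentiableWithinAt ℝ F (s ×ˢ {0}ᶜ) (t, x) :=
      ContDiffOn.differentiableOn hg (by simp) _ ⟨ht, hx0⟩
    have h2 : HasDerivWithinAt (fun t : ℝ => (t, x)) (1, 0) s t :=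
      (hasDerivWithinAt_id _ _).prodMk (hasDerivWithinAt_const _ _ _)
    have h3 := hd.hasFDerivWithinAt.comp_hasDerivWithinAt t h2
      (show MapsTo (fun t : ℝ => (t, x)) s (s ×ˢ ({0}ᶜ : Set E3)) from fun t ht => ⟨ht, hx0⟩)
    refine h3.congr (fun t _ => ?_) ?_ <;> simp [hF, ext_of_norm_one _ hx]
  have hk := kru_mem hM hu
  have h4 := (convex_Icc 0 (G.kru G.u₀)).norm_image_sub_le_of_norm_hasDerivWithin_le
    (f := fun t => g t x) hd (fun t ht => hC (t, x) ⟨ht, by simpa using hx⟩)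
    (left_mem_Icc.2 kru_pos.le) hk
  simp only [h0 x hx, sub_zero] at h4
  rwa [Real.norm_of_nonneg hk.1] at h4

theorem tendsto_horizon (hM : |G.Q| < G.M) {g : ℝ → E3 → V}
    (hg : FamSmooth (Icc 0 (G.kru G.u₀)) g) (hx : ‖x‖ = 1) :
    Tendsto (fun u => g (G.kru u) x) atTop (𝓝 (g 0 x)) := by
  have hc : ContinuousWithinAt (fun t => g t x) (Icc 0 (G.kru G.u₀)) 0 := by
    have : ContinuousOn (fun t => g t x) (Icc 0 (G.kru G.u₀)) :=
      hg.continuousOn.comp (f := fun t : ℝ => (t, x)) (by fun_prop)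
        fun t ht => ⟨ht, by simpa using hx⟩
    exact this 0 (left_mem_Icc.2 kru_pos.le)
  have ht : Tendsto G.kru atTop (𝓝[Icc 0 (G.kru G.u₀)] 0) :=
    tendsto_nhdsWithin_iff.2 ⟨tendsto_kru hM, by
      filter_upwards [eventually_ge_atTop G.u₀] with u hu using kru_mem hM hu⟩
  exact hc.tendsto.comp ht

theorem exists_tendsto (hM : |G.Q| < G.M) (hT : G.HorExt T) (hx : ‖x‖ = 1) :
    ∃ L, Tendsto (fun u => T u x) atTop (𝓝 L) := by
  obtain ⟨g, hg, e⟩ := hT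
  refine ⟨_, (tendsto_horizon hM hg hx).congr' ?_⟩
  filter_upwards [eventually_ge_atTop G.u₀] with u hu
  exact (e u x hu hx).symm

theorem tsq {n : ℕ} {T : ℝ → E3 → Tensor n} (hT : G.HorExt T) :
    G.HorExt fun u x => tsq (T u x) := by
  obtain ⟨g, hg, e⟩ := hT
  exact ⟨_, hg.tsq, fun u x hu hx => congrArg RN.tsq (e u x hu hx)⟩

theorem apply {n : ℕ} {T : ℝ → E3 → Tensor n} (hT : G.HorExt T) (I : Fin n → Fin 3) :
    G.HorExt fun u x => T u x I := by
  obtain ⟨g, hg, e⟩ := hT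
  exact ⟨_, hg.apply I, fun u x hu hx => congrFun (e u x hu hx) I⟩

end HorExt

end HorExt

end Geom

namespace Geom

variable {G : Geom} {S : Pert} {u v u₁ : ℝ} {x : E3}

/-! ## Orders of vanishing at the event horizon -/

/-- `f = O(U^k)` at the event horizon, uniformly on the initial ingoing cone. -/
def Ord (G : Geom) (k : ℕ) (f : ℝ → E3 → ℝ) : Prop :=
  ∃ C : ℝ, ∀ u x, G.u₀ ≤ u → ‖x‖ = 1 → |f u x| ≤ C * G.kru u ^ k

namespace Ord

variable {f g : ℝ → E3 → ℝ} {k j : ℕ}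

theorem congr (hf : G.Ord k f) (h : ∀ u x, G.u₀ ≤ u → ‖x‖ = 1 → g u x = f u x) : G.Ord k g := by
  obtain ⟨C, hC⟩ := hf
  exact ⟨C, fun u x hu hx => by rw [h u x hu hx]; exact hC u x hu hx⟩

theorem add (hf : G.Ord k f) (hg : G.Ord k g) : G.Ord k fun u x => f u x + g u x := by
  obtain ⟨C, hC⟩ := hf
  obtain ⟨D, hD⟩ := hg
  exact ⟨C + D, fun u x hu hx => (abs_add_le _ _).trans
    ((add_le_add (hC u x hu hx) (hD u x hu hx)).trans_eq (by ring))⟩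

theorem mul (hf : G.Ord j f) (hg : G.Ord k g) : G.Ord (j + k) fun u x => f u x * g u x := by
  obtain ⟨C, hC⟩ := hf
  obtain ⟨D, hD⟩ := hg
  refine ⟨C * D, fun u x hu hx => ?_⟩
  rw [abs_mul]
  exact (mul_le_mul (hC u x hu hx) (hD u x hu hx) (abs_nonneg _)
    ((abs_nonneg _).trans (hC u x hu hx))).trans_eq (by ring)

theorem const (c : ℝ) : G.Ord 0 fun _ _ => c := ⟨|c|, fun _ _ _ _ => by simp⟩

theorem mul_zero (hf : G.Ord k f) (hg : G.Ord 0 g) : G.Ord k fun u x => f u x * g u x := hf.mul hg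

theorem zero_mul (hf : G.Ord 0 f) (hg : G.Ord k g) : G.Ord k fun u x => f u x * g u x :=
  (hg.mul_zero hf).congr fun _ _ _ _ => mul_comm _ _

theorem const_mul (hf : G.Ord k f) (c : ℝ) : G.Ord k fun u x => c * f u x := (const c).zero_mul hf

theorem sub (hf : G.Ord k f) (hg : G.Ord k g) : G.Ord k fun u x => f u x - g u x :=
  (hf.add (hg.const_mul (-1))).congr fun _ _ _ _ => by ring

theorem of_succ (hM : |G.Q| < G.M) (hf : G.Ord (k + 1) f) : G.Ord k f := by
  obtain ⟨C, hC⟩ := hf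
  refine ⟨|C| * G.kru G.u₀, fun u x hu hx => (hC u x hu hx).trans ?_⟩
  have hk : 0 ≤ G.kru u := kru_pos.le
  have := kru_le hM hu
  calc C * G.kru u ^ (k + 1) ≤ |C| * G.kru u ^ (k + 1) :=
        mul_le_mul_of_nonneg_right (le_abs_self C) (by positivity)
    _ = |C| * G.kru u * G.kru u ^ k := by ring
    _ ≤ _ := by gcongr

end Ord

theorem ord_r (hM : |G.Q| < G.M) : G.Ord 0 fun u _ => G.r u G.v₀ :=
  ⟨G.r G.u₀ G.v₀, fun u _ hu _ => by
    rw [abs_of_pos (r_pos hM _ _), pow_zero, mul_one]; exact r_mono hM hu le_rfl⟩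

theorem ord_r_sub (hM : |G.Q| < G.M) : G.Ord 1 fun u _ => G.r u G.v₀ - rPlus G.M G.Q := by
  obtain ⟨C, -, hC⟩ := exists_r_sub_rPlus hM
  exact ⟨C, fun u _ hu _ => by
    rw [abs_of_pos (sub_pos.2 (r_gt hM _ _)), pow_one]; exact (hC u hu).1⟩

theorem ord_Om_sq (hM : |G.Q| < G.M) : G.Ord 1 fun u _ => G.Om u G.v₀ ^ 2 := by
  obtain ⟨C, -, hC⟩ := exists_Om_sq_kru hM
  exact ⟨C, fun u _ hu _ => by rw [abs_of_nonneg (sq_nonneg _), pow_one]; exact (hC u hu).1⟩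

theorem HorExt.ord (hM : |G.Q| < G.M) {f : ℝ → E3 → ℝ} (h : G.HorExt f) : G.Ord 0 f := by
  obtain ⟨C, hC⟩ := h.exists_norm_le hM
  exact ⟨C, fun u x hu hx => by rw [pow_zero, mul_one]; exact hC u x hu hx⟩

/-- A family of sphere functions which is `O(U^k)` together with its Laplacian. -/
structure LapOrd (G : Geom) (k : ℕ) (T : ℝ → E3 → Tensor 0) : Prop where
  smooth : ∀ u, G.u₀ ≤ u → SphSmooth (T u)
  ord : G.Ord k fun u x => T u x ![]
  lap : G.Ord k fun u x => sdiv (nabla (T u)) x ![]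

namespace LapOrd

variable {T T' : ℝ → E3 → Tensor 0} {k j : ℕ}

theorem congr (hT : G.LapOrd k T) (h : ∀ u x, G.u₀ ≤ u → ‖x‖ = 1 → T' u x = T u x) :
    G.LapOrd k T' :=
  ⟨fun u hu => (hT.smooth u hu).congr fun x hx => h u x hu hx,
    hT.ord.congr fun u x hu hx => congrFun (h u x hu hx) _,
    hT.lap.congr fun u _ hu hx =>
      congrFun (laplacian_congr (fun y hy => h u y hu hy) (ne_zero_of_norm_one hx)) _⟩

theorem add (hT : G.LapOrd k T) (hT' : G.LapOrd k T') : G.LapOrd k fun u x => T u x + T' u x :=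
  ⟨fun u hu => (hT.smooth u hu).add (hT'.smooth u hu), hT.ord.add hT'.ord,
    (hT.lap.add hT'.lap).congr fun u _ hu hx => congrFun
      (laplacian_add (hT.smooth u hu) (hT'.smooth u hu) (ne_zero_of_norm_one hx)) _⟩

theorem smul {c : ℝ → ℝ} (hc : G.Ord j fun u _ => c u) (hT : G.LapOrd k T) :
    G.LapOrd (j + k) fun u x => c u • T u x :=
  ⟨fun u hu => (hT.smooth u hu).const_smul _, hc.mul hT.ord,
    (hc.mul hT.lap).congr fun u x _ _ => congrFun (laplacian_const_smul (c u) (T u) x) _⟩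

theorem const_smul (hT : G.LapOrd k T) (c : ℝ) : G.LapOrd k fun u x => c • T u x :=
  ⟨fun u hu => (hT.smooth u hu).const_smul _, hT.ord.const_mul c,
    (hT.lap.const_mul c).congr fun u x _ _ => congrFun (laplacian_const_smul c (T u) x) _⟩

theorem sub (hT : G.LapOrd k T) (hT' : G.LapOrd k T') : G.LapOrd k fun u x => T u x - T' u x :=
  (hT.add (hT'.const_smul (-1))).congr fun _ _ _ _ => by module

end LapOrd

theorem HorExt.lapOrd (hM : |G.Q| < G.M) {T : ℝ → E3 → Tensor 0} (h : G.HorExt T) :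
    G.LapOrd 0 T :=
  ⟨fun _ hu => h.sphSmooth hM hu, (h.apply ![]).ord hM, (h.nabla.sdiv.apply ![]).ord hM⟩

/-- The limit at the horizon is the extension at U = 0, so that slice vanishes on the whole sphere
and so does its Laplacian. Smoothness in U then gives one order for both. -/
theorem HorExt.lapOrd_one (hM : |G.Q| < G.M) {T : ℝ → E3 → Tensor 0} (h : G.HorExt T)
    (h0 : ∀ x, ‖x‖ = 1 → Tendsto (fun u => T u x) atTop (𝓝 0)) : G.LapOrd 1 T := by
  refine ⟨fun u hu => h.sphSmooth hM hu, ?_, ?_⟩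
  all_goals
    obtain ⟨g, hg, e⟩ := h
    have hz : ∀ x, ‖x‖ = 1 → g 0 x = 0 := fun x hx => by
      refine tendsto_nhds_unique (tendsto_horizon hM hg hx) ((h0 x hx).congr' ?_)
      filter_upwards [eventually_ge_atTop G.u₀] with u hu
      exact e u x hu hx
  · obtain ⟨C, hC⟩ := exists_norm_le_kru hM hg hz
    refine ⟨C, fun u x hu hx => ?_⟩
    simp only [pow_one, e u x hu hx]
    exact (norm_le_pi_norm (g (G.kru u) x) ![]).trans (hC u x hu hx)
  · have hz' : ∀ x, ‖x‖ = 1 → RN.sdiv (RN.nabla (g 0)) x = 0 := fun x hx => by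
      rw [laplacian_congr (B := fun y => (0 : ℝ) • g 0 y) (fun y hy => by simp [hz y hy])
        (ne_zero_of_norm_one hx), laplacian_const_smul, zero_smul]
    obtain ⟨C, hC⟩ := exists_norm_le_kru hM
      ((hg.nabla uniqueDiffOn_kru).sdiv uniqueDiffOn_kru) hz'
    refine ⟨C, fun u x hu hx => ?_⟩
    simp only [pow_one, laplacian_congr (fun y hy => e u y hu hy) (ne_zero_of_norm_one hx)]
    exact (norm_le_pi_norm (RN.sdiv (RN.nabla (g (G.kru u))) x) ![]).trans (hC u x hu hx)

theorem Ord.tendsto_zero (hM : |G.Q| < G.M) {f : ℝ → E3 → ℝ} (hf : G.Ord 1 f) (hx : ‖x‖ = 1) :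
    Tendsto (fun u => f u x) atTop (𝓝 0) := by
  obtain ⟨C, hC⟩ := hf
  refine squeeze_zero_norm' ?_ (by simpa using (tendsto_kru hM).const_mul C)
  filter_upwards [eventually_ge_atTop G.u₀] with u hu
  simpa using hC u x hu hx

/-- Integration of the derivative along the ingoing cone improves the order of vanishing. -/
theorem LapOrd.of_dU (hM : |G.Q| < G.M) {H : SField 0} (hH : G.Smooth H)
    (h1 : G.LapOrd 1 fun u => H u G.v₀) (h2 : G.LapOrd 2 fun u => G.dU H u G.v₀) :
    G.LapOrd 2 fun u => H u G.v₀ := by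
  have hk : 0 < 4 * G.kappa := by have := kappa_pos hM; positivity
  -- U² decays at rate 4κ, so integration in u from the horizon costs a factor 1/(4κ) but no power
  -- of U.
  have e : ∀ u, G.kru u ^ 2 = Real.exp (-(4 * G.kappa * u)) := fun u => by
    rw [kru, ← Real.exp_nat_mul]; congr 1; push_cast; ring
  have gen : ∀ f f' : ℝ → E3 → ℝ, G.Ord 1 f → G.Ord 2 f' →
      (∀ u x, G.u₀ ≤ u → ‖x‖ = 1 → HasDerivWithinAt (fun u => f u x) (f' u x) (Ici G.u₀) u) →
      G.Ord 2 f := fun f f' hf hf' hd => by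
    obtain ⟨C, hC⟩ := hf'
    refine ⟨C / (4 * G.kappa), fun u x hu hx => ?_⟩
    rw [e]
    exact abs_le_of_deriv_le_exp (h := fun u => f u x) hk (fun u hu => hd u x hu hx)
      (fun u hu => e u ▸ hC u x hu hx) (hf.tendsto_zero hM hx) hu
  refine ⟨h1.smooth, gen _ _ h1.ord h2.ord fun u x hu hx => ?_, gen _ _ h1.lap h2.lap
    fun u x hu hx => ?_⟩
  · exact hasDerivWithinAt_pi.1 (Smooth.hasDerivWithinAt_dU hH hu le_rfl hx) ![]
  · have h := hasDerivWithinAt_pi.1 (Smooth.hasDerivWithinAt_dU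
      (Smooth.nabla hH).sdiv hu (le_refl G.v₀) hx) ![]
    refine h.congr_deriv ?_
    rw [Smooth.dU_sdiv (Smooth.nabla hH) hu le_rfl hx]
    exact congrFun (sdiv_congr (fun y hy => Smooth.dU_nabla hH hu le_rfl hy)
      (ne_zero_of_norm_one hx)) ![]

/-! ## Regular data have bounded data energy -/

/-- The field `Ω² λ`. -/
def lapseLam (G : Geom) (S : Pert) : SField 0 := G.r ⊙ S.otx - (4 * G.Om ^ 2) ⊙ S.lO

theorem smooth_lapseLam (hM : |G.Q| < G.M) (hS : G.IsSolution S) : G.Smooth (lapseLam G S) :=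
  Smooth.sub (Smooth.mulF (contDiffOn_r hM) hS.smooth.otx) (Smooth.mulF (c := 4 * G.Om ^ 2)
    (contDiffOn_const.mul ((contDiffOn_Om hM).pow 2)) hS.smooth.lO)

/-- The combination rτ - 4Ω²`lO` is adapted to the horizon: the undifferentiated τ terms cancel, as
do the `lO` terms, because rρ = -2ω for the background. Every surviving term carries a factor Ω²
times a quantity that vanishes at the horizon for normalised regular data. -/
theorem dU_lapseLam (hS : G.IsSolution S) (p : G.Pt u v x) : G.dU (lapseLam G S) u v x =
    G.Om u v ^ 2 • ((2 : ℝ) • (sdiv (S.eta u v) x + G.r u v • S.rho u v x)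
      - S.otxb u v x - (4 : ℝ) • S.omb u v x) := by
  have hr := p.r_ne
  have ru := (hasDerivAt_r_u p.sub u v).hasDerivWithinAt (s := Ici G.u₀)
  have Ou := (hasDerivAt_Om_u p.sub u v).hasDerivWithinAt (s := Ici G.u₀)
  have h := (ru.fun_smul (Smooth.hasDerivWithinAt_dU hS.smooth.otx p.u p.v p.x)).fun_sub
    (((Ou.fun_pow 2).const_mul 4).fun_smul (Smooth.hasDerivWithinAt_dU hS.smooth.lO p.u p.v p.x))
  have h' : G.dU (lapseLam G S) u v x = _ := h.derivWithin (uniqueDiffOn_Ici _ _ p.u)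
  rw [h', dU_otx hS p, hS.nullStructure.lO_u u v x p.u p.v p.x]
  funext I
  simp [rho, om]
  field_simp
  ring

theorem lam_eq_lapseLam (p : G.Pt u v x) :
    G.Om u v ^ 2 * G.lam S u v x ![] = lapseLam G S u v x ![] := by
  have hO := p.Om_ne
  rw [lam_eq]
  simp [lapseLam, mulF]
  field_simp

/-- By `laplacian_lO`, the `lO` part of the Laplacian replaces div η̲ by -div η. This reduces the
vanishing of Ω²X to that of the Laplacian of Ω²λ and of div η + ρ, where the normalisation applies.
-/
theorem X_eq_lapseLam (hS : G.IsSolution S) (p : G.Pt u v x) :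
    G.Om u v ^ 2 * G.X S u v x ![] = G.r u v * sdiv (nabla (lapseLam G S u v)) x ![]
      + 2 * G.r u v ^ 2 * (G.Om u v ^ 2 *
        (sdiv (S.eta u v) x ![] + G.r u v * S.rho u v x ![])) := by
  have hO := p.Om_ne
  have h1 := hS.smooth.otx.slice p.u p.v
  have h2 := hS.smooth.lO.slice p.u p.v
  have e : sdiv (nabla (lapseLam G S u v)) x = G.r u v • sdiv (nabla (S.otx u v)) x
      + (-(4 * G.Om u v ^ 2)) • sdiv (nabla (S.lO u v)) x := by
    rw [laplacian_congr (B := fun y => G.r u v • S.otx u v y + (-(4 * G.Om u v ^ 2)) • S.lO u v y)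
      (fun y _ => ?_) p.ne, laplacian_add (h1.const_smul _) (h2.const_smul _) p.ne,
      laplacian_const_smul, laplacian_const_smul]
    rw [neg_smul, ← sub_eq_add_neg]
    rfl
  rw [X_eq p, e]
  simp only [Pi.add_apply, Pi.sub_apply, Pi.smul_apply, smul_eq_mul, laplacian_lO hS p]
  field_simp
  ring

/-- The radius is frozen at r₊ to obtain a field with a smooth extension; it vanishes at the horizon
by the normalisation of div η + ρ, and the remainder (r - r₊)ρ is O(U) by itself. -/
theorem ord_sdiv_eta_add (hM : |G.Q| < G.M) (hN : G.PartiallyNormalised S) (hR : G.RegularData S) :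
    G.LapOrd 1 fun u x => sdiv (S.eta u G.v₀) x + G.r u G.v₀ • S.rho u G.v₀ x := by
  have hrho := hR.rho.horExt
  have hA : G.HorExt fun u x => sdiv (S.eta u G.v₀) x + rPlus G.M G.Q • S.rho u G.v₀ x :=
    hR.eta.horExt.sdiv.add (hrho.const_smul _)
  refine ((hA.lapOrd_one hM fun x hx => ?_).add
    (LapOrd.smul (ord_r_sub hM) (hrho.lapOrd hM))).congr fun u x _ _ => by module
  obtain ⟨L, hL⟩ := hrho.exists_tendsto hM hx
  have hr := tendsto_r_horizon hM
  have h1 := hr.smul (hN.mu_horizon x hx)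
  have h2 := (hr.const_sub (rPlus G.M G.Q)).smul hL
  have h3 := h1.add h2
  rw [smul_zero, sub_self, zero_smul, add_zero] at h3
  refine h3.congr fun u => ?_
  have hr := (r_pos hM u G.v₀).ne'
  funext I
  simp [div, mulF]
  field_simp
  ring

/-- The field is O(U) since τ vanishes at the horizon. Its u-derivative is Ω² times a sum of O(U)
terms, `otxb` and `omb` being Ω² times regular quantities. Integration from the horizon then gains a
full order. -/
theorem lapOrd_lapseLam (hM : |G.Q| < G.M) (hS : G.IsSolution S) (hN : G.PartiallyNormalised S)
    (hR : G.RegularData S) : G.LapOrd 2 fun u => lapseLam G S u G.v₀ := by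
  have hf := ord_Om_sq hM
  refine LapOrd.of_dU hM (smooth_lapseLam hM hS) ?_ ?_
  · have h1 := LapOrd.smul (ord_r hM) (hR.otx.horExt.lapOrd_one hM hN.otx_horizon)
    have h2 := LapOrd.smul hf (hR.lO.horExt.lapOrd hM)
    refine (h1.sub (h2.const_smul 4)).congr fun u x _ _ => ?_
    rw [smul_smul]
    rfl
  · have h1 := ord_sdiv_eta_add hM hN hR
    have h2 := LapOrd.smul hf (hR.otxb.horExt.lapOrd hM)
    have h3 := LapOrd.smul hf (hR.omb.horExt.lapOrd hM)
    refine (LapOrd.smul hf (((h1.const_smul 2).sub h2).sub (h3.const_smul 4))).congr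
      fun u x hu hx => ?_
    rw [dU_lapseLam hS ⟨hM, hu, le_rfl, hx⟩]
    have hO : G.Om u G.v₀ ^ 2 ≠ 0 := pow_ne_zero 2 (Om_pos hM _ _).ne'
    simp only [mulF, Pi.inv_apply, Pi.pow_apply, smul_smul, mul_inv_cancel₀ hO, one_smul]

/-- A scalar `y` with `Ω² y = O(U²)` has `Ω⁻¹ y` bounded on the initial ingoing cone. -/
theorem bddAbove_normSq_inv_Om (hM : |G.Q| < G.M) {T : SField 0}
    (h : G.Ord 2 fun u x => G.Om u G.v₀ ^ 2 * T u G.v₀ x ![]) :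
    ∃ C, ∀ u, G.u₀ ≤ u → normSq (G.Om⁻¹ ⊙ T) u G.v₀ ≤ C := by
  obtain ⟨C, hC⟩ := h
  obtain ⟨D, hD0, hD⟩ := exists_Om_sq_kru hM
  refine ⟨C ^ 2 * D ^ 3 * G.kru G.u₀ * sphArea, fun u hu => ?_⟩
  refine (le_abs_self _).trans (abs_sphInt_le fun x hx => ?_)
  have hk : 0 < G.kru u := kru_pos
  have hf : 0 < G.Om u G.v₀ ^ 2 := pow_pos (Om_pos hM _ _) 2
  have h1 := hC u x hu hx
  have h2 := (hD u hu).2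
  have e : tsq ((G.Om⁻¹ ⊙ T) u G.v₀ x) = (G.Om u G.v₀ ^ 2)⁻¹ * T u G.v₀ x ![] ^ 2 := by
    rw [tsq_zero_rank]
    simp [mulF]
    ring
  rw [abs_of_nonneg (tsq_nonneg _), e]
  set f := G.Om u G.v₀ ^ 2
  set y := T u G.v₀ x ![]
  set U := G.kru u
  -- Ω⁻²T² equals (Ω²T)²/Ω⁶, which is at most C²U⁴·D³/U³: one power of U is to spare.
  have h3 : f ^ 2 * y ^ 2 ≤ C ^ 2 * U ^ 4 := by
    have := pow_le_pow_left₀ (abs_nonneg _) h1 2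
    rw [sq_abs] at this
    nlinarith
  have h4 : U ^ 3 ≤ D ^ 3 * f ^ 3 := by
    have := pow_le_pow_left₀ hk.le h2 3
    rwa [mul_pow] at this
  have h5 : f⁻¹ * y ^ 2 = f ^ 2 * y ^ 2 / f ^ 3 := by field_simp
  rw [h5, div_le_iff₀ (by positivity)]
  calc f ^ 2 * y ^ 2 ≤ C ^ 2 * U ^ 4 := h3
    _ = C ^ 2 * U * U ^ 3 := by ring
    _ ≤ C ^ 2 * G.kru G.u₀ * (D ^ 3 * f ^ 3) := by
      have := kru_le hM hu
      have : 0 < G.kru G.u₀ := kru_pos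
      gcongr
    _ = _ := by ring

/-- One factor Ω² can be extracted everywhere: Ωχ̲̂ and β̲_F are Ω² and Ω times regular fields, the
η, σ_F and ρ_F terms carry Ω² explicitly, and `otxb` is Ω² times a regular scalar. -/
theorem ord_inField (hM : |G.Q| < G.M) (hR : G.RegularData S) :
    G.Ord 1 fun u x => inField G S u G.v₀ x := by
  have hf := ord_Om_sq hM
  have hf0 := hf.of_succ hM
  have hr := ord_r hM
  have a1 := hR.chib.horExt.tsq.ord hM
  have a2 := hR.eta.horExt.tsq.ord hM
  have a3 := hR.betabF.horExt.tsq.ord hM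
  have a4 := hR.sigmaF.horExt.tsq.ord hM
  have a5 := hR.rhoF.horExt.tsq.ord hM
  have a6 := (hR.otxb.horExt.apply ![]).ord hM
  have a7 := (hR.rho.horExt.apply ![]).ord hM
  have a8 := (hR.eta.horExt.sdiv.apply ![]).ord hM
  refine (hf.mul_zero ((hr.zero_mul hr).zero_mul ((((hf0.zero_mul a1).add
    ((((a2.add (hf0.zero_mul a3)).add a4).add a5).const_mul 2))).sub
    (a6.zero_mul ((hr.zero_mul a7).add a8))))).congr fun u x hu hx => ?_
  have hO := (Om_pos hM u G.v₀).ne'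
  rw [inField_eq ⟨hM, hu, le_rfl, hx⟩]
  simp only [mulF, tsq_smul, tinner_zero, Pi.inv_apply, Pi.pow_apply, Pi.smul_apply, Pi.add_apply,
    smul_eq_mul]
  field_simp

/-- The density is O(U), and the integral of U = e^{-2κu} over [u₀, ∞) is finite. -/
theorem exists_inFlux_le (hM : |G.Q| < G.M) (hS : G.IsSolution S) (hR : G.RegularData S) :
    ∃ C, ∀ u₁, G.u₀ ≤ u₁ → G.inFlux S u₁ ≤ C := by
  obtain ⟨C, hC⟩ := ord_inField hM hR
  have hk := kappa_pos hM
  refine ⟨|C| * sphArea * (G.kru G.u₀ / (2 * G.kappa)), fun u₁ hu => ?_⟩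
  have hd : ∀ u, HasDerivAt (fun u => -(G.kru u / (2 * G.kappa))) (G.kru u) u := fun u =>
    ((((hasDerivAt_id u).const_mul (2 * G.kappa)).fun_neg.exp).div_const (2 * G.kappa)).fun_neg
      |>.congr_deriv (by simp only [id_eq, mul_one, kru]; field_simp)
  have hc : Continuous G.kru := by unfold kru; fun_prop
  have hi : ∫ u in G.u₀..u₁, G.kru u = (G.kru G.u₀ - G.kru u₁) / (2 * G.kappa) := by
    rw [intervalIntegral.integral_eq_sub_of_hasDerivAt (fun u _ => hd u)
      (hc.intervalIntegrable _ _)]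
    ring
  have i1 := intervalIntegrable_sphInt_u (famSmooth_inField hM hS) (le_refl G.v₀) hu
  have i2 : IntervalIntegrable (fun u => |C| * sphArea * G.kru u) volume G.u₀ u₁ :=
    (hc.const_mul _).intervalIntegrable _ _
  refine (intervalIntegral.integral_mono_on hu i1 i2 fun u hu' => ?_).trans ?_
  · refine (le_abs_self _).trans ((abs_sphInt_le (C := |C| * G.kru u) fun x hx => ?_).trans_eq
      (by ring))
    refine (hC u x hu'.1 hx).trans ?_
    rw [pow_one]
    exact mul_le_mul_of_nonneg_right (le_abs_self C) kru_pos.le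
  · rw [intervalIntegral.integral_const_mul, hi]
    have := sphArea_nonneg
    have : 0 ≤ G.kru u₁ := kru_pos.le
    gcongr
    linarith

theorem bddAbove_dataEnergy (hM : |G.Q| < G.M) (hS : G.IsSolution S)
    (hN : G.PartiallyNormalised S) (hR : G.RegularData S) {Λ : ℝ} (hΛ : 0 ≤ Λ) :
    BddAbove (G.dataEnergy Λ S '' Ici G.u₀) := by
  have hH := lapOrd_lapseLam hM hS hN hR
  have hE := ord_sdiv_eta_add hM hN hR
  obtain ⟨A, hA⟩ := exists_inFlux_le hM hS hR
  obtain ⟨B, hB⟩ := bddAbove_normSq_inv_Om (T := G.lam S) hM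
    (hH.ord.congr fun u x hu hx => lam_eq_lapseLam ⟨hM, hu, le_rfl, hx⟩)
  obtain ⟨C, hC⟩ := bddAbove_normSq_inv_Om (T := G.X S) hM
    ((((ord_r hM).zero_mul hH.lap).add ((((ord_r hM).zero_mul (ord_r hM)).const_mul 2).zero_mul
      ((ord_Om_sq hM).mul hE.ord))).congr fun u x hu hx => by
        rw [X_eq_lapseLam hS ⟨hM, hu, le_rfl, hx⟩]
        simp only [Pi.add_apply, Pi.smul_apply, smul_eq_mul]
        ring)
  refine ⟨G.outFlux S + A + Λ * (B + C), ?_⟩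
  rintro _ ⟨u, hu, rfl⟩
  exact add_le_add (add_le_add_right (hA u hu) _)
    (mul_le_mul_of_nonneg_left (add_le_add (hB u hu) (hC u hu)) hΛ)

end Geom

end RN

end

/-! ### Assembly of the theorem. -/

theorem theorem3p2 (M Q : ℝ) (hQ : |Q| < √15 / 4 * M) :
    ∃ C Λ : ℝ, 0 < C ∧ 1 ≤ Λ ∧
      ∀ G : RN.Geom, G.M = M → G.Q = Q →
      ∀ S : RN.Pert, G.IsSolution S → G.PartiallyNormalised S → G.DecayAssumptions S →
        MeasureTheory.IntegrableOn (G.outDensity S G.u₀) (Set.Ioi G.v₀) ∧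
        (∀ u₁ : ℝ, G.u₀ ≤ u₁ →
          MeasureTheory.IntegrableOn (G.masterDensity S u₁) (Set.Ioi G.v₀) ∧
          ∃ (Xinf : RN.E3 → RN.Tensor 0) (F : ℝ),
            (∀ x, ‖x‖ = 1 →
              Filter.Tendsto (fun v => G.X S u₁ v x) Filter.atTop (nhds (Xinf x))) ∧
            Filter.Tendsto (fun v => G.radFlux S u₁ v) Filter.atTop (nhds F) ∧
            G.masterEnergy S u₁ Xinf + F ≤ C * G.dataEnergy Λ S u₁) ∧
        (G.RegularData S → BddAbove (G.dataEnergy Λ S '' Set.Ici G.u₀)) := by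
  obtain ⟨hM, δ, c, h0, h1, hc, hr⟩ := RN.Geom.exists_coercivity hQ
  have hM0 : 0 < M := (abs_nonneg _).trans_lt hM
  have hΛ : 0 ≤ (1 + 36 * M ^ 2) / (2 * c) := by positivity
  -- Both constants are fixed before the corner and the solution are introduced; δ and c come from
  -- `exists_coercivity` and depend only on M and Q.
  refine ⟨1 + δ⁻¹ + 24 * M, 1 + (1 + 36 * M ^ 2) / (2 * c), by positivity, by linarith, ?_⟩
  rintro G rfl rfl S hS hN hD
  have hm : ∀ u v, c ≤ 6 * G.M - 8 * G.Q ^ 2 / ((1 - δ) * G.r u v) :=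
    fun u v => hr _ (RN.Geom.r_gt hM u v)
  refine ⟨RN.Geom.integrableOn_outDensity hM hS le_rfl (hD.stripBounds hM), fun u₁ hu => ?_,
    fun hR => RN.Geom.bddAbove_dataEnergy hM hS hN hR (by linarith)⟩
  refine ⟨RN.Geom.integrableOn_masterDensity hM hS hu (hD.stripBounds hM), ?_⟩
  have hX : ∀ x, ‖x‖ = 1 → ∃ L, Filter.Tendsto (fun v => G.X S u₁ v x) Filter.atTop (nhds L) :=
    fun x hx => RN.Geom.exists_tendsto_X hM hD hu hx
  choose! L hL using hX
  obtain ⟨F, hF⟩ := RN.Geom.exists_tendsto_radFlux hM hS hD hu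
  exact ⟨L, F, hL, hF, RN.Geom.masterEnergy_add_le hM h0 h1 hc hm hS hD hu hL hF⟩
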